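/- Let $V$ be a complex vector space of dimension $2n$, $n\ge 1$, with a symplectic (nondegenerate alternating bilinear) form $\omega$. Let $\operatorname{End}_{\operatorname{Sp}}V$ be the space of endomorphisms $A$ of $V$ with $\omega(Au,v)=-\omega(u,Av)$ for all $u,v\in V$ (equivalently, $\omega(A\,\cdot,\cdot)$ is symmetric), and let $$\mathcal N=\{A\in\operatorname{End}_{\operatorname{Sp}}V \mid A^{2n}=0\}$$ be the symplectic nilpotent cone, with its reduced structure. Let $Fl(V,\omega)$ be the variety of full isotropic flags $0=F_0\subset F_1\subset\dots\subset F_{2n}=V$, $\dim F_i=i$, $F_{2n-i}=F_i^{\perp}$. Then: 1. $\mathcal N$ is an algebraic variety (a Zariski closed, irreducible subset of $\operatorname{End}V$) of dimension $2n^2$. 2. For $A\in\operatorname{End}_{\operatorname{Sp}}V$, one has $A\in\mathcal N$ if and only if $\operatorname{tr}(A^{2r})=0$ for all $r=1,\dots,n$. 3. A point $A\in\mathcal N$ belongs to the smooth locus $\mathcal N^{sm}$ of $\mathcal N$ if and only if $\operatorname{rk}A=2n-1$. 4. The map $A\mapsto(\ker A^i)_{0\le i\le 2n}$ is a well-defined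 morphism $\pi:\mathcal N^{sm}\to Fl(V,\omega)$. It is a Zariski locally trivial fibration whose fibers are isomorphic, as algebraic varieties, to $(\mathbb C^*)^n\times\mathbb C^{n^2-n}$. -/

import Mathlib

noncomputable section

namespace SympCone

/-! ### Classical algebraic geometry over the complex numbers -/

section Affine

variable (W : Type*) [AddCommGroup W] [Module ℂ W]

/-- Polynomial functions on a complex vector space: the algebra generated by the linear forms. -/
def polyFun : Subalgebra ℂ (W → ℂ) :=
  Algebra.adjoin ℂ (Set.range fun φ : Module.Dual ℂ W => (φ : W → ℂ))

/-- The Zariski topology on a complex vector space: the non-vanishing loci of polynomial functions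
form a basis. -/
@[reducible] def zariski : TopologicalSpace W :=
  TopologicalSpace.generateFrom {U | ∃ p ∈ polyFun W, U = {w | p w ≠ 0}}

variable {W}

/-- Restriction of functions to `S`. -/
def restrictFun (S : Set W) : (W → ℂ) →ₐ[ℂ] (S → ℂ) where
  toFun f s := f s
  map_one' := rfl
  map_mul' _ _ := rfl
  map_zero' := rfl
  map_add' _ _ := rfl
  commutes' _ := rfl

/-- The coordinate ring of a (Zariski closed) subset `S` of a vector space: the algebra of functions
on `S` that are restrictions of polynomial functions. -/
def coordRing (S : Set W) : Subalgebra ℂ (S → ℂ) :=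
  (polyFun W).map (restrictFun S)

/-- The ideal of the functions in the coordinate ring of `S` that vanish at the point `a`. -/
def pointIdeal (S : Set W) (a : S) : Ideal (coordRing S) :=
  RingHom.ker ((Pi.evalAlgHom ℂ (fun _ : S => ℂ) a).comp (coordRing S).val)

instance pointIdeal_isPrime (S : Set W) (a : S) : (pointIdeal S a).IsPrime :=
  RingHom.ker_isPrime _

/-- The smooth locus of a Zariski closed set `S`: the points at which the local ring of `S`
is regular. -/
def smoothLocus (S : Set W) : Set W :=
  {a | ∃ h : a ∈ S, IsRegularLocalRing (Localization.AtPrime (pointIdeal S ⟨a, h⟩))}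

end Affine

/-- The data of a complex space with functions on the set `α`: a topology, and for every point `x`
the functions that are regular at `x`. Only the germ of a function at `x` matters, so functions are
taken to be defined everywhere. -/
structure AlgSpace (α : Type*) where
  top : TopologicalSpace α
  RegularAt : (α → ℂ) → α → Prop

namespace AlgSpace

variable {α β γ : Type*}

/-- The variety structure on a locally closed subset `S` of a vector space: the Zariski topology, and
the functions that are locally quotients of polynomial functions. -/
def quasiAffine {W : Type*} [AddCommGroup W] [Module ℂ W] (S : Set W) : AlgSpace S where
  top := TopologicalSpace.induced Subtype.val (zariski W)
  RegularAt f s := ∃ p ∈ polyFun W, ∃ q ∈ polyFun W, q s ≠ 0 ∧ ∀ t : S, q t ≠ 0 → f t = p t / q t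

/-- The structure induced on a locally closed subset: a function is regular at a point if it extends
locally to a regular function of the ambient space. -/
def restrict (X : AlgSpace α) (T : Set α) : AlgSpace T where
  top := TopologicalSpace.induced Subtype.val X.top
  RegularAt f t := ∃ g : α → ℂ, X.RegularAt g t ∧
    ∃ U : Set α, X.top.IsOpen U ∧ (t : α) ∈ U ∧ ∀ s : T, (s : α) ∈ U → f s = g s

/-- The quotient structure along a map `q`: a set is open when its preimage is, and a function is
regular at a point when its pullback is regular at all points above it. -/
def quotient (X : AlgSpace α) (q : α → β) : AlgSpace β where
  top := TopologicalSpace.coinduced q X.top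
  RegularAt f y := ∀ x, q x = y → X.RegularAt (f ∘ q) x

/-- On `U × V`, the function `h` is a finite sum of products of a regular function on `U` and a
regular function on `V`. -/
def IsTensorOn (X : AlgSpace α) (Y : AlgSpace β) (U : Set α) (V : Set β) (h : α × β → ℂ) : Prop :=
  ∃ (m : ℕ) (a : Fin m → α → ℂ) (b : Fin m → β → ℂ),
    (∀ i, ∀ x ∈ U, X.RegularAt (a i) x) ∧ (∀ i, ∀ y ∈ V, Y.RegularAt (b i) y) ∧
      ∀ x ∈ U, ∀ y ∈ V, h (x, y) = ∑ i, a i x * b i y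

/-- The product of two varieties: a basis of open sets is given by the non-vanishing loci in `U × V`
of functions in `𝒪(U) ⊗ 𝒪(V)`, and regular functions are locally quotients of such functions. -/
def prod (X : AlgSpace α) (Y : AlgSpace β) : AlgSpace (α × β) where
  top := TopologicalSpace.generateFrom
    {O | ∃ U V h, X.top.IsOpen U ∧ Y.top.IsOpen V ∧ IsTensorOn X Y U V h ∧
      O = {p | p.1 ∈ U ∧ p.2 ∈ V ∧ h p ≠ 0}}
  RegularAt f z := ∃ U V g h, X.top.IsOpen U ∧ Y.top.IsOpen V ∧ z.1 ∈ U ∧ z.2 ∈ V ∧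
    IsTensorOn X Y U V g ∧ IsTensorOn X Y U V h ∧ h z ≠ 0 ∧
      ∀ p : α × β, p.1 ∈ U → p.2 ∈ V → h p ≠ 0 → f p = g p / h p

/-- Morphisms are the continuous maps that pull back regular functions to regular functions. -/
def IsMorphism (X : AlgSpace α) (Y : AlgSpace β) (φ : α → β) : Prop :=
  @Continuous _ _ X.top Y.top φ ∧ ∀ x g, Y.RegularAt g (φ x) → X.RegularAt (g ∘ φ) x

/-- An isomorphism is a bijection that is a morphism in both directions. -/
def IsIso (X : AlgSpace α) (Y : AlgSpace β) (e : α ≃ β) : Prop :=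
  IsMorphism X Y e ∧ IsMorphism Y X e.symm

/-- `π` is a (Zariski locally trivial) fibration with fibre `Z`: it is a morphism, and every point of
the base has an open neighbourhood `U` such that `π⁻¹(U)` is isomorphic to `U × Z` over `U`. -/
def IsFibration (X : AlgSpace α) (Y : AlgSpace β) (Z : AlgSpace γ) (π : α → β) : Prop :=
  IsMorphism X Y π ∧
    ∀ y, ∃ U : Set β, Y.top.IsOpen U ∧ y ∈ U ∧
      ∃ e : ↥(π ⁻¹' U) ≃ ↥U × γ,
        IsIso (X.restrict (π ⁻¹' U)) ((Y.restrict U).prod Z) e ∧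
          ∀ x : ↥(π ⁻¹' U), ((e x).1 : β) = π x

end AlgSpace

/-! ### Symplectic linear algebra -/

section Symplectic

variable {V : Type*} [AddCommGroup V] [Module ℂ V]

/-- The symmetric symplectic endomorphisms: those `A` for which `ω (A u) v` is symmetric in `u, v`,
that is, `ω (A u) v = - ω u (A v)`. -/
def endSp (ω : LinearMap.BilinForm ℂ V) : Submodule ℂ (Module.End ℂ V) where
  carrier := {A | ∀ u v, ω (A u) v = - ω u (A v)}
  zero_mem' := by intro u v; simp
  add_mem' := by
    intro A B hA hB u v
    simp only [Set.mem_ofPred_eq] at hA hB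
    simp [hA u v, hB u v, add_comm]
  smul_mem' := by
    intro c A hA u v
    simp only [Set.mem_ofPred_eq] at hA
    simp [hA u v]

/-- The symplectic nilpotent cone of a symplectic space of dimension `2 * n`. -/
def nilCone (ω : LinearMap.BilinForm ℂ V) (n : ℕ) : Set (Module.End ℂ V) :=
  {A | A ∈ endSp ω ∧ A ^ (2 * n) = 0}

/-- Full isotropic flags `F 0 ⊂ F 1 ⊂ ⋯ ⊂ F (2 * n)` in a symplectic space of dimension `2 * n`:
`F i` has dimension `i`, and `F (2 * n - i)` is the symplectic orthogonal of `F i`. -/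
@[ext]
structure IsotropicFlag (ω : LinearMap.BilinForm ℂ V) (n : ℕ) where
  space : Fin (2 * n + 1) → Submodule ℂ V
  mono : Monotone space
  finrank_space : ∀ i, Module.finrank ℂ (space i) = i
  space_rev : ∀ i, space i.rev = ω.orthogonal (space i)

/-- The tuple `b` is a basis adapted to the flag `F`: its first `i` members span `F i`, for all `i`. -/
def IsAdapted {ω : LinearMap.BilinForm ℂ V} {n : ℕ} (b : Fin (2 * n) → V) (F : IsotropicFlag ω n) :
    Prop :=
  ∀ i : Fin (2 * n + 1), F.space i = Submodule.span ℂ (b '' {j | j.castSucc < i})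

/-- The bases of `V` that are adapted to some full isotropic flag. -/
def frames (ω : LinearMap.BilinForm ℂ V) (n : ℕ) : Set (Fin (2 * n) → V) :=
  {b | ∃ F : IsotropicFlag ω n, IsAdapted b F}

/-- The flag to which a frame is adapted (it is unique). -/
def frameFlag (ω : LinearMap.BilinForm ℂ V) (n : ℕ) (b : frames ω n) : IsotropicFlag ω n :=
  b.2.choose

/-- The isotropic flag variety `Fl(V, ω)`: the set of full isotropic flags with its structure of
homogeneous space, as the quotient of the variety of adapted bases by the group of changes of adapted
basis. -/
def flagVariety (ω : LinearMap.BilinForm ℂ V) (n : ℕ) : AlgSpace (IsotropicFlag ω n) :=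
  (AlgSpace.quasiAffine (frames ω n)).quotient (frameFlag ω n)

/-- The set `(ℂ^*)^n × ℂ^(n² - n)` inside a vector space. -/
def torusTimesAffine (n : ℕ) : Set ((Fin n → ℂ) × (Fin (n ^ 2 - n) → ℂ)) :=
  {z | ∀ i, z.1 i ≠ 0}

end Symplectic

end SympCone

end

/-! Geometrically, the cone is swept out by the nilradicals of the stabilizers of full isotropic
flags. Every nilpotent `A` in `endSp ω` shifts some full isotropic flag `F` (`exists_shifts`), and
`F` is unique, equal to the flag of kernels of powers, exactly when `A` is regular, that is `A ^ (2
* n - 1) ≠ 0`. In a symplectic basis adapted to `F`, an element of `endSp ω` is a symmetric matrix;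
shifting `F` means that the entries with `i + j ≥ 2 * n - 1` vanish, and regularity means in
addition that those with `i + j = 2 * n - 2` do not. By symmetry this leaves `n` nonzero and `n ^ 2
- n` free coordinates.

Equations. Odd powers of `A` lie in `endSp ω` and are traceless, so nilpotency amounts to `n` even
trace equations. With the linear equations of `endSp ω` this makes `2 * n ^ 2` equations in
dimension `4 * n ^ 2`, so every point of the cone has height at least `2 * n ^ 2`. For the reverse
bound and irreducibility, conjugating one nilradical by Cayley transforms of an opposite one gives a
polynomial map from an affine space of dimension `2 * n ^ 2`, dominant onto the cone
(`exists_isPolyMap_nilCone`). Two flags always have a common opposite, so any two points of the cone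
lie in the image of one such map.

Smoothness. All local rings have dimension `2 * n ^ 2`, so only the tangent space matters. At a
regular point the differentials of the traces bound it from above, and commutators bound it from
below, the centralizer having dimension at most `n`. Conversely, if the tangent space at a
non-regular point had that dimension, there would be `n` equations with independent differentials
there, and still at a nearby generic non-regular `b`. Any polynomial family of functionals that
kills commutators along the nilradical of a flag lies in the span of these differentials, since at
regular points there is only room for `n` (`mem_span_of_commutator`). But `b` has a kernel of
dimension at least two, and the odd powers of `b` together with the squares of kernel vectors give
more than `n` independent such functionals (`finrank_tangentSpace_ne`).

Fibration. A flag opposite to a fixed one has a canonical unitriangular symplectic basis `oppBasis`,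
which depends algebraically on the flag by Cramer's rule; coordinates in it trivialize the kernel
flag map over the open cell. -/

namespace SympCone

/-! ### Polynomial functions and polynomial maps on vector spaces. -/

section PolynomialMaps

variable {W W₁ W₂ W₃ : Type*} [AddCommGroup W] [Module ℂ W] [AddCommGroup W₁] [Module ℂ W₁]
  [AddCommGroup W₂] [Module ℂ W₂] [AddCommGroup W₃] [Module ℂ W₃]

lemma dual_mem_polyFun (l : Module.Dual ℂ W) : (fun w => l w) ∈ polyFun W :=
  Algebra.subset_adjoin ⟨l, rfl⟩

lemma const_mem_polyFun (c : ℂ) : (fun _ : W => c) ∈ polyFun W :=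
  (polyFun W).algebraMap_mem c

/-- Maps between vector spaces whose coordinates are polynomial functions. -/
def IsPolyMap (φ : W → W₁) : Prop :=
  ∀ l : Module.Dual ℂ W₁, (fun w => l (φ w)) ∈ polyFun W

lemma IsPolyMap.comp_mem {φ : W → W₁} (hφ : IsPolyMap φ) {p : W₁ → ℂ} (hp : p ∈ polyFun W₁) :
    (fun w => p (φ w)) ∈ polyFun W := by
  induction hp using Algebra.adjoin_induction with
  | mem x hx => obtain ⟨l, rfl⟩ := hx; exact hφ l
  | algebraMap r => exact const_mem_polyFun r
  | add x y _ _ hx hy => exact (polyFun W).add_mem hx hy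
  | mul x y _ _ hx hy => exact (polyFun W).mul_mem hx hy

lemma IsPolyMap.comp {ψ : W₁ → W₂} {φ : W → W₁} (hψ : IsPolyMap ψ) (hφ : IsPolyMap φ) :
    IsPolyMap (fun w => ψ (φ w)) := fun l => hφ.comp_mem (hψ l)

lemma isPolyMap_linear (f : W →ₗ[ℂ] W₁) : IsPolyMap (fun w => f w) := fun l =>
  dual_mem_polyFun (l ∘ₗ f)

lemma isPolyMap_const (c : W₁) : IsPolyMap (fun _ : W => c) := fun l => const_mem_polyFun (l c)

lemma isPolyMap_id : IsPolyMap (fun w : W => w) := fun l => dual_mem_polyFun l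

lemma IsPolyMap.add {φ ψ : W → W₁} (hφ : IsPolyMap φ) (hψ : IsPolyMap ψ) :
    IsPolyMap (fun w => φ w + ψ w) := fun l => by
  simp only [map_add]
  exact (polyFun W).add_mem (hφ l) (hψ l)

lemma IsPolyMap.sum {ι : Type*} (s : Finset ι) {φ : ι → W → W₁} (hφ : ∀ i ∈ s, IsPolyMap (φ i)) :
    IsPolyMap (fun w => ∑ i ∈ s, φ i w) := fun l => by
  simp only [map_sum]
  have := (polyFun W).sum_mem (t := s) (f := fun i w => l (φ i w)) (fun i hi => hφ i hi l)
  convert this using 1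
  ext w; simp

/-- Expanding the first argument in a basis turns each functional of the value into a finite sum of
products; only the first factor has to be finite dimensional. -/
lemma IsPolyMap.bilin [FiniteDimensional ℂ W₁] {φ : W → W₁} {ψ : W → W₂}
    (B : W₁ →ₗ[ℂ] W₂ →ₗ[ℂ] W₃) (hφ : IsPolyMap φ) (hψ : IsPolyMap ψ) :
    IsPolyMap (fun w => B (φ w) (ψ w)) := fun l => by
  let b := Module.finBasis ℂ W₁
  have : (fun w => l (B (φ w) (ψ w))) =
      ∑ i, (fun w => b.coord i (φ w)) * fun w => (l ∘ₗ B (b i)) (ψ w) := by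
    ext w
    conv_lhs => rw [← b.sum_repr (φ w)]
    simp only [map_sum, map_smul, LinearMap.sum_apply, LinearMap.smul_apply, smul_eq_mul,
      Finset.sum_apply, Pi.mul_apply, Module.Basis.coord_apply, LinearMap.comp_apply]
  rw [this]
  exact (polyFun W).sum_mem fun i _ => (polyFun W).mul_mem (hφ _) (hψ _)

lemma IsPolyMap.smul {p : W → ℂ} (hp : p ∈ polyFun W) {φ : W → W₁} (hφ : IsPolyMap φ) :
    IsPolyMap (fun w => p w • φ w) := fun l => by
  simp only [map_smul, smul_eq_mul]
  exact (polyFun W).mul_mem hp (hφ l)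

lemma IsPolyMap.neg {φ : W → W₁} (hφ : IsPolyMap φ) : IsPolyMap (fun w => - φ w) :=
  (isPolyMap_linear (-LinearMap.id : W₁ →ₗ[ℂ] W₁)).comp hφ

lemma IsPolyMap.mul [FiniteDimensional ℂ W₁] {φ ψ : W → Module.End ℂ W₁} (hφ : IsPolyMap φ)
    (hψ : IsPolyMap ψ) : IsPolyMap (fun w => φ w * ψ w) :=
  IsPolyMap.bilin (LinearMap.mul ℂ (Module.End ℂ W₁)) hφ hψ

lemma IsPolyMap.pow [FiniteDimensional ℂ W₁] {φ : W → Module.End ℂ W₁} (hφ : IsPolyMap φ) (k : ℕ) :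
    IsPolyMap (fun w => φ w ^ k) := by
  induction k with
  | zero => simpa using isPolyMap_const _
  | succ k ih => simp only [pow_succ]; exact ih.mul hφ

lemma IsPolyMap.apply [FiniteDimensional ℂ W₁] {φ : W → Module.End ℂ W₁} (hφ : IsPolyMap φ)
    {ψ : W → W₁} (hψ : IsPolyMap ψ) : IsPolyMap (fun w => φ w (ψ w)) :=
  IsPolyMap.bilin (LinearMap.id : Module.End ℂ W₁ →ₗ[ℂ] W₁ →ₗ[ℂ] W₁) hφ hψ

lemma isPolyMap_iff_mem {p : W → ℂ} : IsPolyMap p ↔ p ∈ polyFun W :=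
  ⟨fun h => h LinearMap.id, fun h l => by
    have : (fun w => l (p w)) = (l 1) • p := by
      ext w
      have := l.map_smul (p w) 1
      simp only [smul_eq_mul, mul_one] at this
      simp [this, mul_comm]
    rw [this]
    exact (polyFun W).smul_mem h _⟩

lemma isPolyMap_line (a c : W) : IsPolyMap (fun t : ℂ => a + t • c) :=
  (isPolyMap_const a).add (isPolyMap_linear (LinearMap.toSpanSingleton ℂ W c))

lemma exists_polynomial {p : ℂ → ℂ} (hp : p ∈ polyFun ℂ) :
    ∃ P : Polynomial ℂ, ∀ t, p t = P.eval t := by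
  induction hp using Algebra.adjoin_induction with
  | mem x hx =>
    obtain ⟨l, rfl⟩ := hx
    refine ⟨Polynomial.C (l 1) * Polynomial.X, fun t => ?_⟩
    have := l.map_smul t 1
    simp only [smul_eq_mul, mul_one] at this
    refine this.trans ?_
    rw [Polynomial.eval_mul, Polynomial.eval_C, Polynomial.eval_X, mul_comm]
  | algebraMap r => exact ⟨Polynomial.C r, fun t => by simp⟩
  | add x y _ _ hx hy =>
    obtain ⟨P, hP⟩ := hx; obtain ⟨Q, hQ⟩ := hy
    exact ⟨P + Q, fun t => by simp [hP, hQ]⟩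
  | mul x y _ _ hx hy =>
    obtain ⟨P, hP⟩ := hx; obtain ⟨Q, hQ⟩ := hy
    exact ⟨P * Q, fun t => by simp [hP, hQ]⟩

/-- A nonzero polynomial in one variable has finitely many roots. Genericity on a line is phrased
with the cofinite filter so that several open conditions can be met at the same parameter. -/
lemma eventually_ne_zero {p : ℂ → ℂ} (hp : p ∈ polyFun ℂ) {t₀ : ℂ} (h : p t₀ ≠ 0) :
    ∀ᶠ t in Filter.cofinite, p t ≠ 0 := by
  obtain ⟨P, hP⟩ := exists_polynomial hp
  have hP0 : P ≠ 0 := by rintro rfl; simp [hP] at h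
  rw [Filter.eventually_cofinite]
  refine (P.roots.toFinset.finite_toSet).subset fun t ht => ?_
  have ht' : p t = 0 := not_not.1 ht
  rw [Finset.mem_coe, Multiset.mem_toFinset, Polynomial.mem_roots hP0, Polynomial.IsRoot, ← hP, ht']

/-- Polynomial functions on a vector space form a domain. -/
lemma exists_mul_ne_zero {p q : W → ℂ} (hp : p ∈ polyFun W) (hq : q ∈ polyFun W) {a b : W}
    (ha : p a ≠ 0) (hb : q b ≠ 0) : ∃ c, p c ≠ 0 ∧ q c ≠ 0 := by
  -- On the line joining the two points, `p` is nonzero at parameter 0 and `q` at parameter 1.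
  have hl := isPolyMap_line a (b - a)
  have h1 := eventually_ne_zero (hl.comp_mem hp) (t₀ := 0) (by simpa using ha)
  have h2 := eventually_ne_zero (hl.comp_mem hq) (t₀ := 1) (by simpa using hb)
  obtain ⟨t, ht⟩ := (h1.and h2).exists
  exact ⟨_, ht⟩

/-! ### The Zariski topology -/

lemma zariski_isOpen_ne {p : W → ℂ} (hp : p ∈ polyFun W) : @IsOpen _ (zariski W) {w | p w ≠ 0} :=
  TopologicalSpace.GenerateOpen.basic _ ⟨p, hp, rfl⟩

lemma zariski_exists_of_mem {U : Set W} (hU : (zariski W).IsOpen U) {a : W} (ha : a ∈ U) :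
    ∃ p ∈ polyFun W, p a ≠ 0 ∧ {w | p w ≠ 0} ⊆ U := by
  induction hU with
  | basic s hs => obtain ⟨p, hp, rfl⟩ := hs; exact ⟨p, hp, ha, subset_rfl⟩
  | univ => exact ⟨1, (polyFun W).one_mem, by simp, Set.subset_univ _⟩
  | inter s t _ _ hs ht =>
    obtain ⟨p, hp, hpa, hps⟩ := hs ha.1
    obtain ⟨q, hq, hqa, hqt⟩ := ht ha.2
    refine ⟨p * q, (polyFun W).mul_mem hp hq, by simp [hpa, hqa], fun w hw => ?_⟩
    simp only [Pi.mul_apply, ne_eq, mul_eq_zero, not_or, Set.mem_ofPred_eq] at hw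
    exact ⟨hps hw.1, hqt hw.2⟩
  | sUnion S _ ih =>
    obtain ⟨s, hs, has⟩ := ha
    obtain ⟨p, hp, hpa, hps⟩ := ih s hs has
    exact ⟨p, hp, hpa, hps.trans (Set.subset_sUnion_of_mem hs)⟩

lemma zariski_isClosed_of_zeros {ι : Type*} {g : ι → W → ℂ} (hg : ∀ i, g i ∈ polyFun W) {S : Set W}
    (hS : ∀ w, w ∈ S ↔ ∀ i, g i w = 0) : @IsClosed _ (zariski W) S := by
  let := zariski W
  have : S = ⋂ i, {w | g i w ≠ 0}ᶜ := by ext w; simp [hS]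
  rw [this]
  exact isClosed_iInter fun i => @IsOpen.isClosed_compl _ (zariski W) _ (zariski_isOpen_ne (hg i))

/-- A subset any two points of which lie in the image of a vector space under a polynomial map
is irreducible. -/
lemma zariski_isIrreducible {S : Set W} (hne : S.Nonempty)
    (h : ∀ a ∈ S, ∀ b ∈ S, ∃ (m : ℕ) (φ : (Fin m → ℂ) → W), IsPolyMap φ ∧ (∀ x, φ x ∈ S) ∧
      a ∈ Set.range φ ∧ b ∈ Set.range φ) : @IsIrreducible _ (zariski W) S := by
  refine ⟨hne, fun U U' hU hU' hSU hSU' => ?_⟩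
  obtain ⟨a, haS, haU⟩ := hSU
  obtain ⟨b, hbS, hbU⟩ := hSU'
  obtain ⟨m, φ, hφ, hφS, ⟨x, rfl⟩, ⟨y, rfl⟩⟩ := h a haS b hbS
  obtain ⟨p, hp, hpa, hpU⟩ := zariski_exists_of_mem hU haU
  obtain ⟨q, hq, hqb, hqU⟩ := zariski_exists_of_mem hU' hbU
  obtain ⟨z, hz1, hz2⟩ := exists_mul_ne_zero (hφ.comp_mem hp) (hφ.comp_mem hq) hpa hqb
  exact ⟨φ z, hφS z, hpU hz1, hqU hz2⟩

lemma mul_eq_zero_on_of_isIrreducible {S : Set W} (hS : @IsIrreducible _ (zariski W) S)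
    {p q : W → ℂ} (hp : p ∈ polyFun W) (hq : q ∈ polyFun W) (h : ∀ w ∈ S, p w * q w = 0) :
    (∀ w ∈ S, p w = 0) ∨ ∀ w ∈ S, q w = 0 := by
  by_contra! hcon
  obtain ⟨⟨a, ha, hpa⟩, ⟨b, hb, hqb⟩⟩ := hcon
  obtain ⟨c, hc, h1, h2⟩ := hS.2 _ _ (zariski_isOpen_ne hp) (zariski_isOpen_ne hq) ⟨a, ha, hpa⟩
    ⟨b, hb, hqb⟩
  exact mul_ne_zero h1 h2 (h c hc)

/-! ### Differentials of polynomial functions -/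

/-- Leibniz's rule on generators. Curves are tested through linear functionals only, so that no
topology on `W` is needed; polynomial dependence on the base point is recorded for the genericity
arguments. -/
lemma exists_differential {p : W → ℂ} (hp : p ∈ polyFun W) :
    ∃ d : W → Module.Dual ℂ W, (∀ X, (fun a => d a X) ∈ polyFun W) ∧
      ∀ (γ : ℂ → W) (X : W), (∀ l : Module.Dual ℂ W, HasDerivAt (fun t => l (γ t)) (l X) 0) →
        HasDerivAt (fun t => p (γ t)) (d (γ 0) X) 0 := by
  induction hp using Algebra.adjoin_induction with
  | mem x hx =>
    obtain ⟨l, rfl⟩ := hx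
    exact ⟨fun _ => l, fun X => const_mem_polyFun _, fun γ X h => h l⟩
  | algebraMap r =>
    exact ⟨fun _ => 0, fun X => const_mem_polyFun 0, fun γ X h => hasDerivAt_const _ _⟩
  | add x y _ _ hx hy =>
    obtain ⟨d, hd, hd'⟩ := hx; obtain ⟨e, he, he'⟩ := hy
    exact ⟨fun a => d a + e a, fun X => (polyFun W).add_mem (hd X) (he X),
      fun γ X h => (hd' γ X h).add (he' γ X h)⟩
  | mul x y hx' hy' hx hy =>
    obtain ⟨d, hd, hd'⟩ := hx; obtain ⟨e, he, he'⟩ := hy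
    refine ⟨fun a => y a • d a + x a • e a, fun X => (polyFun W).add_mem
      ((polyFun W).mul_mem hy' (hd X)) ((polyFun W).mul_mem hx' (he X)), fun γ X h => ?_⟩
    convert! (hd' γ X h).mul (he' γ X h) using 1
    simp [mul_comm]

open Classical in
/-- The differential of a polynomial function. -/
noncomputable def polyDiff (p : W → ℂ) : W → Module.Dual ℂ W :=
  if h : p ∈ polyFun W then (exists_differential h).choose else 0

lemma polyDiff_mem {p : W → ℂ} (hp : p ∈ polyFun W) (X : W) :
    (fun a => polyDiff p a X) ∈ polyFun W := by
  rw [polyDiff, dif_pos hp]; exact (exists_differential hp).choose_spec.1 X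

lemma hasDerivAt_polyDiff {p : W → ℂ} (hp : p ∈ polyFun W) {γ : ℂ → W} {a X : W} (h0 : γ 0 = a)
    (hγ : ∀ l : Module.Dual ℂ W, HasDerivAt (fun t => l (γ t)) (l X) 0) :
    HasDerivAt (fun t => p (γ t)) (polyDiff p a X) 0 := by
  subst h0
  rw [polyDiff, dif_pos hp]; exact (exists_differential hp).choose_spec.2 γ X hγ

lemma hasDerivAt_line (a X : W) (l : Module.Dual ℂ W) :
    HasDerivAt (fun t : ℂ => l (a + t • X)) (l X) 0 := by
  simp only [map_add, map_smul, smul_eq_mul]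
  simpa using ((hasDerivAt_id (0 : ℂ)).mul_const (l X)).const_add (l a)

lemma hasDerivAt_polyDiff_line {p : W → ℂ} (hp : p ∈ polyFun W) (a X : W) :
    HasDerivAt (fun t : ℂ => p (a + t • X)) (polyDiff p a X) 0 :=
  hasDerivAt_polyDiff hp (by simp) (hasDerivAt_line a X)

lemma polyDiff_add {p q : W → ℂ} (hp : p ∈ polyFun W) (hq : q ∈ polyFun W) (a : W) :
    polyDiff (p + q) a = polyDiff p a + polyDiff q a := by
  ext X
  exact (hasDerivAt_polyDiff_line ((polyFun W).add_mem hp hq) a X).unique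
    ((hasDerivAt_polyDiff_line hp a X).add (hasDerivAt_polyDiff_line hq a X))

lemma polyDiff_mul {p q : W → ℂ} (hp : p ∈ polyFun W) (hq : q ∈ polyFun W) (a : W) :
    polyDiff (p * q) a = q a • polyDiff p a + p a • polyDiff q a := by
  ext X
  refine (hasDerivAt_polyDiff_line ((polyFun W).mul_mem hp hq) a X).unique ?_
  convert! (hasDerivAt_polyDiff_line hp a X).mul (hasDerivAt_polyDiff_line hq a X) using 1
  simp [mul_comm]

lemma polyDiff_dual (l : Module.Dual ℂ W) (a : W) : polyDiff (fun w => l w) a = l := by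
  ext X
  exact (hasDerivAt_polyDiff_line (dual_mem_polyFun l) a X).unique (hasDerivAt_line a X l)

lemma polyDiff_const (c : ℂ) (a : W) : polyDiff (fun _ : W => c) a = 0 := by
  ext X
  exact (hasDerivAt_polyDiff_line (const_mem_polyFun c) a X).unique (hasDerivAt_const _ _)

lemma polyDiff_smul (c : ℂ) {p : W → ℂ} (hp : p ∈ polyFun W) (a : W) :
    polyDiff (c • p) a = c • polyDiff p a := by
  have : c • p = (fun _ : W => c) * p := by ext; simp
  rw [this, polyDiff_mul (const_mem_polyFun c) hp, polyDiff_const]; simp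

/-- The tangent space at `a` of the zero set of all polynomial functions vanishing on `S`. -/
def tangentSpace (S : Set W) (a : W) : Submodule ℂ W where
  carrier := {X | ∀ p ∈ polyFun W, (∀ s ∈ S, p s = 0) → polyDiff p a X = 0}
  zero_mem' := by intro p _ _; simp
  add_mem' := by
    intro X Y hX hY p hp h
    simp [hX p hp h, hY p hp h]
  smul_mem' := by
    intro c X hX p hp h
    simp [hX p hp h]

/-- The differentials at `a` of the polynomial functions vanishing on `S`. -/
def conormalSpace (S : Set W) (a : W) : Submodule ℂ (Module.Dual ℂ W) where
  carrier := {l | ∃ p ∈ polyFun W, (∀ s ∈ S, p s = 0) ∧ polyDiff p a = l}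
  zero_mem' := ⟨fun _ => 0, const_mem_polyFun 0, by simp, polyDiff_const 0 a⟩
  add_mem' := by
    rintro _ _ ⟨p, hp, h, rfl⟩ ⟨q, hq, h', rfl⟩
    exact ⟨p + q, (polyFun W).add_mem hp hq, fun s hs => by simp [h s hs, h' s hs],
      polyDiff_add hp hq a⟩
  smul_mem' := by
    rintro c _ ⟨p, hp, h, rfl⟩
    exact ⟨c • p, (polyFun W).smul_mem hp c, fun s hs => by simp [h s hs], polyDiff_smul c hp a⟩

lemma tangentSpace_eq (S : Set W) (a : W) :
    tangentSpace S a = (conormalSpace S a).dualCoannihilator := by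
  ext X
  simp only [Submodule.mem_dualCoannihilator]
  constructor
  · rintro h _ ⟨p, hp, hs, rfl⟩; exact h p hp hs
  · intro h p hp hs; exact h _ ⟨p, hp, hs, rfl⟩

/-- Double annihilator in finite dimension. It produces an actual equation of `S` with any
prescribed differential that kills the tangent space. -/
lemma conormalSpace_eq [FiniteDimensional ℂ W] (S : Set W) (a : W) :
    conormalSpace S a = (tangentSpace S a).dualAnnihilator := by
  rw [tangentSpace_eq, Subspace.dualCoannihilator_dualAnnihilator_eq]

/-- A curve in `S` has its velocity in the tangent space. -/
lemma mem_tangentSpace {S : Set W} {γ : ℂ → W} {a X : W} (h0 : γ 0 = a)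
    (hγ : ∀ l : Module.Dual ℂ W, HasDerivAt (fun t => l (γ t)) (l X) 0) (hS : ∀ t, γ t ∈ S) :
    X ∈ tangentSpace S a := fun p hp h => by
  refine (hasDerivAt_polyDiff hp h0 hγ).unique ?_
  simp only [h _ (hS _)]
  exact hasDerivAt_const _ _

end PolynomialMaps

end SympCone

namespace SympCone

/-! ### Coordinate rings, their dimension, and the tangent space criterion for regularity. -/

section CoordRing

variable {W : Type*} [AddCommGroup W] [Module ℂ W]

/-- The restriction of polynomial functions to the coordinate ring. -/
def toCoord (S : Set W) : polyFun W →ₐ[ℂ] coordRing S :=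
  ((restrictFun S).comp (polyFun W).val).codRestrict (coordRing S) fun p => ⟨p.1, p.2, rfl⟩

lemma toCoord_apply (S : Set W) (p : polyFun W) (s : S) : (toCoord S p).1 s = p.1 s := rfl

lemma toCoord_surjective (S : Set W) : Function.Surjective (toCoord S) := by
  rintro ⟨c, p, hp, rfl⟩
  exact ⟨⟨p, hp⟩, rfl⟩

lemma toCoord_eq_zero_iff {S : Set W} {p : polyFun W} :
    toCoord S p = 0 ↔ ∀ s ∈ S, p.1 s = 0 := by
  constructor
  · intro h s hs
    rw [← toCoord_apply S p ⟨s, hs⟩, h]; rfl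
  · intro h
    ext s
    exact h s s.2

lemma toCoord_mem_pointIdeal {S : Set W} {a : S} {p : polyFun W} :
    toCoord S p ∈ pointIdeal S a ↔ p.1 a = 0 := Iff.rfl

/-- Evaluation of polynomials in the coordinates of a basis. -/
noncomputable def mvEval {ι : Type*} (b : Module.Basis ι ℂ W) : MvPolynomial ι ℂ →ₐ[ℂ] polyFun W :=
  MvPolynomial.aeval fun i => ⟨_, dual_mem_polyFun (b.coord i)⟩

lemma mvEval_apply {ι : Type*} (b : Module.Basis ι ℂ W) (P : MvPolynomial ι ℂ) (w : W) :
    (mvEval b P).1 w = MvPolynomial.aeval (fun i => b.repr w i) P := by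
  have : (((Pi.evalAlgHom ℂ (fun _ : W => ℂ) w).comp (polyFun W).val).comp (mvEval b)) =
      MvPolynomial.aeval (fun i => b.repr w i) := by
    ext i
    simp [mvEval]
  exact congrArg (fun f => f P) this

lemma mvEval_surjective {ι : Type*} [Finite ι] (b : Module.Basis ι ℂ W) :
    Function.Surjective (mvEval b) := by
  have := Fintype.ofFinite ι
  rintro ⟨p, hp⟩
  induction hp using Algebra.adjoin_induction with
  | mem x hx =>
    obtain ⟨l, rfl⟩ := hx
    refine ⟨∑ i, MvPolynomial.C (l (b i)) * MvPolynomial.X i, Subtype.ext ?_⟩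
    ext w
    rw [mvEval_apply]
    simp only [map_sum, map_mul, MvPolynomial.aeval_X, MvPolynomial.algHom_C]
    have := congrArg l (b.sum_repr w)
    rw [map_sum] at this
    rw [← this]
    simp [mul_comm]
  | algebraMap r => exact ⟨MvPolynomial.C r, by rw [MvPolynomial.algHom_C]; rfl⟩
  | add x y _ _ hx hy =>
    obtain ⟨P, hP⟩ := hx; obtain ⟨Q, hQ⟩ := hy
    exact ⟨P + Q, by rw [map_add, hP, hQ]; rfl⟩
  | mul x y _ _ hx hy =>
    obtain ⟨P, hP⟩ := hx; obtain ⟨Q, hQ⟩ := hy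
    exact ⟨P * Q, by rw [map_mul, hP, hQ]; rfl⟩

lemma mvEval_injective {ι : Type*} [Finite ι] (b : Module.Basis ι ℂ W) :
    Function.Injective (mvEval b) := by
  rw [injective_iff_map_eq_zero]
  intro P hP
  refine MvPolynomial.funext fun x => ?_
  have := mvEval_apply b P (b.equivFun.symm x)
  rw [hP] at this
  have h2 : (fun i => b.repr (b.equivFun.symm x) i) = x := by
    ext i
    rw [← b.equivFun_apply, LinearEquiv.apply_symm_apply]
  rw [h2, MvPolynomial.aeval_eq_eval] at this
  simpa using this.symm

variable [FiniteDimensional ℂ W]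

instance polyFun_finiteType : Algebra.FiniteType ℂ (polyFun W) :=
  Algebra.FiniteType.of_surjective (mvEval (Module.finBasis ℂ W))
    (mvEval_surjective (Module.finBasis ℂ W))

instance coordRing_finiteType (S : Set W) : Algebra.FiniteType ℂ (coordRing S) :=
  Algebra.FiniteType.of_surjective (toCoord S) (toCoord_surjective S)

instance coordRing_isNoetherianRing (S : Set W) : IsNoetherianRing (coordRing S) :=
  Algebra.FiniteType.isNoetherianRing ℂ _

omit [FiniteDimensional ℂ W] in
lemma coordRing_isDomain {S : Set W} (hS : @IsIrreducible _ (zariski W) S) :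
    IsDomain (coordRing S) := by
  have : Nontrivial (coordRing S) := by
    obtain ⟨s, hs⟩ := hS.1
    refine ⟨0, 1, fun h => ?_⟩
    have := congrArg (fun c : coordRing S => c.1 ⟨s, hs⟩) h
    simp at this
  have : NoZeroDivisors (coordRing S) := by
    refine ⟨fun {x y} h => ?_⟩
    obtain ⟨p, rfl⟩ := toCoord_surjective S x
    obtain ⟨q, rfl⟩ := toCoord_surjective S y
    rw [← map_mul, toCoord_eq_zero_iff] at h
    rw [toCoord_eq_zero_iff, toCoord_eq_zero_iff]
    exact mul_eq_zero_on_of_isIrreducible hS p.2 q.2 h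
  exact NoZeroDivisors.to_isDomain _

/-! ### Dimension -/

/-- Incomparability: a strict chain of primes stays strict after contraction along an integral map.
-/
lemma ringKrullDim_le_of_isIntegral {A B : Type*} [CommRing A] [CommRing B] (f : A →+* B)
    (hf : f.IsIntegral) : ringKrullDim B ≤ ringKrullDim A := by
  algebraize [f]
  refine Order.krullDim_le_of_strictMono (fun P : PrimeSpectrum B => P.comap (algebraMap A B)) ?_
  intro P Q hPQ
  have : P.asIdeal < Q.asIdeal := hPQ
  exact Ideal.IsIntegral.comap_lt_comap this

/-- An irreducible set that is dominated by a vector space of dimension `d` has dimension at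
most `d`. -/
lemma ringKrullDim_coordRing_le {S : Set W} (hS : @IsIrreducible _ (zariski W) S)
    {U : Type*} [AddCommGroup U] [Module ℂ U] [FiniteDimensional ℂ U] {φ : U → W}
    (hφ : IsPolyMap φ) (hφS : ∀ u, φ u ∈ S)
    (hdom : ∀ p ∈ polyFun W, (∀ u, p (φ u) = 0) → ∀ s ∈ S, p s = 0) :
    ringKrullDim (coordRing S) ≤ Module.finrank ℂ U := by
  have := coordRing_isDomain hS
  -- Noether normalization: the dimension is at most `s`. Composed with the pullback along `φ`,
  -- which is injective by dominance, it yields `s` algebraically independent polynomials on `U`,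
  -- and the transcendence degree bounds `s`.
  obtain ⟨s, g, hg, hint⟩ := exists_integral_inj_algHom_of_fg ℂ (coordRing S)
  have h1 := ringKrullDim_le_of_isIntegral g.toRingHom hint
  rw [MvPolynomial.ringKrullDim_of_isNoetherianRing, ringKrullDim_eq_zero_of_field] at h1
  refine h1.trans ?_
  simp only [Nat.card_eq_fintype_card, Fintype.card_fin, zero_add]
  let b := Module.finBasis ℂ U
  -- pull back to polynomial functions on `U`
  have hmem : ∀ c : coordRing S, (fun u => c.1 ⟨φ u, hφS u⟩) ∈ polyFun U := by
    intro c
    obtain ⟨p, rfl⟩ := toCoord_surjective S c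
    exact hφ.comp_mem p.2
  let ψ : coordRing S →ₐ[ℂ] polyFun U :=
    { toFun := fun c => ⟨_, hmem c⟩
      map_one' := rfl
      map_mul' := fun _ _ => rfl
      map_zero' := rfl
      map_add' := fun _ _ => rfl
      commutes' := fun _ => rfl }
  have hψ : Function.Injective ψ := by
    rw [injective_iff_map_eq_zero]
    intro c hc
    obtain ⟨p, rfl⟩ := toCoord_surjective S c
    rw [toCoord_eq_zero_iff]
    exact hdom p p.2 fun u => congrArg (fun q : polyFun U => q.1 u) hc
  let e := AlgEquiv.ofBijective (mvEval b) ⟨mvEval_injective b, mvEval_surjective b⟩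
  have hind : AlgebraicIndependent ℂ
      (fun i : Fin s => (e.symm.toAlgHom.comp (ψ.comp g)) (MvPolynomial.X i)) := by
    rw [AlgebraicIndependent]
    have : MvPolynomial.aeval (fun i : Fin s =>
        (e.symm.toAlgHom.comp (ψ.comp g)) (MvPolynomial.X i)) =
          e.symm.toAlgHom.comp (ψ.comp g) := by ext i; simp
    rw [this]
    exact e.symm.injective.comp (hψ.comp hg)
  have h2 := hind.lift_cardinalMk_le_trdeg
  rw [MvPolynomial.trdeg_of_isDomain] at h2
  simp only [Cardinal.mk_fintype, Fintype.card_fin, Cardinal.lift_natCast, Nat.cast_le] at h2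
  exact_mod_cast h2

/-- Some maximal ideal attains the Krull dimension. By the Nullstellensatz maximal ideals are
points, and translations permute these transitively. -/
lemma mvPolynomial_height_of_isMaximal {d : ℕ} (M : Ideal (MvPolynomial (Fin d) ℂ))
    (hM : M.IsMaximal) : M.height = d := by
  have hdim : ringKrullDim (MvPolynomial (Fin d) ℂ) = d := by
    rw [MvPolynomial.ringKrullDim_of_isNoetherianRing, ringKrullDim_eq_zero_of_field]
    simp
  have : FiniteRingKrullDim (MvPolynomial (Fin d) ℂ) := by
    rw [finiteRingKrullDim_iff_ne_bot_and_top, hdim]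
    exact ⟨WithBot.coe_ne_bot, fun h => by
      have := WithBot.coe_injective h
      exact absurd this (ENat.natCast_ne_top d)⟩
  obtain ⟨M₀, hM₀, h0⟩ := Ideal.exists_isMaximal_height (R := MvPolynomial (Fin d) ℂ)
  rw [hdim] at h0
  have h0' : M₀.height = d := by exact_mod_cast h0
  obtain ⟨x, rfl⟩ := MvPolynomial.isMaximal_iff_eq_vanishingIdeal_singleton.1 hM
  obtain ⟨y, rfl⟩ := MvPolynomial.isMaximal_iff_eq_vanishingIdeal_singleton.1 hM₀
  let τ : (Fin d → ℂ) → MvPolynomial (Fin d) ℂ →ₐ[ℂ] MvPolynomial (Fin d) ℂ := fun c =>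
    MvPolynomial.aeval fun i => MvPolynomial.X i + MvPolynomial.C (c i)
  have hτ : ∀ c, (τ c).comp (τ (-c)) = AlgHom.id ℂ _ := by
    intro c; ext i
    simp [τ]
  let e : MvPolynomial (Fin d) ℂ ≃ₐ[ℂ] MvPolynomial (Fin d) ℂ :=
    AlgEquiv.ofAlgHom (τ (x - y)) (τ (-(x - y))) (hτ _) (by simpa using hτ (-(x - y)))
  have hcomap : (MvPolynomial.vanishingIdeal ℂ {y}).comap e.toRingEquiv =
      MvPolynomial.vanishingIdeal ℂ {x} := by
    ext P
    have : MvPolynomial.aeval y (τ (x - y) P) = MvPolynomial.aeval x P := by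
      have : (MvPolynomial.aeval y).comp (τ (x - y)) = MvPolynomial.aeval (R := ℂ) x := by
        ext i; simp [τ]
      exact congrArg (fun f => f P) this
    simp only [Ideal.mem_comap, MvPolynomial.mem_vanishingIdeal_singleton_iff, ← this]
    rfl
  rw [← hcomap, RingEquiv.height_comap, h0']

/-- A zero set of `m` polynomial functions has codimension at most `m` at each of its points. -/
lemma le_height_pointIdeal {S : Set W} {m : ℕ} {g : Fin m → W → ℂ} (hg : ∀ j, g j ∈ polyFun W)
    (hS : ∀ w, w ∈ S ↔ ∀ j, g j w = 0) (a : S) :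
    (Module.finrank ℂ W : ℕ∞) ≤ (pointIdeal S a).height + m := by
  classical
  let b := Module.finBasis ℂ W
  choose G hG using fun j => mvEval_surjective b ⟨g j, hg j⟩
  let φ : MvPolynomial (Fin (Module.finrank ℂ W)) ℂ →ₐ[ℂ] coordRing S := (toCoord S).comp (mvEval b)
  have hφ : Function.Surjective φ := (toCoord_surjective S).comp (mvEval_surjective b)
  have hGw : ∀ j w, MvPolynomial.aeval (fun i => b.repr w i) (G j) = g j w := by
    intro j w
    rw [← mvEval_apply, hG]
  -- The given equations need not generate the ideal of `S`; the Nullstellensatz places that ideal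
  -- in their radical, which is enough for minimal primes.
  have hker : RingHom.ker φ ≤ (Ideal.span (Set.range G)).radical := by
    intro P hP
    rw [← MvPolynomial.vanishingIdeal_zeroLocus_eq_radical (K := ℂ)]
    intro x hx
    have hxS : b.equivFun.symm x ∈ S := by
      rw [hS]
      intro j
      rw [← hGw, ← hx (G j) (Ideal.subset_span ⟨j, rfl⟩)]
      congr 1
      congr 1
      ext i
      rw [← b.equivFun_apply, LinearEquiv.apply_symm_apply]
    have h0 : φ P = 0 := hP
    have h1 := toCoord_eq_zero_iff.1 h0 _ hxS
    have h2 := mvEval_apply b P (b.equivFun.symm x)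
    refine Eq.trans ?_ (h2.symm.trans h1)
    congr 1
    congr 1
    ext i
    rw [← b.equivFun_apply, LinearEquiv.apply_symm_apply]
  have hGker : ∀ j, φ (G j) = 0 := by
    intro j
    refine toCoord_eq_zero_iff.2 fun s hs => ?_
    have := congrArg (fun q : polyFun W => q.1 s) (hG j)
    exact this.trans ((hS s).1 hs j)
  let M := (pointIdeal S a).comap φ.toRingHom
  have hMmax : M.IsMaximal := by
    have : (pointIdeal S a).IsMaximal := RingHom.ker_isMaximal_of_surjective _ fun c =>
      ⟨algebraMap ℂ _ c, by simp⟩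
    exact Ideal.comap_isMaximal_of_surjective φ.toRingHom hφ
  have hMh := mvPolynomial_height_of_isMaximal M hMmax
  -- The point ideal is a minimal prime over as many elements as its height. Their lifts together
  -- with the `m` equations have `M` as a minimal prime, and Krull's height theorem applies in the
  -- polynomial ring.
  obtain ⟨s, hs, hcard⟩ := (pointIdeal S a).exists_finset_card_eq_height_of_isNoetherianRing
  choose lift hlift using hφ
  have hmin : M ∈ (Ideal.span ((s.image lift ∪ Finset.univ.image G : Finset _) :
      Set (MvPolynomial (Fin (Module.finrank ℂ W)) ℂ))).minimalPrimes := by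
    refine ⟨⟨hMmax.isPrime, ?_⟩, ?_⟩
    · rw [Ideal.span_le]
      intro P hP
      rw [Finset.coe_union, Set.mem_union] at hP
      rcases hP with hP | hP
      · simp only [Finset.coe_image, Set.mem_image, Finset.mem_coe] at hP
        obtain ⟨c, hc, rfl⟩ := hP
        show φ (lift c) ∈ pointIdeal S a
        rw [hlift]
        exact hs.1.2 (Ideal.subset_span hc)
      · simp only [Finset.coe_image, Finset.coe_univ, Set.image_univ, Set.mem_range] at hP
        obtain ⟨j, rfl⟩ := hP
        show φ (G j) ∈ pointIdeal S a
        rw [hGker]; exact zero_mem _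
    · rintro Q ⟨hQ, hsQ⟩ hQM
      have hkQ : RingHom.ker φ.toRingHom ≤ Q := by
        refine le_trans hker ((hQ.radical_le_iff).2 ((Ideal.span_mono ?_).trans hsQ))
        rintro _ ⟨j, rfl⟩
        simp
      have hsurj : Function.Surjective φ.toRingHom := fun c => ⟨lift c, hlift c⟩
      have hQ' := Ideal.map_isPrime_of_surjective hsurj hkQ
      have hle : Q.map φ.toRingHom ≤ pointIdeal S a := Ideal.map_le_iff_le_comap.2 hQM
      have hge := hs.2 ⟨hQ', by
        rw [Ideal.span_le]
        intro c hc
        have : lift c ∈ Q := hsQ (Ideal.subset_span (by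
          rw [Finset.coe_union, Finset.coe_image]; exact Or.inl ⟨c, hc, rfl⟩))
        have h2 := Ideal.mem_map_of_mem φ.toRingHom this
        have h3 : φ.toRingHom (lift c) = c := hlift c
        rwa [h3] at h2⟩ hle
      intro P hP
      have : φ.toRingHom P ∈ Q.map φ.toRingHom := hge hP
      rw [← Ideal.mem_comap, Ideal.comap_map_of_surjective' _ hsurj, sup_eq_left.2 hkQ] at this
      exact this
  have h1 := Ideal.height_le_card_of_mem_minimalPrimes_span_finset hmin
  rw [hMh] at h1
  refine h1.trans ?_
  rw [← hcard]
  have h2 : (s.image lift ∪ Finset.univ.image G).card ≤ s.card + m := by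
    refine (Finset.card_union_le _ _).trans (add_le_add Finset.card_image_le ?_)
    exact Finset.card_image_le.trans (by simp)
  exact_mod_cast h2

/-! ### The cotangent space -/

omit [FiniteDimensional ℂ W] in
-- Nakayama's lemma.
lemma maximalIdeal_le_of_le_sup_sq {R : Type*} [CommRing R] [IsLocalRing R] [IsNoetherianRing R]
    {J : Ideal R} (h : IsLocalRing.maximalIdeal R ≤ J ⊔ IsLocalRing.maximalIdeal R ^ 2) :
    IsLocalRing.maximalIdeal R ≤ J := by
  rw [pow_two] at h
  exact Submodule.le_of_le_smul_of_le_jacobson_bot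
    (IsNoetherian.noetherian (IsLocalRing.maximalIdeal R))
    (IsLocalRing.maximalIdeal_le_jacobson _) h

omit [FiniteDimensional ℂ W] in
/-- Taylor expansion to first order. -/
lemma taylor_mem_sq (a : W) {p : W → ℂ} (hp : p ∈ polyFun W) :
    (⟨p, hp⟩ - ⟨_, const_mem_polyFun (p a)⟩ - (⟨_, dual_mem_polyFun (polyDiff p a)⟩ -
      ⟨_, const_mem_polyFun (polyDiff p a a)⟩) : polyFun W) ∈
    (RingHom.ker ((Pi.evalAlgHom ℂ (fun _ : W => ℂ) a).comp (polyFun W).val)) ^ 2 := by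
  set I := RingHom.ker ((Pi.evalAlgHom ℂ (fun _ : W => ℂ) a).comp (polyFun W).val) with hI
  induction hp using Algebra.adjoin_induction with
  | mem x hx =>
    obtain ⟨l, rfl⟩ := hx
    convert zero_mem (I ^ 2) using 1
    ext w
    have : polyDiff (fun w => l w) a = l := polyDiff_dual l a
    simp [this]
  | algebraMap r =>
    convert zero_mem (I ^ 2) using 1
    ext w
    have : polyDiff (algebraMap ℂ (W → ℂ) r) a = 0 := polyDiff_const r a
    simp [this]
  | add x y hx' hy' hx hy =>
    convert add_mem hx hy using 1
    ext w
    simp [polyDiff_add hx' hy']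
    ring
  | mul x y hx' hy' hx hy =>
    -- The remainder of a product is the product of the two increments plus each remainder times the
    -- value of the other factor.
    have h3 : (⟨x, hx'⟩ - ⟨_, const_mem_polyFun (x a)⟩) * (⟨y, hy'⟩ - ⟨_, const_mem_polyFun (y a)⟩)
        ∈ I ^ 2 := by
      rw [pow_two]
      refine Ideal.mul_mem_mul ?_ ?_ <;> simp [hI, RingHom.mem_ker]
    convert add_mem h3 (add_mem (Ideal.mul_mem_left _ ⟨_, const_mem_polyFun (x a)⟩ hy)
      (Ideal.mul_mem_left _ ⟨_, const_mem_polyFun (y a)⟩ hx)) using 1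
    ext w
    simp [polyDiff_mul hx' hy']
    ring

/-- Clear denominators in a minimal set of generators of the maximal ideal. The differentials of the
numerators are injective on the tangent space: a tangent vector that they kill is killed by the
differential of every function vanishing at `a`, in particular by every linear form. -/
lemma finrank_tangentSpace_le {S : Set W} (a : S) :
    Module.finrank ℂ (tangentSpace S (a : W)) ≤
      (IsLocalRing.maximalIdeal (Localization.AtPrime (pointIdeal S a))).spanFinrank := by
  classical
  set L := Localization.AtPrime (pointIdeal S a)
  have hN : IsNoetherianRing L :=
    IsLocalization.isNoetherianRing (pointIdeal S a).primeCompl L inferInstance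
  obtain ⟨s, hcard, hs⟩ :=
    Submodule.FG.exists_span_finset_card_eq_spanFinrank
      (IsNoetherian.noetherian (IsLocalRing.maximalIdeal L))
  rw [← hcard]
  have hnum : ∀ x : L, ∃ c : polyFun W, ∃ u : L, IsUnit u ∧
      u * x = algebraMap (coordRing S) L (toCoord S c) := by
    intro x
    obtain ⟨⟨c, q⟩, h⟩ := IsLocalization.surj (pointIdeal S a).primeCompl x
    obtain ⟨p, rfl⟩ := toCoord_surjective S c
    exact ⟨p, _, IsLocalization.map_units L q, by rw [mul_comm]; exact h⟩
  choose c u hu hc using hnum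
  have hcm : ∀ x ∈ s, toCoord S (c x) ∈ pointIdeal S a := by
    intro x hx
    have hxm : x ∈ IsLocalRing.maximalIdeal L := by
      rw [← hs]; exact Submodule.subset_span hx
    have := Ideal.mul_mem_left _ (u x) hxm
    rw [hc] at this
    exact (IsLocalization.AtPrime.to_map_mem_maximal_iff L (pointIdeal S a) _).1 this
  have hmap : IsLocalRing.maximalIdeal L ≤
      Ideal.map (algebraMap (coordRing S) L) (Ideal.span ((fun x => toCoord S (c x)) '' s)) := by
    rw [← hs]
    refine Submodule.span_le.2 fun x hx => ?_
    have h1 : algebraMap (coordRing S) L (toCoord S (c x)) ∈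
        Ideal.map (algebraMap (coordRing S) L) (Ideal.span ((fun x => toCoord S (c x)) '' s)) :=
      Ideal.mem_map_of_mem _ (Ideal.subset_span ⟨x, hx, rfl⟩)
    rw [← hc] at h1
    exact (Ideal.unit_mul_mem_iff_mem _ (hu x)).1 h1
  let D : tangentSpace S (a : W) →ₗ[ℂ] (s → ℂ) :=
    LinearMap.pi fun x => (polyDiff (c x).1 a) ∘ₗ (tangentSpace S (a : W)).subtype
  have hD : Function.Injective D := by
    rw [← LinearMap.ker_eq_bot, LinearMap.ker_eq_bot']
    rintro ⟨X, hX⟩ hDX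
    have hcX : ∀ x ∈ s, polyDiff (c x).1 a X = 0 := fun x hx => congrFun hDX ⟨x, hx⟩
    have key : ∀ y ∈ Ideal.span ((fun x => toCoord S (c x)) '' (s : Set L)),
        ∃ p : polyFun W, toCoord S p = y ∧ p.1 a = 0 ∧ polyDiff p.1 a X = 0 := by
      intro y hy
      induction hy using Submodule.span_induction with
      | mem y hy =>
        obtain ⟨x, hx, rfl⟩ := hy
        exact ⟨c x, rfl, hcm x hx, hcX x hx⟩
      | zero => exact ⟨0, map_zero _, rfl, by
          have : polyDiff (0 : W → ℂ) (a : W) = 0 := polyDiff_const 0 _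
          simp [this]⟩
      | add y z _ _ hy hz =>
        obtain ⟨p, rfl, h1, h2⟩ := hy
        obtain ⟨q, rfl, h3, h4⟩ := hz
        exact ⟨p + q, map_add _ _ _, by simp [h1, h3], by
          have := polyDiff_add p.2 q.2 (a : W)
          rw [AddMemClass.coe_add, this]; simp [h2, h4]⟩
      | smul r y _ hy =>
        obtain ⟨p, rfl, h1, h2⟩ := hy
        obtain ⟨q, rfl⟩ := toCoord_surjective S r
        exact ⟨q * p, map_mul _ _ _, by simp [h1], by
          have := polyDiff_mul q.2 p.2 (a : W)
          rw [MulMemClass.coe_mul, this]; simp [h1, h2]⟩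
    have hlX : ∀ l : Module.Dual ℂ W, l X = 0 := by
      intro l
      let y : polyFun W := ⟨_, dual_mem_polyFun l⟩ - ⟨_, const_mem_polyFun (l a)⟩
      have hy : algebraMap (coordRing S) L (toCoord S y) ∈ IsLocalRing.maximalIdeal L := by
        rw [IsLocalization.AtPrime.to_map_mem_maximal_iff L (pointIdeal S a)]
        rw [toCoord_mem_pointIdeal]
        simp [y]
      obtain ⟨⟨⟨z, hz⟩, q⟩, h⟩ :=
        (IsLocalization.mem_map_algebraMap_iff (pointIdeal S a).primeCompl L).1 (hmap hy)
      simp only at h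
      rw [← map_mul] at h
      obtain ⟨q', hq'⟩ := (IsLocalization.eq_iff_exists (pointIdeal S a).primeCompl L).1 h
      obtain ⟨t, ht⟩ := toCoord_surjective S (q' * q : coordRing S)
      have hta : t.1 a ≠ 0 := by
        rw [ne_eq, ← toCoord_mem_pointIdeal (S := S), ht]
        exact (q' * q).2
      obtain ⟨p, hp, hpa, hpX⟩ := key (q' * z)
        (Ideal.mul_mem_left _ _ hz)
      -- `t * y - p` is an equation of `S`, so its differential kills `X`; as `y` and the
      -- differential of `p` along `X` vanish, what remains is `t a * l X = 0`.
      have heq : toCoord S (t * y - p) = 0 := by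
        rw [map_sub, map_mul, hp, ht, ← hq']
        ring
      have h0 := hX _ (t * y - p).2 (toCoord_eq_zero_iff.1 heq)
      have h1 : polyDiff (t * y - p).1 (a : W) = polyDiff (t * y).1 a - polyDiff p.1 a := by
        have h2 := polyDiff_add (t * y - p).2 p.2 (a : W)
        have h3 : (t * y - p).1 + p.1 = (t * y).1 := by ext w; simp
        rw [h3] at h2
        rw [h2]; simp
      have h4 : polyDiff (t * y).1 (a : W) = y.1 a • polyDiff t.1 a + t.1 a • polyDiff y.1 a :=
        polyDiff_mul t.2 y.2 a
      have h5 : polyDiff y.1 (a : W) = l := by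
        have h6 := polyDiff_add y.2 (const_mem_polyFun (l a)) (a : W)
        have h7 : y.1 + (fun _ => l a) = fun w => l w := by ext w; simp [y]
        rw [h7, polyDiff_dual, polyDiff_const] at h6
        simpa using h6.symm
      have h8 : y.1 a = 0 := by simp [y]
      rw [h1, h4, h5, h8] at h0
      simp only [zero_smul, zero_add, LinearMap.sub_apply, LinearMap.smul_apply, hpX, sub_zero,
        smul_eq_mul, mul_eq_zero, hta, false_or] at h0
      exact h0
    have : X = 0 := (Module.forall_dual_apply_eq_zero_iff ℂ X).1 hlX
    simpa using this
  have := LinearMap.finrank_le_finrank_of_injective hD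
  rwa [Module.finrank_fintype_fun_eq_card, Fintype.card_coe] at this

/-- Lift a basis of the dual of the tangent space to linear forms on `W`, translated to vanish at
`a`. By the first order Taylor expansion they generate the maximal ideal modulo its square, because
a functional that kills the tangent space is the differential of an equation. Nakayama's lemma
concludes. -/
lemma spanFinrank_maximalIdeal_le {S : Set W} (a : S) :
    (IsLocalRing.maximalIdeal (Localization.AtPrime (pointIdeal S a))).spanFinrank ≤
      Module.finrank ℂ (tangentSpace S (a : W)) := by
  classical
  set L := Localization.AtPrime (pointIdeal S a)
  have hN : IsNoetherianRing L :=
    IsLocalization.isNoetherianRing (pointIdeal S a).primeCompl L inferInstance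
  let T := tangentSpace S (a : W)
  let β := Module.finBasis ℂ (Module.Dual ℂ T)
  have hd : Module.finrank ℂ (Module.Dual ℂ T) = Module.finrank ℂ T := Subspace.dual_finrank_eq
  choose l hl using fun j => Subspace.dualRestrict_surjective (W := T) (β j)
  let lin : Module.Dual ℂ W → polyFun W := fun m =>
    ⟨_, dual_mem_polyFun m⟩ - ⟨_, const_mem_polyFun (m a)⟩
  set I := RingHom.ker ((Pi.evalAlgHom ℂ (fun _ : W => ℂ) (a : W)).comp (polyFun W).val)
  set Q := Ideal.span (Set.range fun j => toCoord S (lin (l j))) with hQ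
  have hI : I.map (toCoord S) ≤ pointIdeal S a := by
    rw [Ideal.map_le_iff_le_comap]
    intro p hp
    exact hp
  have hI2 : ∀ p ∈ I ^ 2, toCoord S p ∈ pointIdeal S a ^ 2 := by
    intro p hp
    have := Ideal.mem_map_of_mem (toCoord S) hp
    rw [Ideal.map_pow] at this
    exact Ideal.pow_right_mono hI 2 this
  have hP : pointIdeal S a ≤ Q ⊔ pointIdeal S a ^ 2 := by
    intro y hy
    obtain ⟨p, rfl⟩ := toCoord_surjective S y
    have hpa : p.1 a = 0 := hy
    let κ := fun j => β.repr (T.dualRestrict (polyDiff p.1 a)) j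
    have hres : polyDiff p.1 a - ∑ j, κ j • l j ∈ conormalSpace S (a : W) := by
      rw [conormalSpace_eq]
      rw [← Submodule.dualRestrict_ker_eq_dualAnnihilator, LinearMap.mem_ker, map_sub, map_sum]
      simp only [map_smul]
      have h2 := β.sum_repr (T.dualRestrict (polyDiff p.1 a))
      rw [sub_eq_zero]
      refine h2.symm.trans (Finset.sum_congr rfl fun j _ => ?_)
      rw [← hl]
    obtain ⟨q, hq, hqS, hqd⟩ := hres
    have h1 := taylor_mem_sq (a : W) p.2
    have h2 := taylor_mem_sq (a : W) hq
    have h1' := hI2 _ h1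
    have h2' := hI2 _ h2
    have hq0 : toCoord S ⟨q, hq⟩ = 0 := toCoord_eq_zero_iff.2 hqS
    have hdec : toCoord S p = toCoord S (∑ j, κ j • lin (l j)) +
        (toCoord S (p - ⟨_, const_mem_polyFun (p.1 a)⟩ - (⟨_, dual_mem_polyFun (polyDiff p.1 a)⟩ -
          ⟨_, const_mem_polyFun (polyDiff p.1 a a)⟩)) -
        toCoord S (⟨q, hq⟩ - ⟨_, const_mem_polyFun (q a)⟩ - (⟨_, dual_mem_polyFun (polyDiff q a)⟩ -
          ⟨_, const_mem_polyFun (polyDiff q a a)⟩))) := by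
      have hlin : ⟨_, dual_mem_polyFun (polyDiff p.1 a)⟩ -
          ⟨_, const_mem_polyFun (polyDiff p.1 a a)⟩ = ∑ j, κ j • lin (l j) +
          ((⟨_, dual_mem_polyFun (polyDiff q a)⟩ -
            ⟨_, const_mem_polyFun (polyDiff q a a)⟩) : polyFun W) := by
        rw [hqd]
        ext w
        simp [lin, Finset.sum_apply, mul_sub, Finset.sum_sub_distrib]
        ring
      have hc1 : (⟨_, const_mem_polyFun (p.1 a)⟩ : polyFun W) = 0 := by ext w; simp [hpa]
      have hc2 : (⟨_, const_mem_polyFun (q a)⟩ : polyFun W) = 0 := by ext w; simp [hqS a a.2]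
      rw [hlin, hc1, hc2]
      simp only [map_sub, map_add, hq0, map_zero]
      ring
    rw [hdec]
    refine add_mem (Submodule.mem_sup_left ?_) (Submodule.mem_sup_right (sub_mem h1' h2'))
    rw [map_sum]
    refine sum_mem fun j _ => ?_
    rw [map_smul, Algebra.smul_def]
    exact Ideal.mul_mem_left _ _ (Ideal.subset_span ⟨j, rfl⟩)
  have hm : (pointIdeal S a).map (algebraMap (coordRing S) L) = IsLocalRing.maximalIdeal L :=
    Localization.AtPrime.map_eq_maximalIdeal
  have hQm : Q.map (algebraMap (coordRing S) L) = IsLocalRing.maximalIdeal L := by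
    apply le_antisymm
    · rw [← hm]
      refine Ideal.map_mono ?_
      rw [hQ, Ideal.span_le]
      rintro _ ⟨j, rfl⟩
      show toCoord S (lin (l j)) ∈ pointIdeal S a
      rw [toCoord_mem_pointIdeal]
      simp [lin]
    · refine maximalIdeal_le_of_le_sup_sq (R := L) ?_
      have := Ideal.map_mono (f := algebraMap (coordRing S) L) hP
      rw [Ideal.map_sup, Ideal.map_pow, hm] at this
      exact this
  rw [← hQm, hQ, Ideal.map_span]
  refine (Submodule.spanFinrank_span_le_ncard_of_finite ((Set.finite_range _).image _)).trans ?_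
  refine (Set.ncard_image_le (Set.finite_range _)).trans ?_
  rw [← Set.image_univ]
  refine (Set.ncard_image_le Set.finite_univ).trans ?_
  rw [Set.ncard_univ, Nat.card_eq_fintype_card, Fintype.card_fin, hd]

lemma spanFinrank_maximalIdeal_eq {S : Set W} (a : S) :
    (IsLocalRing.maximalIdeal (Localization.AtPrime (pointIdeal S a))).spanFinrank =
      Module.finrank ℂ (tangentSpace S (a : W)) :=
  le_antisymm (spanFinrank_maximalIdeal_le a) (finrank_tangentSpace_le a)

/-- A point is smooth exactly when the tangent space has the dimension of the local ring. -/
lemma mem_smoothLocus_iff {S : Set W} (a : S) :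
    (a : W) ∈ smoothLocus S ↔
      ((Module.finrank ℂ (tangentSpace S (a : W)) : ℕ) : ℕ∞) = (pointIdeal S a).height := by
  have hN : IsNoetherianRing (Localization.AtPrime (pointIdeal S a)) :=
    IsLocalization.isNoetherianRing (pointIdeal S a).primeCompl _ inferInstance
  have h1 : (a : W) ∈ smoothLocus S ↔
      IsRegularLocalRing (Localization.AtPrime (pointIdeal S a)) :=
    ⟨fun ⟨_, h⟩ => h, fun h => ⟨a.2, h⟩⟩
  rw [h1, isRegularLocalRing_iff, spanFinrank_maximalIdeal_eq,
    IsLocalization.AtPrime.ringKrullDim_eq_height (pointIdeal S a)]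
  exact_mod_cast Iff.rfl

end CoordRing

end SympCone

namespace SympCone

/-! ### Isotropic flags: shifting by nilpotent elements and general position. -/

section Flags

variable {V : Type*} [AddCommGroup V] [Module ℂ V] {ω : LinearMap.BilinForm ℂ V} {n : ℕ}

lemma endSp_pow_apply {A : Module.End ℂ V} (hA : A ∈ endSp ω) (k : ℕ) (u v : V) :
    ω ((A ^ k) u) v = (-1) ^ k * ω u ((A ^ k) v) := by
  induction k generalizing u v with
  | zero => simp
  | succ k ih =>
    have h1 : (A ^ (k + 1)) v = A ((A ^ k) v) := by rw [pow_succ', Module.End.mul_apply]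
    rw [h1, pow_succ A, Module.End.mul_apply, ih, hA, pow_succ]
    ring

/-- Sequences built step by step. -/
lemma exists_chain {α : Type*} (P : ℕ → α → Prop) (R : α → α → Prop) (m : ℕ)
    (h0 : ∃ a, P 0 a) (hs : ∀ k a, k < m → P k a → ∃ a', P (k + 1) a' ∧ R a a') :
    ∃ f : ℕ → α, (∀ k ≤ m, P k (f k)) ∧ ∀ k < m, R (f k) (f (k + 1)) := by
  induction m with
  | zero =>
    obtain ⟨a, ha⟩ := h0
    exact ⟨fun _ => a, fun k hk => by rwa [Nat.le_zero.1 hk], fun k hk => by omega⟩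
  | succ m ih =>
    obtain ⟨f, hf, hR⟩ := ih fun k a hk => hs k a (by omega)
    obtain ⟨a', ha', hra⟩ := hs m (f m) (by omega) (hf m le_rfl)
    refine ⟨Function.update f (m + 1) a', fun k hk => ?_, fun k hk => ?_⟩
    · rcases Nat.lt_or_ge k (m + 1) with h | h
      · rw [Function.update_of_ne (by omega)]; exact hf k (by omega)
      · obtain rfl : k = m + 1 := by omega
        simpa using ha'
    · rw [Function.update_of_ne (by omega : k ≠ m + 1)]
      rcases Nat.lt_or_ge k m with h | h
      · rw [Function.update_of_ne (by omega)]; exact hR k h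
      · obtain rfl : k = m := by omega
        simpa using hra

variable [FiniteDimensional ℂ V]

/-- An isotropic chain of length `n` extends to a full isotropic flag. -/
lemma exists_flag_of_chain (hω : ω.IsAlt) (hnd : ω.Nondegenerate)
    (hV : Module.finrank ℂ V = 2 * n) {E : ℕ → Submodule ℂ V}
    (hdim : ∀ k ≤ n, Module.finrank ℂ (E k) = k) (hmono : ∀ k < n, E k ≤ E (k + 1))
    (hiso : E n ≤ ω.orthogonal (E n)) :
    ∃ F : IsotropicFlag ω n, (∀ i : Fin (2 * n + 1), (i : ℕ) ≤ n → F.space i = E i) ∧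
      ∀ i : Fin (2 * n + 1), n ≤ (i : ℕ) → F.space i = ω.orthogonal (E (2 * n - i)) := by
  have hmono' : ∀ k l, k ≤ l → l ≤ n → E k ≤ E l := by
    intro k l hkl hl
    induction l, hkl using Nat.le_induction with
    | base => exact le_rfl
    | succ l hkl ih => exact (ih (by omega)).trans (hmono l (by omega))
  -- The middle term is Lagrangian, so the two formulas for the flag agree at `n`.
  have hn : E n = ω.orthogonal (E n) := by
    apply Submodule.eq_of_le_of_finrank_eq hiso
    rw [LinearMap.BilinForm.finrank_orthogonal hnd, hV, hdim n le_rfl]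
    omega
  let sp : Fin (2 * n + 1) → Submodule ℂ V := fun i =>
    if (i : ℕ) ≤ n then E i else ω.orthogonal (E (2 * n - i))
  have h1 : ∀ i : Fin (2 * n + 1), (i : ℕ) ≤ n → sp i = E i := fun i hi => if_pos hi
  have h2 : ∀ i : Fin (2 * n + 1), n ≤ (i : ℕ) → sp i = ω.orthogonal (E (2 * n - i)) := by
    intro i hi
    rcases Nat.eq_or_lt_of_le hi with h | h
    · rw [h1 i h.ge, ← h]
      rw [show 2 * n - n = n by omega]
      exact hn
    · exact if_neg (by omega)
  refine ⟨⟨sp, ?_, ?_, ?_⟩, h1, h2⟩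
  · intro i j hij
    have hij' : (i : ℕ) ≤ j := hij
    have hj : (j : ℕ) ≤ 2 * n := by omega
    rcases Nat.lt_or_ge n j with hjn | hjn
    · rw [h2 j hjn.le]
      rcases Nat.lt_or_ge n i with hin | hin
      · rw [h2 i hin.le]
        exact LinearMap.BilinForm.orthogonal_le (hmono' _ _ (by omega) (by omega))
      · rw [h1 i hin]
        refine (hmono' _ _ hin le_rfl).trans (hn.le.trans ?_)
        exact LinearMap.BilinForm.orthogonal_le (hmono' _ _ (by omega) (by omega))
    · rw [h1 j hjn, h1 i (by omega)]
      exact hmono' _ _ hij' hjn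
  · intro i
    have hi : (i : ℕ) ≤ 2 * n := by omega
    rcases Nat.lt_or_ge n i with hin | hin
    · rw [h2 i hin.le, LinearMap.BilinForm.finrank_orthogonal hnd, hV, hdim _ (by omega)]
      omega
    · rw [h1 i hin, hdim _ hin]
  · intro i
    have hi : (i : ℕ) ≤ 2 * n := by omega
    have hrev : (i.rev : ℕ) = 2 * n - i := by rw [Fin.val_rev]; omega
    rcases Nat.lt_or_ge n i with hin | hin
    · rw [h1 i.rev (by omega), h2 i hin.le, hrev,
        LinearMap.BilinForm.orthogonal_orthogonal hnd hω.isRefl]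
    · rw [h2 i.rev (by omega), h1 i hin, hrev]
      congr 2
      omega

/-- The endomorphism `A` shifts the flag `F`. -/
def Shifts (A : Module.End ℂ V) (F : IsotropicFlag ω n) : Prop :=
  ∀ j : Fin (2 * n), (F.space j.succ).map A ≤ F.space j.castSucc

omit [FiniteDimensional ℂ V] in
lemma isotropic_sup_span (hω : ω.IsAlt) {E : Submodule ℂ V} (hE : E ≤ ω.orthogonal E) {v : V}
    (hv : v ∈ ω.orthogonal E) :
    E ⊔ Submodule.span ℂ {v} ≤ ω.orthogonal (E ⊔ Submodule.span ℂ {v}) := by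
  have hv' : ∀ x ∈ E, ω x v = 0 := hv
  have hvv : ω v v = 0 := hω v
  have hEE : ∀ x ∈ E, ∀ y ∈ E, ω x y = 0 := fun x hx y hy => hE hy x hx
  have hv'' : ∀ x ∈ E, ω v x = 0 := fun x hx => by rw [← hω.neg_eq, hv' x hx, neg_zero]
  rintro x hx y hy
  obtain ⟨x₁, hx₁, x₂, hx₂, rfl⟩ := Submodule.mem_sup.1 hx
  obtain ⟨y₁, hy₁, y₂, hy₂, rfl⟩ := Submodule.mem_sup.1 hy
  obtain ⟨c, rfl⟩ := Submodule.mem_span_singleton.1 hx₂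
  obtain ⟨d, rfl⟩ := Submodule.mem_span_singleton.1 hy₂
  simp [hv' y₁ hy₁, hv'' x₁ hx₁, hvv, hEE y₁ hy₁ x₁ hx₁]

lemma finrank_sup_span {E : Submodule ℂ V} {v : V} (hv : v ∉ E) :
    Module.finrank ℂ ↥(E ⊔ Submodule.span ℂ {v}) = Module.finrank ℂ E + 1 := by
  have h := Submodule.finrank_sup_add_finrank_inf_eq E (Submodule.span ℂ {v})
  have hv0 : v ≠ 0 := fun h => hv (h ▸ E.zero_mem)
  have hdisj : E ⊓ Submodule.span ℂ {v} = ⊥ := by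
    rw [eq_bot_iff]
    rintro x ⟨hx, hx'⟩
    obtain ⟨c, rfl⟩ := Submodule.mem_span_singleton.1 hx'
    by_cases hc : c = 0
    · simp [hc]
    · exact absurd ((Submodule.smul_mem_iff _ hc).1 hx) hv
  rw [hdisj, finrank_bot, finrank_span_singleton hv0] at h
  omega

/-- Every element of the cone shifts a full isotropic flag, which can be chosen to be compatible
with a given isotropic subspace of the kernel. -/
lemma exists_shifts (hω : ω.IsAlt) (hnd : ω.Nondegenerate) (hV : Module.finrank ℂ V = 2 * n)
    {A : Module.End ℂ V} (hA : A ∈ nilCone ω n) {U : Submodule ℂ V} (hU : U ≤ ω.orthogonal U)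
    (hUA : U ≤ LinearMap.ker A) :
    ∃ F : IsotropicFlag ω n, Shifts A F ∧
      ∀ i : Fin (2 * n + 1), (i : ℕ) ≤ n → F.space i ≤ U ∨ U ≤ F.space i := by
  obtain ⟨hAsp, hAn⟩ := hA
  obtain ⟨E, hE, hER⟩ := exists_chain
    (fun k (E : Submodule ℂ V) => Module.finrank ℂ E = k ∧ E ≤ ω.orthogonal E ∧ E.map A ≤ E ∧ (E ≤ U ∨ U ≤ E))
    (fun E E' : Submodule ℂ V => E ≤ E' ∧ E'.map A ≤ E) n
    ⟨⊥, finrank_bot _ _, bot_le, by simp, Or.inl bot_le⟩ (by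
      rintro k E hk ⟨hdim, hiso, hst, hEU⟩
      have key : ∀ v, v ∈ ω.orthogonal E → v ∉ E → A v ∈ E →
          (E ⊔ Submodule.span ℂ {v} ≤ U ∨ U ≤ E ⊔ Submodule.span ℂ {v}) →
          ∃ a' : Submodule ℂ V, (Module.finrank ℂ a' = k + 1 ∧ a' ≤ ω.orthogonal a' ∧ a'.map A ≤ a' ∧
            (a' ≤ U ∨ U ≤ a')) ∧ (E ≤ a' ∧ a'.map A ≤ E) := by
        intro v hv hvE hAv hU
        have hmap : (E ⊔ Submodule.span ℂ {v}).map A ≤ E := by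
          rw [Submodule.map_sup, Submodule.map_span, sup_le_iff]
          exact ⟨hst, by simpa [Submodule.span_le] using hAv⟩
        exact ⟨E ⊔ Submodule.span ℂ {v}, ⟨by rw [finrank_sup_span hvE, hdim],
          isotropic_sup_span hω hiso hv, hmap.trans le_sup_left, hU⟩, le_sup_left, hmap⟩
      -- Once `U` is contained in `E`, new vectors come from the orthogonal of `E`, which `A`
      -- preserves; before that, they come from `U`, where `A` vanishes.
      by_cases hUE : U ≤ E
      · have hlt : E < ω.orthogonal E := by
          refine lt_of_le_of_ne hiso fun h => ?_
          have h1 := LinearMap.BilinForm.finrank_orthogonal hnd E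
          rw [← h, hdim, hV] at h1
          omega
        obtain ⟨x, hx, hxE⟩ := SetLike.exists_of_lt hlt
        classical
        -- The last iterate of `x` outside `E` is the vector to adjoin: `A` maps it into `E`.
        have hex : ∃ m, (A ^ m) x ∈ E := ⟨2 * n, by rw [hAn]; simp⟩
        have hpos : Nat.find hex ≠ 0 := fun h => by
          have := Nat.find_spec hex
          rw [h] at this
          exact hxE (by simpa using this)
        obtain ⟨m, hm⟩ := Nat.exists_eq_succ_of_ne_zero hpos
        refine key ((A ^ m) x) ?_ (Nat.find_min hex (by omega)) ?_ (Or.inr (hUE.trans le_sup_left))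
        · clear hm
          have hst' : ∀ y ∈ ω.orthogonal E, A y ∈ ω.orthogonal E := by
            intro y hy z hz
            have h1 : ω (A z) y = 0 := hy _ (hst ⟨z, hz, rfl⟩)
            rw [hAsp, neg_eq_zero] at h1
            exact h1
          induction m with
          | zero => simpa using hx
          | succ m ih => rw [pow_succ', Module.End.mul_apply]; exact hst' _ ih
        · rw [← Module.End.mul_apply, ← pow_succ', ← Nat.succ_eq_add_one, ← hm]
          exact Nat.find_spec hex
      · have hEU' : E ≤ U := hEU.resolve_right hUE
        obtain ⟨v, hvU, hvE⟩ := Set.not_subset.1 hUE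
        refine key v ?_ hvE ?_ (Or.inl (sup_le hEU' (by simpa [Submodule.span_le] using hvU)))
        · exact LinearMap.BilinForm.orthogonal_le hEU' (hU hvU)
        · have : A v = 0 := hUA hvU
          rw [this]; exact E.zero_mem)
  obtain ⟨F, hF1, hF2⟩ := exists_flag_of_chain hω hnd hV (fun k hk => (hE k hk).1)
    (fun k hk => (hER k hk).1) (hE n le_rfl).2.1
  refine ⟨F, fun j => ?_, fun i hi => ?_⟩
  · rcases Nat.lt_or_ge (j : ℕ) n with hj | hj
    · rw [hF1 j.succ (by simp; omega), hF1 j.castSucc (by simp; omega)]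
      simpa using (hER j hj).2
    · rw [hF2 j.succ (by simp; omega), hF2 j.castSucc (by simpa using hj)]
      simp only [Fin.val_succ, Fin.val_castSucc]
      have hj2 := j.2
      -- Above the middle the shift property is dual to that below, because `A` is skew for `ω`.
      have h1 := (hER (2 * n - (j + 1)) (by omega)).2
      rw [show 2 * n - (j + 1) + 1 = 2 * n - (j : ℕ) by omega] at h1
      rintro _ ⟨y, hy, rfl⟩ z hz
      have h2 : ω (A z) y = 0 := hy _ (h1 ⟨z, hz, rfl⟩)
      rw [hAsp, neg_eq_zero] at h2
      exact h2
  · rw [hF1 i hi]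
    exact (hE i hi).2.2.2

/-- Two flags are opposite. -/
def Opposite (F E : IsotropicFlag ω n) : Prop :=
  ∀ i : Fin (2 * n + 1), F.space i ⊓ E.space i.rev = ⊥

/-- The lower half of the opposite flag is built one vector at a time. The next vector lies in the
orthogonal of `E` and has to avoid one hyperplane section of it for each given flag; a vector space
is not the union of two proper subspaces. -/
lemma exists_common_opposite (hω : ω.IsAlt) (hnd : ω.Nondegenerate)
    (hV : Module.finrank ℂ V = 2 * n) (F F' : IsotropicFlag ω n) :
    ∃ E : IsotropicFlag ω n, Opposite F E ∧ Opposite F' E := by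
  -- a hyperplane does not contain `E^⊥`
  have step : ∀ (F : IsotropicFlag ω n) (k : ℕ) (hk : k < n) (E : Submodule ℂ V),
      Module.finrank ℂ E = k → E ≤ ω.orthogonal E → E ⊓ F.space ⟨2 * n - k, by omega⟩ = ⊥ →
      ¬ ω.orthogonal E ≤ E ⊔ F.space ⟨2 * n - k - 1, by omega⟩ := by
    intro F k hk E hdim hiso hdisj hle
    have h1 : ω.orthogonal (E ⊔ F.space ⟨2 * n - k - 1, by omega⟩) ≤ E := by
      have := LinearMap.BilinForm.orthogonal_le (B := ω) hle
      rwa [LinearMap.BilinForm.orthogonal_orthogonal hnd hω.isRefl] at this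
    have h2 : ω.orthogonal (E ⊔ F.space ⟨2 * n - k - 1, by omega⟩) ≤
        F.space ⟨2 * n - k, by omega⟩ := by
      refine (LinearMap.BilinForm.orthogonal_le le_sup_right).trans ?_
      rw [← F.space_rev]
      refine F.mono ?_
      rw [Fin.le_def, Fin.val_rev]
      simp only
      omega
    -- If the inclusion held, the sum would have zero orthogonal and so be all of `V`, but its
    -- dimension is at most `2 * n - 1`.
    have h3 : ω.orthogonal (E ⊔ F.space ⟨2 * n - k - 1, by omega⟩) = ⊥ := by
      rw [eq_bot_iff, ← hdisj]
      exact le_inf h1 h2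
    have h4 := LinearMap.BilinForm.finrank_orthogonal hnd
      (E ⊔ F.space ⟨2 * n - k - 1, by omega⟩)
    rw [h3, finrank_bot, hV] at h4
    have h5 := Submodule.finrank_add_le_finrank_add_finrank E (F.space ⟨2 * n - k - 1, by omega⟩)
    rw [hdim, F.finrank_space] at h5
    simp only at h5
    omega
  have hdisj_step : ∀ (F : IsotropicFlag ω n) (k : ℕ) (hk : k < n) (E : Submodule ℂ V) (v : V),
      E ⊓ F.space ⟨2 * n - k, by omega⟩ = ⊥ → v ∉ E ⊔ F.space ⟨2 * n - k - 1, by omega⟩ →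
      (E ⊔ Submodule.span ℂ {v}) ⊓ F.space ⟨2 * n - (k + 1), by omega⟩ = ⊥ := by
    intro F k hk E v hdisj hv
    rw [eq_bot_iff]
    rintro x ⟨hx, hx'⟩
    obtain ⟨y, hy, z, hz, rfl⟩ := Submodule.mem_sup.1 hx
    obtain ⟨c, rfl⟩ := Submodule.mem_span_singleton.1 hz
    by_cases hc : c = 0
    · subst hc
      rw [zero_smul, add_zero] at hx' ⊢
      rw [← hdisj]
      exact ⟨hy, F.mono (by rw [Fin.le_def]; simp only; omega) hx'⟩
    · exfalso
      apply hv
      rw [← Submodule.smul_mem_iff _ hc]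
      have : c • v = -y + (y + c • v) := by abel
      rw [this]
      exact Submodule.add_mem_sup (E.neg_mem hy) hx'
  obtain ⟨E, hE, hER⟩ := exists_chain
    (fun k (E : Submodule ℂ V) => Module.finrank ℂ E = k ∧ E ≤ ω.orthogonal E ∧
      ∀ hk : k ≤ n, E ⊓ F.space ⟨2 * n - k, by omega⟩ = ⊥ ∧
        E ⊓ F'.space ⟨2 * n - k, by omega⟩ = ⊥)
    (fun E E' : Submodule ℂ V => E ≤ E') n
    ⟨⊥, finrank_bot _ _, bot_le, by simp⟩ (by
      rintro k E hk ⟨hdim, hiso, hd⟩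
      obtain ⟨hd1, hd2⟩ := hd hk.le
      have h1 := step F k hk E hdim hiso hd1
      have h2 := step F' k hk E hdim hiso hd2
      obtain ⟨v, hv, hv1, hv2⟩ : ∃ v ∈ ω.orthogonal E,
          v ∉ E ⊔ F.space ⟨2 * n - k - 1, by omega⟩ ∧
          v ∉ E ⊔ F'.space ⟨2 * n - k - 1, by omega⟩ := by
        obtain ⟨x, hx, hx1⟩ := Set.not_subset.1 h1
        obtain ⟨y, hy, hy1⟩ := Set.not_subset.1 h2
        by_cases hx2 : x ∈ E ⊔ F'.space ⟨2 * n - k - 1, by omega⟩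
        · by_cases hy2 : y ∈ E ⊔ F.space ⟨2 * n - k - 1, by omega⟩
          · refine ⟨x + y, add_mem hx hy, fun h => hx1 ?_, fun h => hy1 ?_⟩
            · simpa using sub_mem h hy2
            · simpa using sub_mem h hx2
          · exact ⟨y, hy, hy2, hy1⟩
        · exact ⟨x, hx, hx1, hx2⟩
      exact ⟨E ⊔ Submodule.span ℂ {v}, ⟨by
        rw [finrank_sup_span (fun h => hv1 (Submodule.mem_sup_left h)), hdim],
        isotropic_sup_span hω hiso hv, fun _ => ⟨hdisj_step F k hk E v hd1 hv1,
          hdisj_step F' k hk E v hd2 hv2⟩⟩, le_sup_left⟩)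
  obtain ⟨G, hG1, hG2⟩ := exists_flag_of_chain hω hnd hV (fun k hk => (hE k hk).1)
    (fun k hk => hER k hk) (hE n le_rfl).2.1
  have opp : ∀ F : IsotropicFlag ω n,
      (∀ k, ∀ hk : k ≤ n, E k ⊓ F.space ⟨2 * n - k, by omega⟩ = ⊥) → Opposite F G := by
    intro F h i
    have hi : (i : ℕ) ≤ 2 * n := by omega
    have hrev : (i.rev : ℕ) = 2 * n - i := by rw [Fin.val_rev]; omega
    rcases Nat.lt_or_ge (i : ℕ) n with hin | hin
    -- Below the middle oppositeness is dual to that above: an intersection of orthogonals is the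
    -- orthogonal of the sum, which is all of `V`.
    · rw [hG2 _ (by omega), hrev, show 2 * n - (2 * n - (i : ℕ)) = i by omega]
      have h1 := h i hin.le
      have h2 : F.space i = ω.orthogonal (F.space ⟨2 * n - i, by omega⟩) := by
        rw [← F.space_rev]
        congr 1
        ext
        rw [Fin.val_rev]
        simp only
        omega
      rw [h2]
      have h3 : ω.orthogonal (F.space ⟨2 * n - i, by omega⟩) ⊓ ω.orthogonal (E i) ≤
          ω.orthogonal (E i ⊔ F.space ⟨2 * n - i, by omega⟩) := by
        rintro x ⟨hx1, hx2⟩ y hy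
        obtain ⟨y₁, hy₁, y₂, hy₂, rfl⟩ := Submodule.mem_sup.1 hy
        have e1 : ω y₁ x = 0 := hx2 y₁ hy₁
        have e2 : ω y₂ x = 0 := hx1 y₂ hy₂
        simp [e1, e2]
      have h4 : E i ⊔ F.space ⟨2 * n - i, by omega⟩ = ⊤ := by
        apply Submodule.eq_top_of_finrank_eq
        have h5 := Submodule.finrank_sup_add_finrank_inf_eq (E i) (F.space ⟨2 * n - i, by omega⟩)
        rw [h1, finrank_bot, (hE i hin.le).1, F.finrank_space] at h5
        simp only at h5
        omega
      rw [h4, LinearMap.BilinForm.orthogonal_top_eq_bot hnd] at h3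
      exact eq_bot_iff.2 h3
    · rw [hG1 _ (by omega), inf_comm, hrev]
      have h1 := h (2 * n - i) (by omega)
      rwa [show (⟨2 * n - (2 * n - (i : ℕ)), by omega⟩ : Fin (2 * n + 1)) = i from
        Fin.ext (by simp only; omega)] at h1
  exact ⟨G, opp F fun k hk => ((hE k hk).2.2 hk).1, opp F' fun k hk => ((hE k hk).2.2 hk).2⟩

end Flags

end SympCone

namespace SympCone

/-! ### Bases adapted to a flag. -/

section Adapted

variable {V : Type*} [AddCommGroup V] [Module ℂ V] {ω : LinearMap.BilinForm ℂ V} {n : ℕ}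

lemma IsAdapted.mem_space_iff {F : IsotropicFlag ω n} {c : Fin (2 * n) → V} (hc : IsAdapted c F)
    {i : Fin (2 * n + 1)} {v : V} :
    v ∈ F.space i ↔ ∃ t : {j : Fin (2 * n) // j.castSucc < i} → ℂ, ∑ j, t j • c j = v := by
  rw [hc i, Set.image_eq_range, Submodule.mem_span_range_iff_exists_fun]
  rfl

lemma IsAdapted.mem {F : IsotropicFlag ω n} {c : Fin (2 * n) → V} (hc : IsAdapted c F)
    {i : Fin (2 * n + 1)} {j : Fin (2 * n)} (h : j.castSucc < i) : c j ∈ F.space i := by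
  rw [hc i]
  exact Submodule.subset_span ⟨j, h, rfl⟩

variable [FiniteDimensional ℂ V]

omit [FiniteDimensional ℂ V] in
lemma IsotropicFlag.space_last (F : IsotropicFlag ω n) (hV : Module.finrank ℂ V = 2 * n)
    [FiniteDimensional ℂ V] : F.space (Fin.last _) = ⊤ := by
  apply Submodule.eq_top_of_finrank_eq
  rw [F.finrank_space, hV]; simp

omit [FiniteDimensional ℂ V] in
lemma IsotropicFlag.space_zero (F : IsotropicFlag ω n) [FiniteDimensional ℂ V] :
    F.space 0 = ⊥ := by
  rw [← Submodule.finrank_eq_zero (R := ℂ), F.finrank_space]; rfl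

lemma isAdapted_of_mem {F : IsotropicFlag ω n} {c : Fin (2 * n) → V}
    (h1 : ∀ i, c i ∈ F.space i.succ) (h2 : ∀ i, c i ∉ F.space i.castSucc) : IsAdapted c F := by
  intro i
  induction i using Fin.induction with
  | zero =>
    rw [F.space_zero]
    simp
  | succ i ih =>
    have hset : {j : Fin (2 * n) | j.castSucc < i.succ} =
        insert i {j : Fin (2 * n) | j.castSucc < i.castSucc} := by
      ext j
      simp only [Set.mem_ofPred_eq, Set.mem_insert_iff, Fin.lt_def, Fin.val_castSucc, Fin.val_succ,
        Fin.ext_iff]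
      omega
    rw [hset, Set.image_insert_eq, Submodule.span_insert, ← ih, sup_comm]
    symm
    apply Submodule.eq_of_le_of_finrank_eq
    · refine sup_le (F.mono (Fin.castSucc_lt_succ).le) ?_
      simpa [Submodule.span_le] using h1 i
    · rw [finrank_sup_span (h2 i), F.finrank_space, F.finrank_space]
      simp

lemma IsAdapted.span_eq_top {F : IsotropicFlag ω n} {c : Fin (2 * n) → V} (hc : IsAdapted c F)
    (hV : Module.finrank ℂ V = 2 * n) : Submodule.span ℂ (Set.range c) = ⊤ := by
  rw [← F.space_last hV, hc]
  congr 1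
  ext x
  simp [Fin.castSucc_lt_last]

lemma IsAdapted.linearIndependent {F : IsotropicFlag ω n} {c : Fin (2 * n) → V}
    (hc : IsAdapted c F) (hV : Module.finrank ℂ V = 2 * n) : LinearIndependent ℂ c :=
  linearIndependent_of_top_le_span_of_card_eq_finrank (hc.span_eq_top hV).ge (by simp [hV])

lemma IsAdapted.not_mem {F : IsotropicFlag ω n} {c : Fin (2 * n) → V} (hc : IsAdapted c F)
    (hV : Module.finrank ℂ V = 2 * n) {i : Fin (2 * n + 1)} {j : Fin (2 * n)}
    (h : i ≤ j.castSucc) : c j ∉ F.space i := by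
  rw [hc i]
  intro h2
  have := (hc.linearIndependent hV).notMem_span_image (s := {j | j.castSucc < i}) (x := j)
    (by simpa using h)
  exact this h2

end Adapted

/-! ### Symplectic bases and flags in general position. -/

section SympBases

/-- The sign of the `i`-th member of a symplectic basis. -/
def sg (n : ℕ) (i : Fin (2 * n)) : ℂ := if (i : ℕ) < n then 1 else -1

lemma sg_rev {n : ℕ} (i : Fin (2 * n)) : sg n i.rev = - sg n i := by
  have := i.2
  unfold sg
  rw [Fin.val_rev]
  by_cases h : (i : ℕ) < n
  · rw [if_pos h, if_neg (by omega)]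
  · rw [if_neg h, if_pos (by omega), neg_neg]

lemma sg_mul_self {n : ℕ} (i : Fin (2 * n)) : sg n i * sg n i = 1 := by
  unfold sg; split_ifs <;> norm_num

lemma sg_ne_zero {n : ℕ} (i : Fin (2 * n)) : sg n i ≠ 0 := by
  unfold sg; split_ifs <;> norm_num

variable {V : Type*} [AddCommGroup V] [Module ℂ V] {ω : LinearMap.BilinForm ℂ V} {n : ℕ}

/-- Symplectic bases: `b i` pairs to `± 1` with `b i.rev` and to `0` with the other members. -/
def IsSympBasis (ω : LinearMap.BilinForm ℂ V) (b : Fin (2 * n) → V) : Prop :=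
  ∀ i j, ω (b i) (b j) = if j = i.rev then sg n i else 0

namespace IsSympBasis

variable {b : Fin (2 * n) → V} (hb : IsSympBasis ω b)
include hb

lemma pair_sum (i : Fin (2 * n)) (t : Fin (2 * n) → ℂ) :
    ω (b i) (∑ j, t j • b j) = sg n i * t i.rev := by
  simp [hb i, mul_comm]

lemma pair_ne {i j : Fin (2 * n)} (h : j ≠ i.rev) : ω (b i) (b j) = 0 := by simp [hb i, h]

lemma linearIndependent : LinearIndependent ℂ b := by
  rw [Fintype.linearIndependent_iff]
  intro t ht i
  have := hb.pair_sum i.rev t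
  rw [ht, map_zero, Fin.rev_rev] at this
  exact (mul_eq_zero.1 this.symm).resolve_left (sg_ne_zero _)

variable [FiniteDimensional ℂ V] (hV : Module.finrank ℂ V = 2 * n)
include hV

lemma span_eq_top : Submodule.span ℂ (Set.range b) = ⊤ :=
  hb.linearIndependent.span_eq_top_of_card_eq_finrank' (by simp [hV])

lemma expand (v : V) : v = ∑ j, (sg n j * ω (b j) v) • b j.rev := by
  have hv : v ∈ Submodule.span ℂ (Set.range b) := by rw [hb.span_eq_top hV]; trivial
  obtain ⟨t, rfl⟩ := (Submodule.mem_span_range_iff_exists_fun ℂ).1 hv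
  have : ∀ j, (sg n j * ω (b j) (∑ j, t j • b j)) • b j.rev = t j.rev • b j.rev := by
    intro j
    rw [hb.pair_sum, ← mul_assoc, sg_mul_self, one_mul]
  simp_rw [this]
  exact (Equiv.sum_comp Fin.revPerm (fun j => t j • b j)).symm

lemma expand' (v : V) : v = ∑ j, (sg n j.rev * ω (b j.rev) v) • b j := by
  conv_lhs => rw [hb.expand hV v]
  have := Equiv.sum_comp Fin.revPerm (fun j => (sg n j * ω (b j) v) • b j.rev)
  simp only [Fin.revPerm_apply, Fin.rev_rev] at this
  exact this.symm

lemma eq_zero_of {v : V} (h : ∀ j, ω (b j) v = 0) : v = 0 := by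
  rw [hb.expand hV v]; simp [h]

lemma end_eq_zero_of {X : Module.End ℂ V} (h : ∀ i j, ω (b i) (X (b j)) = 0) : X = 0 := by
  ext v
  rw [hb.expand' hV v, map_sum, LinearMap.zero_apply]
  refine Finset.sum_eq_zero fun j _ => ?_
  rw [map_smul, hb.eq_zero_of hV fun i => h i j, smul_zero]

lemma pair_eq_sum (hω : ω.IsAlt) (u v : V) :
    ω u v = - ∑ j, sg n j * ω (b j.rev) u * ω (b j) v := by
  conv_lhs => rw [hb.expand hV v]
  simp only [map_sum, map_smul, smul_eq_mul, ← Finset.sum_neg_distrib]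
  refine Finset.sum_congr rfl fun j _ => ?_
  rw [← hω.neg_eq u (b j.rev)]; ring

/-- Up to sign, `ω (b j.rev) v` is the coefficient of `b j` in `v`. This form turns membership in a
step of the flag into linear equations. -/
lemma mem_span_iff {i : Fin (2 * n + 1)} {v : V} :
    v ∈ Submodule.span ℂ (b '' {j | j.castSucc < i}) ↔
      ∀ j : Fin (2 * n), i ≤ j.castSucc → ω (b j.rev) v = 0 := by
  constructor
  · intro hv j hj
    have : Submodule.span ℂ (b '' {j | j.castSucc < i}) ≤ LinearMap.ker (ω (b j.rev)) := by
      rw [Submodule.span_le]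
      rintro _ ⟨k, hk, rfl⟩
      refine hb.pair_ne ?_
      rw [Fin.rev_rev]
      rintro rfl
      exact absurd (lt_of_lt_of_le hk hj) (lt_irrefl _)
    exact this hv
  · intro h
    rw [hb.expand' hV v]
    refine Submodule.sum_mem _ fun j _ => ?_
    by_cases hj : j.castSucc < i
    · exact Submodule.smul_mem _ _ (Submodule.subset_span ⟨j, hj, rfl⟩)
    · rw [h j (not_lt.1 hj)]; simp

/-- The flag of a symplectic basis. -/
lemma exists_flag : ∃ F : IsotropicFlag ω n, IsAdapted b F := by
  refine ⟨⟨fun i => Submodule.span ℂ (b '' {j | j.castSucc < i}), ?_, ?_, ?_⟩, fun i => rfl⟩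
  · intro i j hij
    exact Submodule.span_mono (Set.image_mono fun k hk => lt_of_lt_of_le hk hij)
  · intro i
    have := Fintype.ofFinite (b '' {j | j.castSucc < i})
    have h1 := finrank_span_set_eq_card (R := ℂ) (s := b '' {j | j.castSucc < i})
      (hb.linearIndependent.linearIndepOn_id.mono (Set.image_subset_range _ _))
    rw [h1, Set.toFinset_card, Fintype.card_eq_nat_card, Nat.card_coe_set_eq,
      Set.ncard_image_of_injective _ hb.linearIndependent.injective, ← Nat.card_coe_set_eq]
    have hcard : Nat.card {j : Fin (2 * n) // j.castSucc < i} = Nat.card (Fin i) := by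
      refine Nat.card_congr ⟨fun j => ⟨j.1, j.2⟩, fun k => ⟨⟨k, by omega⟩, k.2⟩, fun _ => rfl,
        fun _ => rfl⟩
    rw [Nat.card_fin] at hcard
    exact hcard
  · intro i
    ext v
    rw [hb.mem_span_iff hV]
    constructor
    · intro h u hu
      have : Submodule.span ℂ (b '' {j | j.castSucc < i}) ≤ LinearMap.ker (ω.flip v) := by
        rw [Submodule.span_le]
        rintro _ ⟨k, hk, rfl⟩
        have := h k.rev (by
          rw [Fin.le_def, Fin.val_rev, Fin.val_castSucc, Fin.val_rev]
          have : (k : ℕ) < i := hk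
          omega)
        rwa [Fin.rev_rev] at this
      exact this hu
    · intro h j hj
      refine h _ (Submodule.subset_span ⟨j.rev, ?_, rfl⟩)
      show j.rev.castSucc < i
      rw [Fin.lt_def, Fin.val_castSucc, Fin.val_rev]
      rw [Fin.le_def, Fin.val_rev, Fin.val_castSucc] at hj
      omega

end IsSympBasis

variable [FiniteDimensional ℂ V]

/-- Two opposite flags have a common adapted symplectic basis. -/
lemma exists_isSympBasis (hω : ω.IsAlt) (hnd : ω.Nondegenerate)
    (hV : Module.finrank ℂ V = 2 * n) {F E : IsotropicFlag ω n} (hFE : Opposite F E) :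
    ∃ b : Fin (2 * n) → V, IsSympBasis ω b ∧ IsAdapted b F ∧ IsAdapted (fun i => b i.rev) E := by
  -- The two dimensions add up to `2 * n + 1`, so the subspaces meet.
  have hex : ∀ i : Fin (2 * n), ∃ v ∈ F.space i.succ ⊓ E.space i.castSucc.rev, v ≠ 0 := by
    intro i
    rw [← Submodule.ne_bot_iff]
    intro h
    have h1 := Submodule.finrank_sup_add_finrank_inf_eq (F.space i.succ) (E.space i.castSucc.rev)
    have h2 := Submodule.finrank_le (F.space i.succ ⊔ E.space i.castSucc.rev)
    rw [h, finrank_bot, F.finrank_space, E.finrank_space, Fin.val_succ, Fin.val_rev,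
      Fin.val_castSucc] at h1
    rw [hV] at h2
    omega
  choose v hv hv0 using hex
  have hvF : ∀ i, v i ∉ F.space i.castSucc := by
    intro i h
    have : v i ∈ F.space i.castSucc ⊓ E.space i.castSucc.rev := ⟨h, (hv i).2⟩
    rw [hFE] at this
    exact hv0 i (by simpa using this)
  have hvE : ∀ i, v i ∉ E.space i.succ.rev := by
    intro i h
    have : v i ∈ F.space i.succ ⊓ E.space i.succ.rev := ⟨(hv i).1, h⟩
    rw [hFE] at this
    exact hv0 i (by simpa using this)
  -- Below the antidiagonal degree the isotropy of `F` gives orthogonality; above it, the isotropy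
  -- of `E` does.
  have hpair : ∀ i j : Fin (2 * n), j ≠ i.rev → ω (v i) (v j) = 0 := by
    intro i j hij
    have hij' : (j : ℕ) ≠ 2 * n - (i + 1) := fun h => hij (Fin.ext (by rw [Fin.val_rev, h]))
    rcases Nat.lt_or_ge (i + j + 1) (2 * n) with h | h
    · have h1 : v j ∈ F.space i.succ.rev := by
        refine F.mono ?_ (hv j).1
        rw [Fin.le_def, Fin.val_rev, Fin.val_succ, Fin.val_succ]
        omega
      rw [F.space_rev] at h1
      exact h1 _ (hv i).1
    · have h1 : v j ∈ E.space i.castSucc.rev.rev := by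
        refine E.mono ?_ (hv j).2
        rw [Fin.le_def, Fin.rev_rev, Fin.val_rev, Fin.val_castSucc, Fin.val_castSucc]
        omega
      rw [E.space_rev] at h1
      exact h1 _ (hv i).2
  have hvad : IsAdapted v F := isAdapted_of_mem (fun i => (hv i).1) hvF
  have hne : ∀ i, ω (v i) (v i.rev) ≠ 0 := by
    intro i h
    have : ∀ w, ω (v i) w = 0 := by
      intro w
      have hle : Submodule.span ℂ (Set.range v) ≤ LinearMap.ker (ω (v i)) := by
        rw [Submodule.span_le]
        rintro _ ⟨j, rfl⟩
        by_cases hj : j = i.rev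
        · subst hj; exact h
        · exact hpair i j hj
      rw [hvad.span_eq_top hV] at hle
      exact hle trivial
    exact hv0 i (hnd.1 _ this)
  -- Only the last `n` vectors are rescaled, to pair to 1 with their partners in the first half.
  let κ : Fin (2 * n) → ℂ := fun i => if (i : ℕ) < n then 1 else (ω (v i.rev) (v i))⁻¹
  have hκ : ∀ i, κ i ≠ 0 := by
    intro i
    have := hne i.rev
    rw [Fin.rev_rev] at this
    simp only [κ]
    split_ifs
    · exact one_ne_zero
    · exact inv_ne_zero this
  refine ⟨fun i => κ i • v i, ?_, isAdapted_of_mem ?_ ?_, isAdapted_of_mem ?_ ?_⟩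
  · intro i j
    simp only [map_smul, LinearMap.smul_apply, smul_eq_mul]
    by_cases hj : j = i.rev
    · subst hj
      rw [if_pos rfl]
      have hlt := i.2
      simp only [κ, sg, Fin.val_rev, Fin.rev_rev]
      by_cases hi : (i : ℕ) < n
      · rw [if_neg (by omega), if_pos hi, if_pos hi]
        field_simp [hne i]
      · rw [if_pos (by omega), if_neg hi, if_neg hi, ← hω.neg_eq (v i) (v i.rev)]
        have := hne i.rev
        rw [Fin.rev_rev] at this
        have h2 := hne i
        field_simp
    · rw [if_neg hj, hpair i j hj]; ring
  · exact fun i => Submodule.smul_mem _ _ (hv i).1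
  · exact fun i h => hvF i ((Submodule.smul_mem_iff _ (hκ i)).1 h)
  · intro i
    refine Submodule.smul_mem _ _ ?_
    have := (hv i.rev).2
    have hi : i.rev.castSucc.rev = i.succ :=
      Fin.ext (by simp only [Fin.val_succ, Fin.val_rev, Fin.val_castSucc]; omega)
    rwa [hi] at this
  · intro i h
    refine hvE i.rev ?_
    have := (Submodule.smul_mem_iff _ (hκ i.rev)).1 h
    convert this using 2
    ext
    simp only [Fin.val_succ, Fin.val_rev, Fin.val_castSucc]
    omega

lemma exists_adapted_isSympBasis (hω : ω.IsAlt) (hnd : ω.Nondegenerate)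
    (hV : Module.finrank ℂ V = 2 * n) (F : IsotropicFlag ω n) :
    ∃ b : Fin (2 * n) → V, IsSympBasis ω b ∧ IsAdapted b F := by
  obtain ⟨E, hE, -⟩ := exists_common_opposite hω hnd hV F F
  obtain ⟨b, h1, h2, -⟩ := exists_isSympBasis hω hnd hV hE
  exact ⟨b, h1, h2⟩

/-- The flag `F` is opposite to the flag spanned by the last members of `ε`. -/
def OppTo (ε : Fin (2 * n) → V) (F : IsotropicFlag ω n) : Prop :=
  ∀ i, ∀ v ∈ F.space i, (∀ k : Fin (2 * n), k.castSucc < i → ω (ε k.rev) v = 0) → v = 0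

omit [FiniteDimensional ℂ V] in
lemma oppTo_of_opposite {ε : Fin (2 * n) → V} [FiniteDimensional ℂ V]
    (hV : Module.finrank ℂ V = 2 * n) (hε : IsSympBasis ω ε)
    {F E : IsotropicFlag ω n} (hFE : Opposite F E) (hE : IsAdapted (fun i => ε i.rev) E) :
    OppTo ε F := by
  intro i v hv h
  have : v ∈ F.space i ⊓ E.space i.rev := by
    refine ⟨hv, ?_⟩
    rw [hε.expand hV v]
    refine Submodule.sum_mem _ fun j _ => ?_
    by_cases hj : j.castSucc < i.rev
    · exact Submodule.smul_mem _ _ (hE.mem hj)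
    · have := h j.rev (by
        rw [Fin.lt_def, Fin.val_castSucc, Fin.val_rev]
        rw [Fin.lt_def, Fin.val_castSucc, Fin.val_rev] at hj
        have := j.2
        omega)
      rw [Fin.rev_rev] at this
      rw [this]; simp
  rw [hFE] at this
  simpa using this

lemma oppTo_self {ε : Fin (2 * n) → V} (hV : Module.finrank ℂ V = 2 * n) (hε : IsSympBasis ω ε)
    {F : IsotropicFlag ω n} (hF : IsAdapted ε F) : OppTo ε F := by
  intro i v hv h
  rw [hF i, hε.mem_span_iff hV] at hv
  refine hε.eq_zero_of hV fun j => ?_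
  rw [← Fin.rev_rev j]
  rcases lt_or_ge j.rev.castSucc i with hj | hj
  · exact h _ hj
  · exact hv _ hj

/-- The functionals in question are as many as the dimension of the flag step, and oppositeness says
that they separate its points; hence they are coordinates on it. -/
lemma existsUnique_oppBasis {ε : Fin (2 * n) → V} {F : IsotropicFlag ω n} (h : OppTo ε F) (i : Fin (2 * n)) :
    ∃! v, v ∈ F.space i.succ ∧ ∀ k : Fin (2 * n), k ≤ i →
      ω (ε k.rev) v = if k = i then sg n i.rev else 0 := by
  let L : F.space i.succ →ₗ[ℂ] ({k : Fin (2 * n) // k ≤ i} → ℂ) :=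
    LinearMap.pi fun k => (ω (ε k.1.rev)) ∘ₗ (F.space i.succ).subtype
  have hinj : Function.Injective L := by
    rw [← LinearMap.ker_eq_bot, LinearMap.ker_eq_bot']
    rintro ⟨v, hv⟩ hL
    ext
    exact h i.succ v hv fun k hk => congrFun hL ⟨k, Fin.castSucc_lt_succ_iff.1 hk⟩
  have hcard : Fintype.card {k : Fin (2 * n) // k ≤ i} = i + 1 := by
    rw [Fintype.card_subtype]
    have : (Finset.univ.filter fun k : Fin (2 * n) => k ≤ i) = Finset.Iic i := by ext; simp
    rw [this, Fin.card_Iic]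
  have hsurj : Function.Surjective L := by
    rw [← LinearMap.injective_iff_surjective_of_finrank_eq_finrank]
    · exact hinj
    · rw [F.finrank_space, Module.finrank_fintype_fun_eq_card, hcard, Fin.val_succ]
  obtain ⟨⟨v, hv⟩, hLv⟩ := hsurj fun k => if k.1 = i then sg n i.rev else 0
  refine ⟨v, ⟨hv, fun k hk => congrFun hLv ⟨k, hk⟩⟩, ?_⟩
  rintro w ⟨hw, hw'⟩
  have : L ⟨w, hw⟩ = L ⟨v, hv⟩ := by
    rw [hLv]; ext k; exact hw' k.1 k.2
  exact congrArg Subtype.val (hinj this)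

open Classical in
/-- The symplectic basis adapted to `F` that is unitriangular with respect to `ε`. -/
noncomputable def oppBasis (ε : Fin (2 * n) → V) (F : IsotropicFlag ω n) (i : Fin (2 * n)) : V :=
  if h : ∃ v, v ∈ F.space i.succ ∧ ∀ k : Fin (2 * n), k ≤ i →
      ω (ε k.rev) v = if k = i then sg n i.rev else 0 then h.choose else 0

lemma oppBasis_spec {ε : Fin (2 * n) → V} {F : IsotropicFlag ω n} (h : OppTo ε F) (i : Fin (2 * n)) :
    oppBasis ε F i ∈ F.space i.succ ∧ ∀ k : Fin (2 * n), k ≤ i →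
      ω (ε k.rev) (oppBasis ε F i) = if k = i then sg n i.rev else 0 := by
  have := (existsUnique_oppBasis h i).exists
  rw [oppBasis, dif_pos this]
  exact this.choose_spec

lemma eq_oppBasis {ε : Fin (2 * n) → V} {F : IsotropicFlag ω n} (h : OppTo ε F) (i : Fin (2 * n)) {v : V}
    (hv : v ∈ F.space i.succ) (hv' : ∀ k : Fin (2 * n), k ≤ i →
      ω (ε k.rev) v = if k = i then sg n i.rev else 0) : v = oppBasis ε F i :=
  (existsUnique_oppBasis h i).unique ⟨hv, hv'⟩ (oppBasis_spec h i)

lemma oppBasis_isAdapted {ε : Fin (2 * n) → V} {F : IsotropicFlag ω n} (h : OppTo ε F) :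
    IsAdapted (oppBasis ε F) F := by
  refine isAdapted_of_mem (fun i => (oppBasis_spec h i).1) fun i hi => ?_
  have h1 := (oppBasis_spec h i).2
  have h2 : oppBasis ε F i = 0 := h _ _ hi fun k hk => by
    have hk' : k < i := hk
    rw [h1 k hk'.le, if_neg hk'.ne]
  have h3 := h1 i le_rfl
  rw [h2, map_zero, if_pos rfl] at h3
  exact sg_ne_zero _ h3.symm

/-- Pairings of low total degree vanish by isotropy of the flag. The others are expanded in `ε`,
where unitriangularity leaves at most the term `k = i`, and this only for `j = i.rev`. -/
lemma oppBasis_isSympBasis (hω : ω.IsAlt) (hV : Module.finrank ℂ V = 2 * n)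
    {ε : Fin (2 * n) → V} (hε : IsSympBasis ω ε) {F : IsotropicFlag ω n} (h : OppTo ε F) :
    IsSympBasis ω (oppBasis ε F) := by
  intro i j
  have hi := i.2
  have hj := j.2
  rcases Nat.lt_or_ge (i + j + 1) (2 * n) with hij | hij
  · rw [if_neg (fun h => by rw [h, Fin.val_rev] at hij; omega)]
    have h1 : oppBasis ε F j ∈ F.space i.succ.rev := by
      refine F.mono ?_ (oppBasis_spec h j).1
      rw [Fin.le_def, Fin.val_rev, Fin.val_succ, Fin.val_succ]
      omega
    rw [F.space_rev] at h1
    exact h1 _ (oppBasis_spec h i).1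
  · rw [hε.pair_eq_sum hV hω]
    have hz : ∀ k : Fin (2 * n), (k ≠ i ∨ j ≠ i.rev) →
        sg n k * ω (ε k.rev) (oppBasis ε F i) * ω (ε k) (oppBasis ε F j) = 0 := by
      intro k hk
      rcases lt_or_ge k i with hki | hki
      · rw [(oppBasis_spec h i).2 k hki.le, if_neg hki.ne]; ring
      · have hne : k.rev < j := by
          rw [Fin.lt_def, Fin.val_rev]
          have hki' : (i : ℕ) ≤ k := hki
          have hk2 := k.2
          rcases hk with hk | hk
          · have : (k : ℕ) ≠ i := fun h => hk (Fin.ext h)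
            omega
          · have : (j : ℕ) ≠ 2 * n - (i + 1) := fun h => hk (Fin.ext (by rw [Fin.val_rev, h]))
            omega
        have := (oppBasis_spec h j).2 k.rev hne.le
        rw [Fin.rev_rev, if_neg hne.ne] at this
        rw [this]; ring
    by_cases hji : j = i.rev
    · rw [if_pos hji, Finset.sum_eq_single i (fun k _ hk => hz k (Or.inl hk)) (by simp)]
      have h1 := (oppBasis_spec h i).2 i le_rfl
      have h2 := (oppBasis_spec h j).2 j le_rfl
      rw [if_pos rfl] at h1 h2
      subst hji
      rw [Fin.rev_rev] at h2
      rw [h1, h2, sg_rev]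
      have := sg_mul_self i
      linear_combination (sg n i) * this
    · rw [if_neg hji, Finset.sum_eq_zero fun k _ => hz k (Or.inr hji), neg_zero]

/-- The matrix of the leading `ε`-coordinates of the first members of `c`. -/
def leadingMinor (ω : LinearMap.BilinForm ℂ V) (ε c : Fin (2 * n) → V) (i : Fin (2 * n + 1)) :
    Matrix {j : Fin (2 * n) // j.castSucc < i} {j : Fin (2 * n) // j.castSucc < i} ℂ :=
  Matrix.of fun k j => ω (ε k.1.rev) (c j)

/-- Oppositeness is injectivity of the leading `ε`-coordinates on each step of the flag. In a frame
these are square matrices, so the condition becomes Zariski open. -/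
lemma oppTo_iff_det (hV : Module.finrank ℂ V = 2 * n) {ε c : Fin (2 * n) → V}
    {F : IsotropicFlag ω n} (hc : IsAdapted c F) :
    OppTo ε F ↔ ∀ i, (leadingMinor ω ε c i).det ≠ 0 := by
  have hmul : ∀ i (t : {j : Fin (2 * n) // j.castSucc < i} → ℂ) k,
      ((leadingMinor ω ε c i).mulVec t) k = ω (ε k.1.rev) (∑ j, t j • c j) := by
    intro i t k
    simp [Matrix.mulVec, dotProduct, leadingMinor, mul_comm]
  constructor
  · intro h i hdet
    obtain ⟨t, ht, ht0⟩ := Matrix.exists_mulVec_eq_zero_iff.2 hdet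
    have h1 := h i (∑ j, t j • c j) (hc.mem_space_iff.2 ⟨t, rfl⟩) fun k hk => by
      rw [← hmul i t ⟨k, hk⟩, ht0]; rfl
    apply ht
    have hli := (hc.linearIndependent hV).comp
      (fun j : {j : Fin (2 * n) // j.castSucc < i} => j.1) Subtype.val_injective
    exact funext (Fintype.linearIndependent_iff.1 hli t h1)
  · intro h i v hv hk
    obtain ⟨t, rfl⟩ := hc.mem_space_iff.1 hv
    have : t = 0 := by
      by_contra hne
      exact h i (Matrix.exists_mulVec_eq_zero_iff.1 ⟨t, hne, funext fun k => by
        rw [hmul]; exact hk k.1 k.2⟩)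
    simp [this]

end SympBases

end SympCone

namespace SympCone

/-! ### Symmetric matrix coordinates on `endSp ω`. -/

section Coordinates

variable {V : Type*} [AddCommGroup V] [Module ℂ V]

/-- The endomorphism `x ↦ ω u x • v + ω v x • u`. -/
noncomputable def symEnd (ω : LinearMap.BilinForm ℂ V) : V →ₗ[ℂ] V →ₗ[ℂ] Module.End ℂ V :=
  LinearMap.mk₂ ℂ (fun u v => (ω u).smulRight v + (ω v).smulRight u)
    (fun u u' v => by ext x; simp [add_smul]; abel)
    (fun c u v => by ext x; simp [smul_smul, mul_comm])
    (fun u v v' => by ext x; simp [add_smul]; abel)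
    (fun c u v => by ext x; simp [smul_smul, mul_comm])

variable {ω : LinearMap.BilinForm ℂ V} {n : ℕ}

lemma symEnd_apply (u v x : V) : symEnd ω u v x = ω u x • v + ω v x • u := rfl

lemma symEnd_mem (hω : ω.IsAlt) (u v : V) : symEnd ω u v ∈ endSp ω := by
  intro x y
  simp only [symEnd_apply, map_add, map_smul, LinearMap.add_apply, LinearMap.smul_apply,
    smul_eq_mul]
  rw [← hω.neg_eq x u, ← hω.neg_eq x v]
  ring

lemma endSp_pair_comm (hω : ω.IsAlt) {X : Module.End ℂ V} (hX : X ∈ endSp ω) (u v : V) :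
    ω u (X v) = ω v (X u) := by
  have h := hX u v
  rw [← hω.neg_eq v (X u)] at h
  linear_combination h

/-- The element of `endSp ω` with a given symmetric matrix of coordinates. -/
noncomputable def ofCoord (ω : LinearMap.BilinForm ℂ V) (b : Fin (2 * n) → V)
    (z : Fin (2 * n) → Fin (2 * n) → ℂ) : Module.End ℂ V :=
  ∑ i, ∑ j, (-(1 / 2) * (sg n i * sg n j) * z i j) • symEnd ω (b i) (b j)

lemma ofCoord_mem (hω : ω.IsAlt) (b : Fin (2 * n) → V) (z : Fin (2 * n) → Fin (2 * n) → ℂ) :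
    ofCoord ω b z ∈ endSp ω :=
  Submodule.sum_mem _ fun _ _ => Submodule.sum_mem _ fun _ _ =>
    Submodule.smul_mem _ _ (symEnd_mem hω _ _)

/-- The two halves of `symEnd` contribute at transposed positions, each with minus the product of
the two signs. The prefactor of `ofCoord` cancels the signs, and its one half is absorbed by the
symmetry of `z`. -/
lemma IsSympBasis.coord_ofCoord {b : Fin (2 * n) → V} (hb : IsSympBasis ω b)
    {z : Fin (2 * n) → Fin (2 * n) → ℂ} (hz : ∀ i j, z i j = z j i) (k l : Fin (2 * n)) :
    ω (b k.rev) (ofCoord ω b z (b l.rev)) = z k l := by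
  have h : ∀ i j, ω (b k.rev) (symEnd ω (b i) (b j) (b l.rev)) =
      -(if l = i then if k = j then sg n i * sg n j else 0 else 0) -
      (if k = i then if l = j then sg n i * sg n j else 0 else 0) := by
    intro i j
    simp only [symEnd_apply, map_add, map_smul, smul_eq_mul]
    rw [hb i, hb j, hb k.rev i, hb k.rev j]
    simp only [Fin.rev_rev, Fin.rev_inj, sg_rev]
    by_cases h1 : l = i <;> by_cases h2 : k = j <;> by_cases h3 : l = j <;> by_cases h4 : k = i <;>
      simp [h1, h2, h3, h4, eq_comm] <;> grind
  simp only [ofCoord, LinearMap.sum_apply, map_sum, LinearMap.smul_apply, map_smul, smul_eq_mul, h]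
  simp only [mul_sub, mul_neg, mul_ite, mul_zero, Finset.sum_sub_distrib, Finset.sum_neg_distrib,
    Finset.sum_ite_irrel, Finset.sum_ite_eq, Finset.mem_univ, if_true, Finset.sum_const_zero]
  rw [hz l k]
  have h1 := sg_mul_self k
  have h2 := sg_mul_self l
  linear_combination (z k l * sg n k ^ 2) * h2 + z k l * h1

lemma IsSympBasis.end_ext [FiniteDimensional ℂ V] {b : Fin (2 * n) → V} (hb : IsSympBasis ω b)
    (hV : Module.finrank ℂ V = 2 * n)
    {X Y : Module.End ℂ V} (h : ∀ i j : Fin (2 * n), ω (b i.rev) (X (b j.rev)) = ω (b i.rev) (Y (b j.rev))) :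
    X = Y := by
  rw [← sub_eq_zero]
  refine hb.end_eq_zero_of hV fun i j => ?_
  have := h i.rev j.rev
  rw [Fin.rev_rev, Fin.rev_rev] at this
  simp [this]

lemma IsSympBasis.ofCoord_coord [FiniteDimensional ℂ V] {b : Fin (2 * n) → V}
    (hb : IsSympBasis ω b) (hω : ω.IsAlt)
    (hV : Module.finrank ℂ V = 2 * n) {X : Module.End ℂ V} (hX : X ∈ endSp ω) :
    ofCoord ω b (fun i j => ω (b i.rev) (X (b j.rev))) = X :=
  hb.end_ext hV fun i j =>
    hb.coord_ofCoord (fun _ _ => endSp_pair_comm hω hX _ _) i j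

/-- Independent coordinates of degree less than `m`. -/
def CoordIdx (n m : ℕ) : Type :=
  {p : Fin (2 * n) × Fin (2 * n) // p.1 ≤ p.2 ∧ (p.1 : ℕ) + p.2 < m}

instance (n m : ℕ) : Fintype (CoordIdx n m) :=
  inferInstanceAs (Fintype {p : Fin (2 * n) × Fin (2 * n) // p.1 ≤ p.2 ∧ (p.1 : ℕ) + p.2 < m})

lemma card_coordIdx (n m : ℕ) :
    Fintype.card (CoordIdx n m) = ∑ i ∈ Finset.range (2 * n), (min (2 * n) (m - i) - i) := by
  have e : CoordIdx n m ≃ Σ i : Fin (2 * n), Fin (min (2 * n) (m - i) - i) :=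
    { toFun := fun p => ⟨p.1.1, ⟨p.1.2 - p.1.1, by
        have h := p.2
        have h1 : (p.1.1 : ℕ) ≤ p.1.2 := h.1
        have h2 := p.1.2.2
        omega⟩⟩
      invFun := fun q => ⟨(q.1, ⟨q.2 + q.1, by have := q.2.2; omega⟩), by
        have := q.2.2
        refine ⟨?_, ?_⟩
        · rw [Fin.le_def]; simp
        · simp only; omega⟩
      left_inv := fun p => by
        have h1 : (p.1.1 : ℕ) ≤ p.1.2 := p.2.1
        apply Subtype.ext
        refine Prod.ext rfl (Fin.ext ?_)
        simp only
        omega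
      right_inv := fun q => by
        refine Sigma.ext rfl (heq_of_eq (Fin.ext ?_))
        simp }
  rw [Fintype.card_congr e, Fintype.card_sigma, ← Fin.sum_univ_eq_sum_range
    (fun i => min (2 * n) (m - i) - i)]
  simp

lemma sum_range_sub_two_mul (n k : ℕ) :
    ∑ i ∈ Finset.range n, (2 * n + k - 1 - 2 * i) = n * (n + k) := by
  induction n generalizing k with
  | zero => simp
  | succ n ih =>
    rw [Finset.sum_range_succ]
    have : ∀ i ∈ Finset.range n, 2 * (n + 1) + k - 1 - 2 * i = 2 * n + (k + 2) - 1 - 2 * i := by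
      intro i _; omega
    rw [Finset.sum_congr rfl this, ih]
    have : 2 * (n + 1) + k - 1 - 2 * n = k + 1 := by omega
    rw [this]; ring

/-- Row `i < n` contributes `2 * n - 1 - 2 * i` positions and the other rows none: a sum of the
first `n` odd numbers. -/
lemma card_coordIdx_nil (n : ℕ) : Fintype.card (CoordIdx n (2 * n - 1)) = n ^ 2 := by
  rw [card_coordIdx]
  have h0 := sum_range_sub_two_mul n 0
  rw [two_mul n, Finset.sum_range_add, ← two_mul]
  rw [Finset.sum_eq_zero (s := Finset.range n) (f := fun x => min (2 * n) (2 * n - 1 - (n + x)) - (n + x))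
    (fun i hi => by omega)]
  rw [add_zero, pow_two]
  simp only [add_zero] at h0
  rw [← h0]
  refine Finset.sum_congr rfl fun i hi => ?_
  omega

/-- Each of the rows `i < n` loses exactly one position compared with the previous count. -/
lemma card_coordIdx_lower (n : ℕ) : Fintype.card (CoordIdx n (2 * n - 2)) = n ^ 2 - n := by
  rw [card_coordIdx]
  rw [two_mul n, Finset.sum_range_add, ← two_mul]
  rw [Finset.sum_eq_zero (s := Finset.range n) (f := fun x => min (2 * n) (2 * n - 2 - (n + x)) - (n + x))
    (fun i hi => by omega), add_zero]
  have h0 := sum_range_sub_two_mul n 0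
  have : ∑ i ∈ Finset.range n, (2 * n + 0 - 1 - 2 * i) =
      ∑ i ∈ Finset.range n, ((min (2 * n) (2 * n - 2 - i) - i) + 1) := by
    refine Finset.sum_congr rfl fun i hi => ?_
    have := Finset.mem_range.1 hi
    omega
  rw [this, Finset.sum_add_distrib] at h0
  simp only [Finset.sum_const, Finset.card_range, smul_eq_mul, mul_one, add_zero] at h0
  rw [pow_two]
  omega

lemma card_coordIdx_all (n : ℕ) : Fintype.card (CoordIdx n (4 * n)) = 2 * n ^ 2 + n := by
  rw [card_coordIdx]
  have : ∀ i ∈ Finset.range (2 * n), (min (2 * n) (4 * n - i) - i) = 2 * n - i := by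
    intro i hi
    have := Finset.mem_range.1 hi
    omega
  rw [Finset.sum_congr rfl this]
  have key : ∀ m : ℕ, 2 * ∑ i ∈ Finset.range m, (m - i) = m * (m + 1) := by
    intro m
    induction m with
    | zero => simp
    | succ m ih =>
      rw [Finset.sum_range_succ']
      simp only [Nat.add_sub_add_right, Nat.sub_zero]
      rw [mul_add, ih]; ring
  refine Nat.eq_of_mul_eq_mul_left two_pos ?_
  rw [key (2 * n)]; ring

/-- The symmetric matrix with given independent entries. -/
noncomputable def symExt {n m : ℕ} (z : CoordIdx n m → ℂ) (i j : Fin (2 * n)) : ℂ :=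
  if h : (i : ℕ) + j < m then
    z ⟨(min i j, max i j), by
      refine ⟨min_le_max, ?_⟩
      rcases le_total i j with h' | h'
      · rwa [min_eq_left h', max_eq_right h']
      · rw [min_eq_right h', max_eq_left h', add_comm]; exact h⟩
  else 0

lemma symExt_comm {n m : ℕ} (z : CoordIdx n m → ℂ) (i j : Fin (2 * n)) :
    symExt z i j = symExt z j i := by
  unfold symExt
  simp only [min_comm i j, max_comm i j, add_comm (i : ℕ) j]

lemma symExt_idx {n m : ℕ} (z : CoordIdx n m → ℂ) (p : CoordIdx n m) :
    symExt z p.1.1 p.1.2 = z p := by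
  unfold symExt
  rw [dif_pos p.2.2]
  congr 1
  apply Subtype.ext
  simp [min_eq_left p.2.1, max_eq_right p.2.1]

lemma symExt_of_le {n m : ℕ} (z : CoordIdx n m → ℂ) {i j : Fin (2 * n)} (h : m ≤ (i : ℕ) + j) :
    symExt z i j = 0 := dif_neg (by omega)

lemma symExt_restrict {n m : ℕ} {x : Fin (2 * n) → Fin (2 * n) → ℂ} (hx : ∀ i j, x i j = x j i)
    (h0 : ∀ i j : Fin (2 * n), m ≤ (i : ℕ) + j → x i j = 0) :
    symExt (fun p : CoordIdx n m => x p.1.1 p.1.2) = x := by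
  ext i j
  unfold symExt
  split_ifs with h
  · rcases le_total i j with h' | h'
    · simp [min_eq_left h', max_eq_right h']
    · simp [min_eq_right h', max_eq_left h', hx i j]
  · exact (h0 i j (by omega)).symm

/-- The elements of `endSp ω` whose coordinates of degree at least `m` vanish. -/
def coordSub (ω : LinearMap.BilinForm ℂ V) (b : Fin (2 * n) → V) (m : ℕ) :
    Submodule ℂ (Module.End ℂ V) where
  carrier := {X | X ∈ endSp ω ∧ ∀ i j : Fin (2 * n), m ≤ (i : ℕ) + j → ω (b i.rev) (X (b j.rev)) = 0}
  zero_mem' := ⟨(endSp ω).zero_mem, by simp⟩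
  add_mem' := fun hX hY => ⟨(endSp ω).add_mem hX.1 hY.1, fun i j h => by
    simp [hX.2 i j h, hY.2 i j h]⟩
  smul_mem' := fun c X hX => ⟨(endSp ω).smul_mem c hX.1, fun i j h => by simp [hX.2 i j h]⟩

/-- The independent coordinates on `coordSub`. -/
noncomputable def IsSympBasis.coordEquiv [FiniteDimensional ℂ V] {b : Fin (2 * n) → V}
    (hb : IsSympBasis ω b) (hω : ω.IsAlt) (hV : Module.finrank ℂ V = 2 * n) (m : ℕ) :
    coordSub ω b m ≃ₗ[ℂ] (CoordIdx n m → ℂ) where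
  toFun X p := ω (b p.1.1.rev) (X.1 (b p.1.2.rev))
  map_add' X Y := by ext; simp
  map_smul' c X := by ext; simp
  invFun z := ⟨ofCoord ω b (symExt z), ofCoord_mem hω _ _, fun i j h => by
    rw [hb.coord_ofCoord (symExt_comm z), symExt_of_le z h]⟩
  left_inv X := by
    apply Subtype.ext
    simp only
    rw [symExt_restrict (x := fun i j => ω (b i.rev) (X.1 (b j.rev)))
      (fun _ _ => endSp_pair_comm hω X.2.1 _ _) X.2.2]
    exact hb.ofCoord_coord hω hV X.2.1
  right_inv z := by
    ext p
    simp only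
    rw [hb.coord_ofCoord (symExt_comm z), symExt_idx]

lemma IsSympBasis.finrank_coordSub [FiniteDimensional ℂ V] {b : Fin (2 * n) → V}
    (hb : IsSympBasis ω b) (hω : ω.IsAlt) (hV : Module.finrank ℂ V = 2 * n) (m : ℕ) :
    Module.finrank ℂ (coordSub ω b m) = Fintype.card (CoordIdx n m) := by
  rw [(hb.coordEquiv hω hV m).finrank_eq, Module.finrank_fintype_fun_eq_card]

lemma coordSub_all (b : Fin (2 * n) → V) : coordSub ω b (4 * n) = endSp ω := by
  ext X
  exact ⟨fun h => h.1, fun h => ⟨h, fun i j hij => by omega⟩⟩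

lemma exists_isSympBasis' [FiniteDimensional ℂ V] (hω : ω.IsAlt) (hnd : ω.Nondegenerate)
    (hV : Module.finrank ℂ V = 2 * n) : ∃ b : Fin (2 * n) → V, IsSympBasis ω b := by
  obtain ⟨F, -, -⟩ := exists_shifts hω hnd hV (A := 0) (U := ⊥)
    ⟨(endSp ω).zero_mem, by
      rcases Nat.eq_zero_or_pos n with rfl | h
      · have : Subsingleton V := Module.finrank_zero_iff.1 hV
        exact LinearMap.ext fun x => Subsingleton.elim _ _
      · exact zero_pow (by omega)⟩ bot_le bot_le
  obtain ⟨b, hb, -⟩ := exists_adapted_isSympBasis hω hnd hV F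
  exact ⟨b, hb⟩

lemma finrank_endSp [FiniteDimensional ℂ V] (hω : ω.IsAlt) (hnd : ω.Nondegenerate)
    (hV : Module.finrank ℂ V = 2 * n) : Module.finrank ℂ (endSp ω) = 2 * n ^ 2 + n := by
  obtain ⟨b, hb⟩ := exists_isSympBasis' hω hnd hV
  rw [← coordSub_all b, hb.finrank_coordSub hω hV, card_coordIdx_all]

/-- The functionals that vanish on all squares `symEnd ω u u` vanish on `endSp ω`. -/
lemma endSp_induction [FiniteDimensional ℂ V] (hω : ω.IsAlt) (hnd : ω.Nondegenerate)
    (hV : Module.finrank ℂ V = 2 * n) {P : Submodule ℂ (Module.End ℂ V)}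
    (h : ∀ u, symEnd ω u u ∈ P) : endSp ω ≤ P := by
  obtain ⟨b, hb⟩ := exists_isSympBasis' hω hnd hV
  intro X hX
  rw [← hb.ofCoord_coord hω hV hX]
  refine Submodule.sum_mem _ fun i _ => Submodule.sum_mem _ fun j _ => Submodule.smul_mem _ _ ?_
  -- Polarization.
  have h1 : symEnd ω (b i) (b j) = (1 / 2 : ℂ) •
      (symEnd ω (b i + b j) (b i + b j) - symEnd ω (b i) (b i) - symEnd ω (b j) (b j)) := by
    have h2 : symEnd ω (b j) (b i) = symEnd ω (b i) (b j) := by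
      ext x; simp only [symEnd_apply]; abel
    simp only [map_add, LinearMap.add_apply, h2]
    module
  rw [h1]
  exact P.smul_mem _ (P.sub_mem (P.sub_mem (h _) (h _)) (h _))

end Coordinates

end SympCone

namespace SympCone

/-! ### Kernels of powers of a nilpotent endomorphism. -/

section Nilpotent

variable {V : Type*} [AddCommGroup V] [Module ℂ V] [FiniteDimensional ℂ V]

/-- Kernels of powers stop growing at the first equality, which by `hA'` cannot happen before
exponent `d`. Strict growth from 0 bounds the dimension below, and strict descent from `d` bounds it
above. -/
lemma finrank_ker_pow {d : ℕ} (hV : Module.finrank ℂ V = d) {A : Module.End ℂ V} (hA : A ^ d = 0)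
    (hA' : A ^ (d - 1) ≠ 0) {k : ℕ} (hk : k ≤ d) :
    Module.finrank ℂ (LinearMap.ker (A ^ k)) = k := by
  have hle : ∀ k, LinearMap.ker (A ^ k) ≤ LinearMap.ker (A ^ (k + 1)) := fun k x hx => by
    rw [LinearMap.mem_ker] at hx ⊢
    rw [pow_succ', Module.End.mul_apply, hx, map_zero]
  have hlt : ∀ k < d, Module.finrank ℂ (LinearMap.ker (A ^ k)) <
      Module.finrank ℂ (LinearMap.ker (A ^ (k + 1))) := by
    intro k hk
    refine Submodule.finrank_lt_finrank_of_lt (lt_of_le_of_ne (hle k) fun h => hA' ?_)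
    have := Module.End.ker_pow_constant h (d - k)
    rw [Nat.add_sub_cancel' hk.le, hA, LinearMap.ker_zero, LinearMap.ker_eq_top] at this
    rw [show d - 1 = (d - 1 - k) + k by omega, pow_add, this, mul_zero]
  have h1 : ∀ k ≤ d, k ≤ Module.finrank ℂ (LinearMap.ker (A ^ k)) := by
    intro k
    induction k with
    | zero => intro _; exact Nat.zero_le _
    | succ k ih => intro hk; exact lt_of_le_of_lt (ih (by omega)) (hlt k (by omega))
  have h2 : ∀ j ≤ d, Module.finrank ℂ (LinearMap.ker (A ^ (d - j))) + j ≤ d := by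
    intro j
    induction j with
    | zero => intro _; rw [← hV]; exact Submodule.finrank_le _
    | succ j ih =>
      intro hj
      have := hlt (d - (j + 1)) (by omega)
      rw [show d - (j + 1) + 1 = d - j by omega] at this
      have := ih (by omega)
      omega
  have h3 := h2 (d - k) (by omega)
  rw [show d - (d - k) = k by omega] at h3
  have := h1 k hk
  omega

/-- `A` maps the kernel of the next power into the kernel of the present one, and the kernel of this
restriction embeds in that of `A`. -/
lemma finrank_ker_pow_le (A : Module.End ℂ V) (k : ℕ) :
    Module.finrank ℂ (LinearMap.ker (A ^ k)) ≤ k * Module.finrank ℂ (LinearMap.ker A) := by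
  induction k with
  | zero =>
    rw [pow_zero, zero_mul, Nat.le_zero, Submodule.finrank_eq_zero]
    exact LinearMap.ker_id
  | succ k ih =>
    have h := LinearMap.finrank_range_add_finrank_ker (A.domRestrict (LinearMap.ker (A ^ (k + 1))))
    have h1 : Module.finrank ℂ (LinearMap.range (A.domRestrict (LinearMap.ker (A ^ (k + 1))))) ≤
        Module.finrank ℂ (LinearMap.ker (A ^ k)) := by
      refine Submodule.finrank_mono ?_
      rintro _ ⟨⟨x, hx⟩, rfl⟩
      rw [LinearMap.mem_ker, pow_succ, Module.End.mul_apply] at hx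
      exact hx
    have h2 : Module.finrank ℂ (LinearMap.ker (A.domRestrict (LinearMap.ker (A ^ (k + 1))))) ≤
        Module.finrank ℂ (LinearMap.ker A) := by
      rw [← Submodule.finrank_map_subtype_eq]
      refine Submodule.finrank_mono ?_
      rintro _ ⟨⟨x, hx⟩, hx', rfl⟩
      exact hx'
    rw [add_mul, one_mul]
    omega

lemma finrank_range_eq_iff {d : ℕ} (hd : 1 ≤ d) (hV : Module.finrank ℂ V = d)
    {A : Module.End ℂ V} (hA : A ^ d = 0) :
    Module.finrank ℂ (LinearMap.range A) = d - 1 ↔ A ^ (d - 1) ≠ 0 := by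
  have h := LinearMap.finrank_range_add_finrank_ker A
  constructor
  · intro hr h0
    have h1 := finrank_ker_pow_le A (d - 1)
    rw [h0, LinearMap.ker_zero, finrank_top, hV, show Module.finrank ℂ (LinearMap.ker A) = 1 by omega]
      at h1
    omega
  · intro h0
    have := finrank_ker_pow hV hA h0 hd
    rw [pow_one] at this
    omega

end Nilpotent

/-! ### Regular nilpotents and the flags that they shift. -/

section Regular

variable {V : Type*} [AddCommGroup V] [Module ℂ V] [FiniteDimensional ℂ V]
  {ω : LinearMap.BilinForm ℂ V} {n : ℕ}

/-- The kernels of the powers of a regular nilpotent element form an isotropic flag. -/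
lemma exists_kerFlag (hnd : ω.Nondegenerate)
    (hV : Module.finrank ℂ V = 2 * n) {A : Module.End ℂ V} (hA : A ∈ nilCone ω n)
    (hA' : A ^ (2 * n - 1) ≠ 0) :
    ∃ F : IsotropicFlag ω n, ∀ i, F.space i = LinearMap.ker (A ^ (i : ℕ)) := by
  have hdim : ∀ i : Fin (2 * n + 1), Module.finrank ℂ (LinearMap.ker (A ^ (i : ℕ))) = i :=
    fun i => finrank_ker_pow hV hA.2 hA' (by omega)
  -- The kernel of the complementary power is a range, and the range of a power is orthogonal to its
  -- kernel because `A` is skew.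
  have hrange : ∀ i : Fin (2 * n + 1), LinearMap.ker (A ^ (i.rev : ℕ)) =
      LinearMap.range (A ^ (i : ℕ)) := by
    intro i
    symm
    apply Submodule.eq_of_le_of_finrank_eq
    · rintro _ ⟨x, rfl⟩
      have := hA.2
      rw [LinearMap.mem_ker, ← Module.End.mul_apply, ← pow_add, Fin.val_rev,
        show 2 * n + 1 - (↑i + 1) + ↑i = 2 * n by omega, hA.2, LinearMap.zero_apply]
    · have := LinearMap.finrank_range_add_finrank_ker (A ^ (i : ℕ))
      rw [hdim i] at this
      rw [hdim, Fin.val_rev]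
      omega
  refine ⟨⟨fun i => LinearMap.ker (A ^ (i : ℕ)), ?_, hdim, ?_⟩, fun i => rfl⟩
  · intro i j hij x hx
    have hij' : (i : ℕ) ≤ j := hij
    rw [LinearMap.mem_ker] at hx ⊢
    rw [← Nat.sub_add_cancel hij', pow_add, Module.End.mul_apply, hx, map_zero]
  · intro i
    apply Submodule.eq_of_le_of_finrank_eq
    · rw [hrange]
      rintro _ ⟨x, rfl⟩ y hy
      have h1 := endSp_pow_apply hA.1 i y x
      rw [LinearMap.mem_ker] at hy
      rw [hy, map_zero, LinearMap.zero_apply] at h1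
      exact (mul_eq_zero.1 h1.symm).resolve_left (pow_ne_zero _ (by norm_num))
    · rw [LinearMap.BilinForm.finrank_orthogonal hnd, hV, hdim, hdim, Fin.val_rev]
      omega

omit [FiniteDimensional ℂ V] in
lemma shifts_of_ker {A : Module.End ℂ V} {F : IsotropicFlag ω n}
    (h : ∀ i, F.space i = LinearMap.ker (A ^ (i : ℕ))) : Shifts A F := by
  rintro j _ ⟨x, hx, rfl⟩
  rw [h] at hx ⊢
  rw [Fin.val_succ, pow_succ] at hx
  exact hx

lemma Shifts.space_le {A : Module.End ℂ V} {F : IsotropicFlag ω n} (h : Shifts A F)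
    (i : Fin (2 * n + 1)) : F.space i ≤ LinearMap.ker (A ^ (i : ℕ)) := by
  induction i using Fin.induction with
  | zero => rw [F.space_zero]; exact bot_le
  | succ i ih =>
    intro x hx
    have := ih (h i ⟨x, hx, rfl⟩)
    rw [Fin.val_succ, pow_succ]
    exact this

lemma Shifts.pow_eq_zero (hV : Module.finrank ℂ V = 2 * n) {A : Module.End ℂ V}
    {F : IsotropicFlag ω n} (h : Shifts A F) : A ^ (2 * n) = 0 := by
  have := h.space_le (Fin.last _)
  rw [F.space_last hV, top_le_iff, LinearMap.ker_eq_top] at this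
  simpa using this

lemma Shifts.space_eq (hV : Module.finrank ℂ V = 2 * n) {A : Module.End ℂ V}
    {F : IsotropicFlag ω n} (h : Shifts A F) (hA' : A ^ (2 * n - 1) ≠ 0) (i : Fin (2 * n + 1)) :
    F.space i = LinearMap.ker (A ^ (i : ℕ)) :=
  Submodule.eq_of_le_of_finrank_eq (h.space_le i) (by
    rw [F.finrank_space, finrank_ker_pow hV (h.pow_eq_zero hV) hA' (by omega)])

lemma isAdapted_pow {A : Module.End ℂ V} (hA : A ^ (2 * n) = 0) {F : IsotropicFlag ω n}
    (h : ∀ i, F.space i = LinearMap.ker (A ^ (i : ℕ))) {v : V} (hv : (A ^ (2 * n - 1)) v ≠ 0) :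
    IsAdapted (fun i : Fin (2 * n) => (A ^ (2 * n - 1 - i : ℕ)) v) F := by
  refine isAdapted_of_mem (fun i => ?_) fun i => ?_
  · rw [h, LinearMap.mem_ker, ← Module.End.mul_apply, ← pow_add, Fin.val_succ,
      show (i : ℕ) + 1 + (2 * n - 1 - i) = 2 * n by omega, hA, LinearMap.zero_apply]
  · rw [h, LinearMap.mem_ker, ← Module.End.mul_apply, ← pow_add, Fin.val_castSucc,
      show (i : ℕ) + (2 * n - 1 - i) = 2 * n - 1 by omega]
    exact hv

lemma IsSympBasis.mem_space_iff {b : Fin (2 * n) → V} (hb : IsSympBasis ω b)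
    (hV : Module.finrank ℂ V = 2 * n) {F : IsotropicFlag ω n} (hF : IsAdapted b F)
    {i : Fin (2 * n + 1)} {v : V} :
    v ∈ F.space i ↔ ∀ j : Fin (2 * n), i ≤ j.castSucc → ω (b j.rev) v = 0 := by
  rw [hF i, hb.mem_span_iff hV]

/-- With both indices reversed, the image of `b j.rev` lies in the step below exactly when its
coordinates from that index on vanish. The entries with `i + j = 2 * n - 2` measure the passage to
the next lower basis vector. -/
lemma IsSympBasis.shifts_iff {b : Fin (2 * n) → V} (hb : IsSympBasis ω b)
    (hV : Module.finrank ℂ V = 2 * n) {F : IsotropicFlag ω n} (hF : IsAdapted b F)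
    {A : Module.End ℂ V} : Shifts A F ↔
      ∀ i j : Fin (2 * n), 2 * n - 1 ≤ (i : ℕ) + j → ω (b i.rev) (A (b j.rev)) = 0 := by
  constructor
  · intro h i j hij
    have h1 : A (b j.rev) ∈ F.space j.rev.castSucc := h _ ⟨_, hF.mem Fin.castSucc_lt_succ, rfl⟩
    refine (hb.mem_space_iff hV hF).1 h1 i ?_
    rw [Fin.le_def, Fin.val_castSucc, Fin.val_castSucc, Fin.val_rev]
    omega
  · intro h k
    rw [Submodule.map_le_iff_le_comap, hF k.succ, Submodule.span_le]
    rintro _ ⟨j, hj, rfl⟩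
    refine (hb.mem_space_iff hV hF).2 fun i hi => ?_
    have := h i j.rev (by
      have hj' : j.castSucc < k.succ := hj
      rw [Fin.lt_def, Fin.val_castSucc, Fin.val_succ] at hj'
      rw [Fin.le_def, Fin.val_castSucc, Fin.val_castSucc] at hi
      rw [Fin.val_rev]
      omega)
    rwa [Fin.rev_rev] at this

/-- An element that shifts a flag is regular when its coordinates next to the diagonal do not
vanish. -/
lemma IsSympBasis.regular_iff {b : Fin (2 * n) → V} (hb : IsSympBasis ω b)
    (hV : Module.finrank ℂ V = 2 * n) (hn : 1 ≤ n) {F : IsotropicFlag ω n} (hF : IsAdapted b F)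
    {A : Module.End ℂ V} (hA : Shifts A F) : A ^ (2 * n - 1) ≠ 0 ↔
      ∀ i j : Fin (2 * n), (i : ℕ) + j = 2 * n - 2 → ω (b i.rev) (A (b j.rev)) ≠ 0 := by
  constructor
  · intro hA' i j hij h0
    have hj : j.rev.castSucc = i.succ := Fin.ext (by
      rw [Fin.val_castSucc, Fin.val_succ, Fin.val_rev]; omega)
    have h1 : A (b j.rev) ∈ F.space j.rev.castSucc := hA _ ⟨_, hF.mem Fin.castSucc_lt_succ, rfl⟩
    -- A vanishing entry lowers `b j.rev` by two steps, which puts it in the kernel of too small a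
    -- power.
    have h2 : A (b j.rev) ∈ F.space i.castSucc := by
      rw [hj] at h1
      refine (hb.mem_space_iff hV hF).2 fun k hk => ?_
      rcases eq_or_lt_of_le hk with h | h
      · obtain rfl : i = k := Fin.castSucc_injective _ h
        exact h0
      · refine (hb.mem_space_iff hV hF).1 h1 k ?_
        rw [Fin.lt_def] at h
        rw [Fin.le_def, Fin.val_succ]
        exact h
    refine hF.not_mem hV (i := j.rev.castSucc) (j := j.rev) le_rfl ?_
    rw [hA.space_eq hV hA'] at h2 ⊢
    rw [hj, Fin.val_succ, pow_succ]
    exact h2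
  · intro h
    refine (finrank_range_eq_iff (by omega) hV (hA.pow_eq_zero hV)).1 ?_
    -- Let `k` be the highest index in a kernel vector. If `k > 0`, the coordinate of its image at
    -- `k - 1` is a nonzero multiple of the entry there, a contradiction.
    have hle : LinearMap.ker A ≤ F.space ⟨1, by omega⟩ := by
      intro x hx
      by_contra hxF
      have hne : (Finset.univ.filter fun k : Fin (2 * n) => ω (b k.rev) x ≠ 0).Nonempty := by
        by_contra hemp
        refine hxF ((hb.mem_space_iff hV hF).2 fun j _ => ?_)
        by_contra hj
        exact hemp ⟨j, by simpa using hj⟩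
      obtain ⟨k, hk, hmax⟩ := Finset.exists_max_image _ id hne
      simp only [Finset.mem_filter, Finset.mem_univ, true_and, id] at hk hmax
      have hk0 : 0 < (k : ℕ) := by
        by_contra hk0
        refine hxF ((hb.mem_space_iff hV hF).2 fun j hj => ?_)
        by_contra hj'
        have h1 : (j : ℕ) ≤ k := hmax j hj'
        have h2 : 1 ≤ (j : ℕ) := hj
        omega
      let l : Fin (2 * n) := ⟨k - 1, by omega⟩
      have hl : l.succ = k.castSucc := Fin.ext (by simp [l]; omega)
      set t := sg n k.rev * ω (b k.rev) x with ht
      have hy : x - t • b k ∈ F.space k.castSucc := by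
        refine (hb.mem_space_iff hV hF).2 fun j hj => ?_
        rw [map_sub, map_smul, hb]
        by_cases hjk : j = k
        · subst hjk
          rw [Fin.rev_rev, if_pos rfl, smul_eq_mul, ht]
          linear_combination -ω (b j.rev) x * sg_mul_self j.rev
        · rw [if_neg (by rw [Fin.rev_rev]; exact fun h => hjk h.symm)]
          have : ω (b j.rev) x = 0 := by
            by_contra hj'
            exact hjk (le_antisymm (hmax j hj') hj)
          simp [this]
      have h2 : ω (b l.rev) (A (x - t • b k)) = 0 := by
        refine (hb.mem_space_iff hV hF (i := l.castSucc)).1 ?_ l le_rfl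
        exact hA l ⟨_, hl ▸ hy, rfl⟩
      rw [map_sub, map_smul, LinearMap.mem_ker.1 hx, zero_sub, map_neg, map_smul, neg_eq_zero,
        smul_eq_mul] at h2
      have h3 := h l k.rev (by rw [Fin.val_rev]; simp only [l]; omega)
      rw [Fin.rev_rev] at h3
      exact mul_ne_zero (mul_ne_zero (sg_ne_zero _) hk) h3 h2
    have h1 := Submodule.finrank_mono hle
    rw [F.finrank_space] at h1
    have h2 := LinearMap.finrank_range_add_finrank_ker A
    have h3 : Module.finrank ℂ (LinearMap.range A) ≠ 2 * n := by
      intro h3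
      have htop : LinearMap.range A = ⊤ := Submodule.eq_top_of_finrank_eq (h3.trans hV.symm)
      have hinj : Function.Injective A := by
        rw [LinearMap.injective_iff_surjective]; exact LinearMap.range_eq_top.1 htop
      have h4 : Function.Injective (A ^ (2 * n)) := by
        rw [Module.End.coe_pow]; exact hinj.iterate _
      rw [hA.pow_eq_zero hV] at h4
      have : Subsingleton V := ⟨fun x y => h4 rfl⟩
      rw [Module.finrank_zero_of_subsingleton] at hV
      omega
    simp only at h1
    omega

end Regular

/-! ### The trace form and the trace criterion for nilpotency. -/

section Traces

variable {V : Type*} [AddCommGroup V] [Module ℂ V] [FiniteDimensional ℂ V]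
  {ω : LinearMap.BilinForm ℂ V} {n : ℕ}

/-- The product is twice a rank one map. Pairing with squares thus recovers the quadratic form `ω u
(B u)`, which determines an element of `endSp ω`. -/
lemma trace_mul_symEnd (B : Module.End ℂ V) (u : V) :
    LinearMap.trace ℂ V (B * symEnd ω u u) = 2 * ω u (B u) := by
  have : B * symEnd ω u u = (2 : ℂ) • (ω u).smulRight (B u) := by
    ext x
    simp only [Module.End.mul_apply, symEnd_apply, map_add, map_smul, LinearMap.smul_apply,
      LinearMap.smulRight_apply]
    module
  rw [this, map_smul, LinearMap.trace_smulRight, smul_eq_mul]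

lemma trace_eq_zero_of_mem (hω : ω.IsAlt) (hnd : ω.Nondegenerate)
    (hV : Module.finrank ℂ V = 2 * n) {X : Module.End ℂ V} (hX : X ∈ endSp ω) :
    LinearMap.trace ℂ V X = 0 := by
  refine endSp_induction hω hnd hV (P := LinearMap.ker (LinearMap.trace ℂ V)) (fun u => ?_) hX
  have := trace_mul_symEnd (ω := ω) 1 u
  rw [one_mul] at this
  rw [LinearMap.mem_ker, this, Module.End.one_apply, hω u, mul_zero]

omit [FiniteDimensional ℂ V] in
lemma endSp_pow_odd {A : Module.End ℂ V} (hA : A ∈ endSp ω) {k : ℕ} (hk : Odd k) :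
    A ^ k ∈ endSp ω := fun u v => by rw [endSp_pow_apply hA, hk.neg_one_pow]; ring

/-- The trace form is nondegenerate on `endSp ω`. -/
lemma eq_zero_of_trace_mul (hω : ω.IsAlt) (hnd : ω.Nondegenerate) {B : Module.End ℂ V}
    (hB : B ∈ endSp ω)
    (h : ∀ X ∈ endSp ω, LinearMap.trace ℂ V (B * X) = 0) : B = 0 := by
  have h1 : ∀ u, ω u (B u) = 0 := fun u => by
    have := h _ (symEnd_mem hω u u)
    rw [trace_mul_symEnd] at this
    simpa using this
  ext v
  refine hnd.2 _ fun u => ?_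
  have h2 := h1 (u + v)
  simp only [map_add, LinearMap.add_apply, h1, zero_add, add_zero] at h2
  rw [endSp_pair_comm hω hB v u] at h2
  linear_combination h2 / 2

/-- An endomorphism all of whose powers have trace zero is nilpotent. -/
lemma pow_finrank_eq_zero_of_trace {A : Module.End ℂ V}
    (h : ∀ k, 1 ≤ k → k ≤ Module.finrank ℂ V → LinearMap.trace ℂ V (A ^ k) = 0) :
    A ^ Module.finrank ℂ V = 0 := by
  set d := Module.finrank ℂ V with hd
  have hdeg : A.charpoly.natDegree = d := LinearMap.charpoly_natDegree A
  have hmonic := LinearMap.charpoly_monic A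
  -- Cayley-Hamilton expresses the higher powers through lower positive ones.
  have hall : ∀ k, 1 ≤ k → LinearMap.trace ℂ V (A ^ k) = 0 := by
    intro k
    induction k using Nat.strong_induction_on with
    | _ k ih =>
      intro hk
      rcases Nat.lt_or_ge d k with hlt | hge
      · have h1 := LinearMap.aeval_self_charpoly A
        rw [Polynomial.aeval_eq_sum_range, hdeg, Finset.sum_range_succ, ← hdeg,
          hmonic.coeff_natDegree, one_smul, hdeg] at h1
        have h2 : A ^ k = - ∑ i ∈ Finset.range d, A.charpoly.coeff i • A ^ (k - d + i) := by
          have h3 := congrArg (fun B => A ^ (k - d) * B) h1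
          simp only [mul_add, mul_zero, Finset.mul_sum, ← pow_add, mul_smul_comm] at h3
          rw [Nat.sub_add_cancel hlt.le] at h3
          rw [eq_neg_iff_add_eq_zero, add_comm]
          exact h3
        rw [h2, map_neg, map_sum, neg_eq_zero]
        refine Finset.sum_eq_zero fun i hi => ?_
        have := Finset.mem_range.1 hi
        rw [map_smul, ih _ (by omega) (by omega), smul_zero]
      · exact h k hk hge
  have hpoly : ∀ q : Polynomial ℂ,
      LinearMap.trace ℂ V (Polynomial.aeval A (q * Polynomial.X)) = 0 := by
    intro q
    induction q using Polynomial.induction_on' with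
    | add p q hp hq => rw [add_mul, map_add, map_add, hp, hq, add_zero]
    | monomial k a =>
      rw [Polynomial.monomial_mul_X, Polynomial.aeval_monomial, ← Algebra.smul_def, map_smul,
        hall _ (by omega), smul_zero]
  obtain ⟨g, hg, hgX⟩ := Polynomial.exists_eq_pow_rootMultiplicity_mul_and_not_dvd A.charpoly
    hmonic.ne_zero 0
  set m := A.charpoly.rootMultiplicity 0
  rw [Polynomial.C_0, sub_zero] at hg hgX
  have hcop : IsCoprime (Polynomial.X ^ (m + 1) : Polynomial ℂ) g :=
    ((Polynomial.irreducible_X.coprime_iff_not_dvd).2 hgX).pow_left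
  obtain ⟨u, w, huw⟩ := hcop
  have hCH : Polynomial.aeval A (Polynomial.X ^ m * g) = 0 := by
    rw [← hg]; exact LinearMap.aeval_self_charpoly A
  -- `e` is the projection onto the part where `A` is invertible. It is a polynomial in `A` without
  -- constant term, so its trace, which is its rank, is zero.
  set e := Polynomial.aeval A (u * Polynomial.X ^ (m + 1)) with he
  have hidem : IsIdempotentElem e := by
    show e * e = e
    have h1 : e * (1 - e) = 0 := by
      have : 1 - e = Polynomial.aeval A (w * g) := by
        rw [he, ← map_one (Polynomial.aeval (R := ℂ) A), ← map_sub, ← huw]; congr 1; ring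
      rw [this, he, ← map_mul,
        show u * Polynomial.X ^ (m + 1) * (w * g) = (u * Polynomial.X * w) * (Polynomial.X ^ m * g) by
          ring, map_mul, hCH, mul_zero]
    rw [mul_sub, mul_one, sub_eq_zero] at h1
    exact h1.symm
  have hzero : e = 0 := by
    rw [← LinearMap.IsIdempotentElem.trace_eq_zero_iff hidem, he, pow_succ, ← mul_assoc]
    exact hpoly _
  have h1 : Polynomial.aeval A (w * g) = 1 := by
    have := congrArg (Polynomial.aeval A) huw
    rw [map_add, ← he, hzero, zero_add, map_one] at this
    exact this
  have h2 : A ^ m = 0 := by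
    have : A ^ m = Polynomial.aeval A (Polynomial.X ^ m * (w * g)) := by
      rw [map_mul, h1, mul_one, map_pow, Polynomial.aeval_X]
    rw [this, show Polynomial.X ^ m * (w * g) = w * (Polynomial.X ^ m * g) by ring, map_mul, hCH,
      mul_zero]
  have hm : m ≤ d := by
    rw [← hdeg]
    have := Polynomial.natDegree_le_of_dvd (Polynomial.pow_rootMultiplicity_dvd A.charpoly 0)
      hmonic.ne_zero
    simpa using this
  rw [← Nat.sub_add_cancel hm, pow_add, h2, mul_zero]

/-- Odd powers stay in `endSp ω` and are traceless there, so only even exponents impose conditions.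
-/
lemma mem_nilCone_iff_trace (hω : ω.IsAlt) (hnd : ω.Nondegenerate)
    (hV : Module.finrank ℂ V = 2 * n) {A : Module.End ℂ V} (hA : A ∈ endSp ω) :
    A ∈ nilCone ω n ↔ ∀ r : ℕ, 1 ≤ r → r ≤ n → LinearMap.trace ℂ V (A ^ (2 * r)) = 0 := by
  constructor
  · intro h r hr _
    refine (LinearMap.isNilpotent_trace_of_isNilpotent ?_).eq_zero
    have : IsNilpotent A := ⟨2 * n, h.2⟩
    exact this.pow_of_pos (by omega)
  · intro h
    refine ⟨hA, ?_⟩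
    rw [← hV]
    refine pow_finrank_eq_zero_of_trace fun k hk hk' => ?_
    rcases Nat.even_or_odd k with ⟨r, rfl⟩ | hodd
    · rw [← two_mul]
      exact h r (by omega) (by omega)
    · exact trace_eq_zero_of_mem hω hnd hV (endSp_pow_odd hA hodd)

end Traces

/-! ### The centralizer of a regular nilpotent. -/

section Centralizer

variable {V : Type*} [AddCommGroup V] [Module ℂ V] [FiniteDimensional ℂ V]
  {ω : LinearMap.BilinForm ℂ V} {n : ℕ}

omit [FiniteDimensional ℂ V] in
lemma commutator_mem {X b : Module.End ℂ V} (hX : X ∈ endSp ω) (hb : b ∈ endSp ω) :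
    X * b - b * X ∈ endSp ω := fun u v => by
  simp only [LinearMap.sub_apply, Module.End.mul_apply, map_sub]
  rw [hX (b u) v, hb u (X v), hb (X u) v, hX u (b v)]
  ring

/-- The commutator with `b` on `endSp ω`. -/
noncomputable def adEnd {b : Module.End ℂ V} (hb : b ∈ endSp ω) : endSp ω →ₗ[ℂ] endSp ω :=
  ((LinearMap.mulRight ℂ b - LinearMap.mulLeft ℂ b) ∘ₗ (endSp ω).subtype).codRestrict _
    fun X => commutator_mem X.2 hb

omit [FiniteDimensional ℂ V] in
lemma adEnd_apply {b : Module.End ℂ V} (hb : b ∈ endSp ω) (X : endSp ω) :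
    (adEnd hb X : Module.End ℂ V) = X.1 * b - b * X.1 := rfl

omit [FiniteDimensional ℂ V] in
lemma finrank_ker_le_of_forall [FiniteDimensional ℂ V] {V' : Type*} [AddCommGroup V'] [Module ℂ V']
    (f : V →ₗ[ℂ] V') (L : V →ₗ[ℂ] (Fin n → ℂ)) (h : ∀ x, f x = 0 → L x = 0 → x = 0) :
    Module.finrank ℂ (LinearMap.ker f) ≤ n := by
  have hinj : Function.Injective (L.domRestrict (LinearMap.ker f)) := by
    rw [← LinearMap.ker_eq_bot, LinearMap.ker_eq_bot']
    rintro ⟨x, hx⟩ hx'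
    exact Subtype.ext (h x hx hx')
  simpa using LinearMap.finrank_le_finrank_of_injective hinj

/-- For a cyclic vector `v`, an element `B` commuting with `b` is determined by the numbers `ω v (B
(b ^ k v))`. Those with `k` odd vanish by skewness and those with `k ≥ 2 * n` by nilpotency, which
leaves `n` even exponents. -/
lemma finrank_ker_adEnd_le (hω : ω.IsAlt) (hnd : ω.Nondegenerate)
    (hV : Module.finrank ℂ V = 2 * n) {b : Module.End ℂ V} (hb : b ∈ endSp ω) (hbn : b ^ (2 * n) = 0)
    (hb' : b ^ (2 * n - 1) ≠ 0) :
    Module.finrank ℂ (LinearMap.ker (adEnd hb)) ≤ n := by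
  obtain ⟨v, hv⟩ : ∃ v, (b ^ (2 * n - 1)) v ≠ 0 := by
    by_contra! h
    exact hb' (LinearMap.ext h)
  obtain ⟨F, hF⟩ := exists_kerFlag hnd hV ⟨hb, hbn⟩ hb'
  have hspan := (isAdapted_pow hbn hF hv).span_eq_top hV
  let L : endSp ω →ₗ[ℂ] (Fin n → ℂ) :=
    LinearMap.pi fun j => (ω v) ∘ₗ (LinearMap.applyₗ ((b ^ (2 * (j : ℕ))) v)) ∘ₗ
      (endSp ω).subtype
  have hL : ∀ B j, L B j = ω v (B.1 ((b ^ (2 * (j : ℕ))) v)) := fun B j => rfl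
  have hinj : ∀ B, adEnd hb B = 0 → L B = 0 → B = 0 := by
    rintro ⟨B, hB⟩ hB' h0
    have hcomm : Commute B b := by
      have := congrArg Subtype.val hB'
      rw [adEnd_apply, Submodule.coe_zero, sub_eq_zero] at this
      exact this
    have h1 : ∀ k, ω v (B ((b ^ k) v)) = 0 := by
      intro k
      rcases Nat.even_or_odd k with ⟨r, rfl⟩ | hodd
      · rw [← two_mul]
        rcases Nat.lt_or_ge r n with hr | hr
        · have := congrFun h0 ⟨r, hr⟩
          rw [hL] at this
          exact this
        · rw [show 2 * r = 2 * n + (2 * r - 2 * n) by omega, pow_add, hbn, zero_mul]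
          simp
      · have h2 : ω v (B ((b ^ k) v)) = ω ((b ^ k) v) (B v) := endSp_pair_comm hω hB _ _
        rw [endSp_pow_apply hb, hodd.neg_one_pow, ← Module.End.mul_apply (b ^ k),
          ← (hcomm.pow_right k).eq, Module.End.mul_apply] at h2
        linear_combination h2 / 2
    have h3 : ∀ k l, ω ((b ^ l) v) (B ((b ^ k) v)) = 0 := by
      intro k l
      rw [endSp_pow_apply hb, ← Module.End.mul_apply, ← Module.End.mul_apply,
        ← (hcomm.pow_right l).eq, mul_assoc, ← pow_add, Module.End.mul_apply, h1, mul_zero]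
    have h4 : B = 0 := by
      apply LinearMap.ext_on_range hspan
      intro i
      refine hnd.2 _ fun u => ?_
      have : Submodule.span ℂ (Set.range fun i : Fin (2 * n) => (b ^ (2 * n - 1 - i : ℕ)) v) ≤
          LinearMap.ker (ω.flip (B ((b ^ (2 * n - 1 - i : ℕ)) v))) := by
        rw [Submodule.span_le]
        rintro _ ⟨j, rfl⟩
        exact h3 _ _
      rw [hspan] at this
      exact this trivial
    subst h4
    rfl
  exact finrank_ker_le_of_forall _ L hinj

/-- At most `n` independent functionals on `endSp ω` kill all commutators with a regular element. -/
lemma card_le_of_linearIndependent (hω : ω.IsAlt) (hnd : ω.Nondegenerate)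
    (hV : Module.finrank ℂ V = 2 * n) {b : Module.End ℂ V} (hb : b ∈ endSp ω) (hbn : b ^ (2 * n) = 0)
    (hb' : b ^ (2 * n - 1) ≠ 0) {m : ℕ} {L : Fin m → Module.Dual ℂ (Module.End ℂ V)}
    (hL : LinearIndependent ℂ fun i => (L i) ∘ₗ (endSp ω).subtype)
    (h : ∀ i, ∀ X ∈ endSp ω, L i (X * b - b * X) = 0) : m ≤ n := by
  have h1 := finrank_ker_adEnd_le hω hnd hV hb hbn hb'
  have h2 := LinearMap.finrank_range_add_finrank_ker (adEnd hb)
  have h3 := Subspace.finrank_add_finrank_dualAnnihilator_eq (LinearMap.range (adEnd hb))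
  have h4 : m ≤ Module.finrank ℂ (LinearMap.range (adEnd hb)).dualAnnihilator := by
    let L' : Fin m → (LinearMap.range (adEnd hb)).dualAnnihilator := fun i =>
      ⟨(L i) ∘ₗ (endSp ω).subtype, by
        rw [Submodule.mem_dualAnnihilator]
        rintro _ ⟨X, rfl⟩
        exact h i X X.2⟩
    have : LinearIndependent ℂ L' := LinearIndependent.of_comp
      (LinearMap.range (adEnd hb)).dualAnnihilator.subtype hL
    simpa using this.fintype_card_le_finrank
  omega

end Centralizer

end SympCone

namespace SympCone

/-! ### Determinants of matrices with polynomial entries. -/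

section Determinants

variable {W : Type*} [AddCommGroup W] [Module ℂ W]

lemma det_mem_polyFun {ι : Type*} [Fintype ι] [DecidableEq ι] {M : W → Matrix ι ι ℂ}
    (h : ∀ i j, (fun w => M w i j) ∈ polyFun W) : (fun w => (M w).det) ∈ polyFun W := by
  have : (fun w => (M w).det) =
      ∑ σ : Equiv.Perm ι, ((Equiv.Perm.sign σ : ℤ) : ℂ) • ∏ i, fun w => M w (σ i) i := by
    ext w
    simp [Matrix.det_apply', Finset.sum_apply, Finset.prod_apply]
  rw [this]
  exact (polyFun W).sum_mem fun σ _ => (polyFun W).smul_mem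
    ((polyFun W).prod_mem fun i _ => h _ _) _

end Determinants

/-! ### Cayley transforms and a polynomial parametrization of the cone. -/

section Cayley

variable {V : Type*} [AddCommGroup V] [Module ℂ V] {ω : LinearMap.BilinForm ℂ V} {n : ℕ}

/-- The Cayley transform of an endomorphism with vanishing `2 * n`-th power. -/
noncomputable def cayley (n : ℕ) (u : Module.End ℂ V) : Module.End ℂ V :=
  (1 + u) * ∑ k ∈ Finset.range (2 * n), u ^ k

/-- The geometric sum inverts `1 - u`, so `cayley n u` is `(1 + u) / (1 - u)` in polynomial form,
and changing the sign of `u` inverts it. -/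
lemma cayley_mul_neg {u : Module.End ℂ V} (hu : u ^ (2 * n) = 0) :
    cayley n u * cayley n (-u) = 1 := by
  have h1 := mul_neg_geom_sum u (2 * n)
  have h2 := mul_neg_geom_sum (-u) (2 * n)
  rw [hu, sub_zero] at h1
  rw [(even_two_mul n).neg_pow, hu, sub_zero, sub_neg_eq_add] at h2
  have hc : Commute (∑ k ∈ Finset.range (2 * n), u ^ k) (1 + -u) := by
    refine Commute.sum_left _ _ _ fun k _ => ?_
    exact (Commute.one_right _).add_right ((Commute.refl u).pow_left k).neg_right
  rw [← sub_eq_add_neg] at hc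
  calc cayley n u * cayley n (-u) = (1 + u) * ((∑ k ∈ Finset.range (2 * n), u ^ k) * (1 - u)) *
        ∑ k ∈ Finset.range (2 * n), (-u) ^ k := by
        simp only [cayley, mul_assoc, sub_eq_add_neg]
    _ = 1 := by rw [hc.eq, h1, mul_one, h2]

lemma cayley_neg_mul {u : Module.End ℂ V} (hu : u ^ (2 * n) = 0) :
    cayley n (-u) * cayley n u = 1 := by
  have := cayley_mul_neg (n := n) (u := -u) (by rw [(even_two_mul n).neg_pow, hu])
  rwa [neg_neg] at this

lemma cayley_adjoint {u : Module.End ℂ V} (hu : u ∈ endSp ω) (x y : V) :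
    ω (cayley n u x) y = ω x (cayley n (-u) y) := by
  have h1 : ∀ x y, ω ((∑ k ∈ Finset.range (2 * n), u ^ k) x) y =
      ω x ((∑ k ∈ Finset.range (2 * n), (-u) ^ k) y) := by
    intro x y
    simp only [LinearMap.sum_apply, map_sum]
    refine Finset.sum_congr rfl fun k _ => ?_
    rw [endSp_pow_apply hu, neg_pow u k]
    rcases neg_one_pow_eq_or (Module.End ℂ V) k with h | h <;>
      rcases Nat.even_or_odd k with h' | h' <;>
      simp [h'.neg_one_pow]
  have hc : Commute (1 + -u) (∑ k ∈ Finset.range (2 * n), (-u) ^ k) := by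
    refine Commute.sum_right _ _ _ fun k _ => ?_
    exact (Commute.one_left _).add_left ((Commute.refl (-u)).pow_right k)
  have h2 : ∀ x y, ω ((1 + u) x) y = ω x ((1 + -u) y) := by
    intro x y
    simp only [LinearMap.add_apply, Module.End.one_apply, map_add, LinearMap.neg_apply, map_neg]
    rw [hu]
  unfold cayley
  rw [hc.eq, Module.End.mul_apply, h2, h1, ← Module.End.mul_apply]

lemma conj_mem_nilCone {c d : Module.End ℂ V} (hdc : d * c = 1)
    (hadj : ∀ x y, ω (c x) y = ω x (d y)) (hadj' : ∀ x y, ω (d x) y = ω x (c y))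
    {X : Module.End ℂ V} (hX : X ∈ nilCone ω n) :
    c * X * d ∈ nilCone ω n := by
  refine ⟨fun x y => ?_, ?_⟩
  · simp only [Module.End.mul_apply]
    rw [hadj, hX.1, hadj']
  · rcases Nat.eq_zero_or_pos (2 * n) with h | h
    · have h2 := hX.2
      rw [h, pow_zero] at h2 ⊢
      exact h2
    · have : ∀ k, (c * X * d) ^ (k + 1) = c * X ^ (k + 1) * d := by
        intro k
        induction k with
        | zero => simp
        | succ k ih =>
          rw [pow_succ, ih, pow_succ X (k + 1)]
          simp only [mul_assoc]
          rw [← mul_assoc d c, hdc, one_mul]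
      obtain ⟨m, hm⟩ : ∃ m, 2 * n = m + 1 := ⟨2 * n - 1, by omega⟩
      rw [hm, this, ← hm, hX.2, mul_zero, zero_mul]

variable [FiniteDimensional ℂ V]

lemma isPolyMap_cayley : IsPolyMap (fun u : Module.End ℂ V => cayley n u) :=
  ((isPolyMap_const 1).add isPolyMap_id).mul (IsPolyMap.sum _ fun k _ => isPolyMap_id.pow k)

/-- The symplectic basis in reversed order. -/
noncomputable def revBasis (ε : Fin (2 * n) → V) (i : Fin (2 * n)) : V := sg n i • ε i.rev

omit [FiniteDimensional ℂ V] in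
lemma revBasis_isSympBasis {ε : Fin (2 * n) → V} (hε : IsSympBasis ω ε) :
    IsSympBasis ω (revBasis ε) := by
  intro i j
  simp only [revBasis, map_smul, LinearMap.smul_apply, smul_eq_mul]
  rw [hε]
  by_cases h : j = i.rev
  · subst h
    rw [if_pos rfl, if_pos rfl, sg_rev]
    linear_combination (sg n i) * sg_mul_self i
  · rw [if_neg h, if_neg (fun h' => h (by rw [Fin.rev_rev] at h'; rw [← h', Fin.rev_rev]))]; ring

/-- Every flag opposite to the reversed flag of `ε` is the image of the flag of `ε` under a
Cayley transform. -/
lemma exists_cayley_eq (hω : ω.IsAlt) (hV : Module.finrank ℂ V = 2 * n) {ε : Fin (2 * n) → V}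
    (hε : IsSympBasis ω ε) {F : IsotropicFlag ω n} (hF : OppTo ε F) :
    ∃ u ∈ coordSub ω (revBasis ε) (2 * n - 1), ∀ i, cayley n u (ε i) = oppBasis ε F i := by
  obtain ⟨E, hE⟩ := (revBasis_isSympBasis hε).exists_flag hV
  let B := basisOfTopLeSpanOfCardEqFinrank ε (hε.span_eq_top hV).ge (by simp [hV])
  have hB : ∀ i, B i = ε i := fun i => by simp [B]
  -- `g` is the isometry carrying `ε` to the opposite basis. It is unipotent, so the Cayley
  -- transform can be inverted: `u = h / (2 + h)` with `h = g - 1`, where `q` is the inverse of `2 +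
  -- h` as a geometric sum.
  set g : Module.End ℂ V := B.constr ℂ (oppBasis ε F) with hg
  have hgε : ∀ i, g (ε i) = oppBasis ε F i := fun i => by
    rw [← hB i, hg, Module.Basis.constr_basis]
  have hb := oppBasis_isSympBasis hω hV hε hF
  have hgω : ∀ x y, ω (g x) (g y) = ω x y := by
    have : ω.compl₁₂ g g = ω := B.ext fun i => B.ext fun j => by
      rw [LinearMap.compl₁₂_apply, hB, hB, hgε, hgε, hb, hε]
    intro x y
    exact congrArg (fun β : LinearMap.BilinForm ℂ V => β x y) this
  set h := g - 1 with hh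
  have hgh : g = 1 + h := by rw [hh]; abel
  have hshift : Shifts h E := by
    intro k
    rw [Submodule.map_le_iff_le_comap, hE k.succ, Submodule.span_le]
    rintro _ ⟨j, hj, rfl⟩
    have hj' : j.castSucc < k.succ := hj
    refine ((revBasis_isSympBasis hε).mem_space_iff hV hE).2 fun i hi => ?_
    have hle : i.rev ≤ j.rev := by
      rw [Fin.rev_le_rev]
      rw [Fin.lt_def, Fin.val_castSucc, Fin.val_succ] at hj'
      rw [Fin.le_def, Fin.val_castSucc, Fin.val_castSucc] at hi
      rw [Fin.le_def]; omega
    have h1 := (oppBasis_spec hF j.rev).2 i.rev hle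
    rw [Fin.rev_rev] at h1
    simp only [revBasis, hh, LinearMap.sub_apply, map_smul, LinearMap.smul_apply, map_sub, hgε,
      Module.End.one_apply, Fin.rev_rev, h1, smul_eq_mul]
    rw [hε]
    simp only [Fin.rev_inj]
    by_cases hij : j = i
    · subst hij; simp
    · rw [if_neg (fun h => hij h.symm), if_neg hij]; ring
  have hn0 : h ^ (2 * n) = 0 := hshift.pow_eq_zero hV
  set q : Module.End ℂ V := (1 / 2 : ℂ) • ∑ k ∈ Finset.range (2 * n), ((-(1 / 2) : ℂ) • h) ^ k with hq
  have hq1 : (2 + h) * q = 1 := by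
    have h1 := mul_neg_geom_sum ((-(1 / 2) : ℂ) • h) (2 * n)
    rw [smul_pow, hn0, smul_zero, sub_zero] at h1
    have h2 : (2 + h) = (2 : ℂ) • (1 - (-(1 / 2) : ℂ) • h) := by
      rw [smul_sub, smul_smul]
      ext x
      simp [two_smul]
    rw [hq, h2, smul_mul_smul_comm, h1]
    norm_num
  have hcomm : Commute h q := by
    refine Commute.smul_right ?_ _
    refine Commute.sum_right _ _ _ fun k _ => ?_
    exact ((Commute.refl h).smul_right _).pow_right k
  have hq2 : q * (2 + h) = 1 := by
    rw [← hq1]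
    exact (((Commute.ofNat_left 2 q).add_left hcomm).eq).symm
  set u := h * q with hu
  have hu1 : u * (2 + h) = h := by rw [hu, mul_assoc, hq2, mul_one]
  have huE : Shifts u E := by
    have hqE : ∀ i, ∀ x ∈ E.space i, q x ∈ E.space i := by
      intro i x hx
      have hhE : ∀ x ∈ E.space i, h x ∈ E.space i := by
        intro x hx
        induction i using Fin.cases with
        | zero =>
          rw [E.space_zero, Submodule.mem_bot] at hx
          rw [hx, map_zero]; exact Submodule.zero_mem _
        | succ i => exact E.mono Fin.castSucc_lt_succ.le (hshift i ⟨x, hx, rfl⟩)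
      have hpow : ∀ k : ℕ, (h ^ k) x ∈ E.space i := by
        intro k
        induction k with
        | zero => exact hx
        | succ k ih => rw [pow_succ', Module.End.mul_apply]; exact hhE _ ih
      simp only [hq, LinearMap.smul_apply, LinearMap.sum_apply, smul_pow]
      exact Submodule.smul_mem _ _ (Submodule.sum_mem _ fun k _ => Submodule.smul_mem _ _ (hpow k))
    rintro j _ ⟨x, hx, rfl⟩
    exact hshift j ⟨q x, hqE _ x hx, rfl⟩
  have husp : u ∈ endSp ω := by
    intro x y
    -- After substituting `2 + h` in both arguments, skewness of `u` is invariance of `ω` under `1 +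
    -- h`.
    have key : ∀ x y, ω (u ((2 + h) x)) ((2 + h) y) = - ω ((2 + h) x) (u ((2 + h) y)) := by
      intro x y
      rw [← Module.End.mul_apply u, ← Module.End.mul_apply u, hu1]
      have h3 := hgω x y
      have h4 : ∀ z, (2 + h) z = (2 : ℂ) • z + h z := fun z => by
        rw [LinearMap.add_apply]; congr 1; rw [two_smul]
        rw [← one_add_one_eq_two]; rfl
      simp only [hgh, LinearMap.add_apply, Module.End.one_apply, map_add] at h3
      simp only [h4, map_add, LinearMap.add_apply, map_smul, LinearMap.smul_apply, smul_eq_mul]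
      linear_combination 2 * h3
    have h5 : ∀ z, (2 + h) (q z) = z := fun z => by rw [← Module.End.mul_apply, hq1]; rfl
    have := key (q x) (q y)
    rwa [h5, h5] at this
  have hun : u ^ (2 * n) = 0 := huE.pow_eq_zero hV
  refine ⟨u, ⟨husp, ((revBasis_isSympBasis hε).shifts_iff hV hE).1 huE⟩, fun i => ?_⟩
  have hgeom := mul_neg_geom_sum u (2 * n)
  have hgeom' := geom_sum_mul_neg u (2 * n)
  rw [hun, sub_zero] at hgeom hgeom'
  have h6 : (1 - u) * cayley n u = 1 + u := by
    have : Commute (1 - u) (1 + u) :=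
      ((Commute.one_left _).sub_left ((Commute.one_right _).add_right (Commute.refl u)))
    rw [cayley, ← mul_assoc, this.eq, mul_assoc, hgeom, mul_one]
  have h7 : (1 - u) * g = 1 + u := by
    have : u * h = h - 2 * u := by
      have := hu1
      rw [mul_add] at this
      rw [← (Commute.ofNat_right u 2).eq]
      exact eq_sub_of_add_eq' this
    rw [hgh, sub_mul, one_mul, mul_add, mul_one, this, two_mul]
    abel
  have h8 : cayley n u = g := by
    have := congrArg (fun z => (∑ k ∈ Finset.range (2 * n), u ^ k) * z) (h6.trans h7.symm)
    simp only [← mul_assoc] at this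
    rwa [hgeom', one_mul, one_mul] at this
  rw [h8, hgε]

/-- A polynomial map from an affine space of dimension `2 * n ^ 2` to the cone whose image contains
all elements that shift a flag opposite to the reversed flag of `ε`. -/
lemma exists_isPolyMap_nilCone (hω : ω.IsAlt) (hV : Module.finrank ℂ V = 2 * n)
    {ε : Fin (2 * n) → V} (hε : IsSympBasis ω ε) :
    ∃ φ : (Fin (2 * n ^ 2) → ℂ) → Module.End ℂ V, IsPolyMap φ ∧ (∀ x, φ x ∈ nilCone ω n) ∧
      ∀ A ∈ endSp ω, ∀ F : IsotropicFlag ω n, Shifts A F → OppTo ε F → A ∈ Set.range φ := by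
  obtain ⟨E, hE⟩ := (revBasis_isSympBasis hε).exists_flag hV
  obtain ⟨F₀, hF₀⟩ := hε.exists_flag hV
  let N₁ := coordSub ω (revBasis ε) (2 * n - 1)
  let N₂ := coordSub ω ε (2 * n - 1)
  have hnil₁ : ∀ u ∈ N₁, u ^ (2 * n) = 0 := fun u hu =>
    (((revBasis_isSympBasis hε).shifts_iff hV hE).2 hu.2).pow_eq_zero hV
  have hnil₂ : ∀ u ∈ N₂, u ^ (2 * n) = 0 := fun u hu =>
    ((hε.shifts_iff hV hF₀).2 hu.2).pow_eq_zero hV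
  have hdim : Module.finrank ℂ (N₁ × N₂) = 2 * n ^ 2 := by
    rw [Module.finrank_prod, (revBasis_isSympBasis hε).finrank_coordSub hω hV,
      hε.finrank_coordSub hω hV, card_coordIdx_nil]
    ring
  let e : (Fin (2 * n ^ 2) → ℂ) ≃ₗ[ℂ] N₁ × N₂ := LinearEquiv.ofFinrankEq _ _ (by simp [hdim])
  have h1 : IsPolyMap fun x => ((e x).1 : Module.End ℂ V) :=
    isPolyMap_linear (N₁.subtype ∘ₗ LinearMap.fst ℂ N₁ N₂ ∘ₗ e.toLinearMap)
  have h2 : IsPolyMap fun x => ((e x).2 : Module.End ℂ V) :=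
    isPolyMap_linear (N₂.subtype ∘ₗ LinearMap.snd ℂ N₁ N₂ ∘ₗ e.toLinearMap)
  have hadj' : ∀ u ∈ N₁, ∀ x y, ω (cayley n (-u) x) y = ω x (cayley n u y) := fun u hu x y => by
    rw [cayley_adjoint ((endSp ω).neg_mem hu.1), neg_neg]
  -- Elements of the nilradical of the flag of `ε`, moved by isometries coming from the opposite
  -- nilradical: `n ^ 2` parameters for each.
  refine ⟨fun x => cayley n (e x).1.1 * (e x).2.1 * cayley n (-(e x).1.1),
    ((isPolyMap_cayley.comp h1).mul h2).mul (isPolyMap_cayley.comp h1.neg), fun x => ?_, ?_⟩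
  · exact conj_mem_nilCone (cayley_neg_mul (hnil₁ _ (e x).1.2)) (cayley_adjoint (e x).1.2.1)
      (hadj' _ (e x).1.2) ⟨(e x).2.2.1, hnil₂ _ (e x).2.2⟩
  · intro A hA F hAF hF
    obtain ⟨u, hu, huε⟩ := exists_cayley_eq hω hV hε hF
    have hb := oppBasis_isSympBasis hω hV hε hF
    have hX : cayley n (-u) * A * cayley n u ∈ N₂ := by
      refine ⟨(conj_mem_nilCone (n := n) (cayley_mul_neg (hnil₁ _ hu)) (hadj' u hu)
        (cayley_adjoint hu.1) ⟨hA, hAF.pow_eq_zero hV⟩).1, fun i j hij => ?_⟩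
      rw [Module.End.mul_apply, Module.End.mul_apply, huε, ← cayley_adjoint hu.1, huε]
      exact (hb.shifts_iff hV (oppBasis_isAdapted hF)).1 hAF i j hij
    refine ⟨e.symm (⟨u, hu⟩, ⟨_, hX⟩), ?_⟩
    simp only [LinearEquiv.apply_symm_apply]
    have h3 := cayley_mul_neg (hnil₁ u hu)
    calc cayley n u * (cayley n (-u) * A * cayley n u) * cayley n (-u)
        = (cayley n u * cayley n (-u)) * A * (cayley n u * cayley n (-u)) := by
          simp only [mul_assoc]
      _ = A := by rw [h3, one_mul, mul_one]

end Cayley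

/-! ### Irreducibility, equations and dimension of the cone. -/

section Dimension

variable {V : Type*} [AddCommGroup V] [Module ℂ V] [FiniteDimensional ℂ V]
  {ω : LinearMap.BilinForm ℂ V} {n : ℕ}

omit [FiniteDimensional ℂ V] in
lemma zero_mem_nilCone (hn : 1 ≤ n) : (0 : Module.End ℂ V) ∈ nilCone ω n :=
  ⟨(endSp ω).zero_mem, zero_pow (by omega)⟩

/-- Two elements shift flags with a common opposite, so a single parametrization reaches both. -/
lemma nilCone_isIrreducible (hω : ω.IsAlt) (hnd : ω.Nondegenerate)
    (hV : Module.finrank ℂ V = 2 * n) (hn : 1 ≤ n) :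
    @IsIrreducible _ (zariski (Module.End ℂ V)) (nilCone ω n) := by
  refine zariski_isIrreducible ⟨0, zero_mem_nilCone hn⟩ fun A hA B hB => ?_
  obtain ⟨F, hAF, -⟩ := exists_shifts hω hnd hV hA (U := ⊥) bot_le bot_le
  obtain ⟨F', hBF, -⟩ := exists_shifts hω hnd hV hB (U := ⊥) bot_le bot_le
  obtain ⟨E, hFE, hFE'⟩ := exists_common_opposite hω hnd hV F F'
  obtain ⟨ε, hε, -, hεE⟩ := exists_isSympBasis hω hnd hV hFE
  obtain ⟨φ, hφ, hφN, hφr⟩ := exists_isPolyMap_nilCone hω hV hε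
  exact ⟨_, φ, hφ, hφN, hφr A hA.1 F hAF (oppTo_of_opposite hV hε hFE hεE),
    hφr B hB.1 F' hBF (oppTo_of_opposite hV hε hFE' hεE)⟩

/-- Each flag is shifted by a regular element. -/
lemma exists_regular_shifts (hω : ω.IsAlt) (hnd : ω.Nondegenerate)
    (hV : Module.finrank ℂ V = 2 * n) (hn : 1 ≤ n) (F : IsotropicFlag ω n) :
    ∃ A ∈ endSp ω, Shifts A F ∧ A ^ (2 * n - 1) ≠ 0 := by
  obtain ⟨b, hb, hbF⟩ := exists_adapted_isSympBasis hω hnd hV F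
  let z : Fin (2 * n) → Fin (2 * n) → ℂ := fun i j => if (i : ℕ) + j = 2 * n - 2 then 1 else 0
  have hz : ∀ i j, z i j = z j i := fun i j => by simp only [z, add_comm]
  have hs : Shifts (ofCoord ω b z) F := (hb.shifts_iff hV hbF).2 fun i j hij => by
    rw [hb.coord_ofCoord hz]
    exact if_neg (by omega)
  refine ⟨ofCoord ω b z, ofCoord_mem hω _ _, hs, (hb.regular_iff hV hn hbF hs).2 fun i j hij => ?_⟩
  rw [hb.coord_ofCoord hz]
  simp [z, hij]

/-- The `2 * n ^ 2 - n` linear equations of `endSp ω` and the `n` even traces. That their number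
equals the codimension is what later bounds the height of every point from below. -/
lemma exists_nilCone_equations (hω : ω.IsAlt) (hnd : ω.Nondegenerate)
    (hV : Module.finrank ℂ V = 2 * n) :
    ∃ g : Fin (2 * n ^ 2) → Module.End ℂ V → ℂ, (∀ j, g j ∈ polyFun (Module.End ℂ V)) ∧
      ∀ A, A ∈ nilCone ω n ↔ ∀ j, g j A = 0 := by
  let K := (endSp ω).dualAnnihilator
  have hK : Module.finrank ℂ K + n = 2 * n ^ 2 := by
    have h1 := Subspace.finrank_add_finrank_dualAnnihilator_eq (endSp ω)
    rw [finrank_endSp hω hnd hV, Module.finrank_linearMap, hV] at h1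
    have : 2 * n * (2 * n) = 4 * n ^ 2 := by ring
    show Module.finrank ℂ (endSp ω).dualAnnihilator + n = _
    omega
  let β := Module.finBasis ℂ K
  let e : Fin (Module.finrank ℂ K) ⊕ Fin n ≃ Fin (2 * n ^ 2) := finSumFinEquiv.trans (finCongr hK)
  let g' : Fin (Module.finrank ℂ K) ⊕ Fin n → Module.End ℂ V → ℂ :=
    Sum.elim (fun i A => (β i).1 A) fun r A => LinearMap.trace ℂ V (A ^ (2 * (r + 1 : ℕ)))
  refine ⟨fun j => g' (e.symm j), fun j => ?_, fun A => ?_⟩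
  · have : ∀ s, g' s ∈ polyFun (Module.End ℂ V) := by
      rintro (i | r)
      · exact dual_mem_polyFun (β i).1
      · exact isPolyMap_iff_mem.1 ((isPolyMap_linear (LinearMap.trace ℂ V)).comp (isPolyMap_id.pow _))
    exact this _
  · rw [e.symm.forall_congr_left]
    simp only [Equiv.symm_symm, Equiv.symm_apply_apply, Sum.forall]
    have hsp : A ∈ endSp ω ↔ ∀ i, (β i).1 A = 0 := by
      constructor
      · exact fun h i => (Submodule.mem_dualAnnihilator _).1 (β i).2 A h
      · intro h
        rw [← Subspace.dualAnnihilator_dualCoannihilator_eq (W := endSp ω),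
          Submodule.mem_dualCoannihilator]
        intro l hl
        have h5 : l A = (∑ i, β.repr ⟨l, hl⟩ i • β i : K).1 A := by rw [β.sum_repr]
        rw [h5]
        simp only [Submodule.coe_sum, Submodule.coe_smul, LinearMap.sum_apply,
          LinearMap.smul_apply, h, smul_zero, Finset.sum_const_zero]
    constructor
    · intro h
      refine ⟨hsp.1 h.1, fun r => ?_⟩
      exact (mem_nilCone_iff_trace hω hnd hV h.1).1 h _ (by omega) (by omega)
    · rintro ⟨h1, h2⟩
      refine (mem_nilCone_iff_trace hω hnd hV (hsp.2 h1)).2 fun r hr hr' => ?_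
      have := h2 ⟨r - 1, by omega⟩
      simp only [g', Sum.elim_inr, Nat.sub_add_cancel hr] at this
      exact this

lemma nilCone_isClosed (hω : ω.IsAlt) (hnd : ω.Nondegenerate)
    (hV : Module.finrank ℂ V = 2 * n) :
    @IsClosed _ (zariski (Module.End ℂ V)) (nilCone ω n) := by
  obtain ⟨g, hg, hS⟩ := exists_nilCone_equations hω hnd hV
  exact zariski_isClosed_of_zeros hg hS

/-- The parametrization is dominant: where the product of minors `h` is nonzero, the kernel flag of
`A` exists and is opposite, so `A` is in the image. A regular element shifting the flag of `ε` shows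
that `h` is not identically zero, and irreducibility extends vanishing to the whole cone. -/
lemma ringKrullDim_nilCone_le (hω : ω.IsAlt) (hnd : ω.Nondegenerate)
    (hV : Module.finrank ℂ V = 2 * n) (hn : 1 ≤ n) :
    ringKrullDim (coordRing (nilCone ω n)) ≤ ((2 * n ^ 2 : ℕ) : WithBot ℕ∞) := by
  have hirr := nilCone_isIrreducible hω hnd hV hn
  obtain ⟨ε, hε⟩ := exists_isSympBasis' hω hnd hV
  obtain ⟨F₀, hF₀⟩ := hε.exists_flag hV
  obtain ⟨φ, hφ, hφN, hφr⟩ := exists_isPolyMap_nilCone hω hV hε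
  have := ringKrullDim_coordRing_le hirr hφ hφN ?_
  · simpa using this
  intro p hp hp0
  obtain ⟨A₀, hA₀, hs₀, hr₀⟩ := exists_regular_shifts hω hnd hV hn F₀
  obtain ⟨v, hv⟩ : ∃ v, (A₀ ^ (2 * n - 1)) v ≠ 0 := by
    by_contra! h
    exact hr₀ (LinearMap.ext h)
  let fr : Module.End ℂ V → Fin (2 * n) → V := fun A j => (A ^ (2 * n - 1 - j : ℕ)) v
  let h : Module.End ℂ V → ℂ := fun A => ∏ i, (leadingMinor ω ε (fr A) i).det
  have hh : h ∈ polyFun (Module.End ℂ V) := by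
    have : h = ∏ i, fun A => (leadingMinor ω ε (fr A) i).det := by
      ext A; simp [h, Finset.prod_apply]
    rw [this]
    refine (polyFun _).prod_mem fun i _ => det_mem_polyFun fun k j => ?_
    exact isPolyMap_iff_mem.1 ((isPolyMap_linear (ω (ε k.1.rev))).comp
      ((isPolyMap_id.pow _).apply (isPolyMap_const v)))
  have hne : ∀ A ∈ nilCone ω n, h A ≠ 0 → A ∈ Set.range φ := by
    intro A hA hhA
    have hdet : ∀ i, (leadingMinor ω ε (fr A) i).det ≠ 0 := fun i =>
      (Finset.prod_ne_zero_iff.1 hhA) i (Finset.mem_univ i)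
    have hAv : (A ^ (2 * n - 1)) v ≠ 0 := by
      intro h0
      refine hdet (Fin.last _) (Matrix.det_eq_zero_of_column_eq_zero
        ⟨⟨0, by omega⟩, Fin.castSucc_lt_last _⟩ fun k => ?_)
      simp [leadingMinor, fr, h0]
    obtain ⟨F, hF⟩ := exists_kerFlag hnd hV hA fun h0 => hAv (by rw [h0]; rfl)
    exact hφr A hA.1 F (shifts_of_ker hF) ((oppTo_iff_det hV (isAdapted_pow hA.2 hF hAv)).2 hdet)
  refine (mul_eq_zero_on_of_isIrreducible hirr hp hh fun A hA => ?_).resolve_right fun h0 => ?_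
  · by_cases hhA : h A = 0
    · rw [hhA, mul_zero]
    · obtain ⟨x, rfl⟩ := hne A hA hhA
      rw [hp0, zero_mul]
  · have h1 := h0 A₀ ⟨hA₀, hs₀.pow_eq_zero hV⟩
    refine Finset.prod_ne_zero_iff.2 (fun i _ => ?_) h1
    exact (oppTo_iff_det hV (isAdapted_pow (hs₀.pow_eq_zero hV) (hs₀.space_eq hV hr₀) hv)).1
      (oppTo_self hV hε hF₀) i

/-- Counting equations bounds the height below, and the Krull dimension bounds it above. Since the
value is the same at all points, smoothness depends on the tangent space alone. -/
lemma height_pointIdeal_nilCone (hω : ω.IsAlt) (hnd : ω.Nondegenerate)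
    (hV : Module.finrank ℂ V = 2 * n) (hn : 1 ≤ n) (a : nilCone ω n) :
    (pointIdeal (nilCone ω n) a).height = ((2 * n ^ 2 : ℕ) : ℕ∞) := by
  obtain ⟨g, hg, hS⟩ := exists_nilCone_equations hω hnd hV
  have h1 := le_height_pointIdeal hg hS a
  have h2 : ((pointIdeal (nilCone ω n) a).height : WithBot ℕ∞) ≤ ((2 * n ^ 2 : ℕ) : WithBot ℕ∞) :=
    (Ideal.height_le_ringKrullDim_of_ne_top (Ideal.IsPrime.ne_top inferInstance)).trans
      (ringKrullDim_nilCone_le hω hnd hV hn)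
  have h3 : (pointIdeal (nilCone ω n) a).height ≤ ((2 * n ^ 2 : ℕ) : ℕ∞) :=
    WithBot.coe_le_coe.1 h2
  refine le_antisymm h3 ?_
  have h4 : Module.finrank ℂ (Module.End ℂ V) = 2 * n ^ 2 + 2 * n ^ 2 := by
    rw [Module.finrank_linearMap, hV]; ring
  rw [h4, Nat.cast_add] at h1
  exact (ENat.add_le_add_iff_right (ENat.natCast_ne_top _)).1 h1

lemma ringKrullDim_nilCone (hω : ω.IsAlt) (hnd : ω.Nondegenerate)
    (hV : Module.finrank ℂ V = 2 * n) (hn : 1 ≤ n) :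
    ringKrullDim (coordRing (nilCone ω n)) = ((2 * n ^ 2 : ℕ) : WithBot ℕ∞) := by
  refine le_antisymm (ringKrullDim_nilCone_le hω hnd hV hn) ?_
  have h1 := height_pointIdeal_nilCone hω hnd hV hn ⟨0, zero_mem_nilCone hn⟩
  have h2 := Ideal.height_le_ringKrullDim_of_ne_top
    (I := pointIdeal (nilCone ω n) ⟨0, zero_mem_nilCone hn⟩) (Ideal.IsPrime.ne_top inferInstance)
  rw [h1] at h2
  exact_mod_cast h2

end Dimension

end SympCone

namespace SympCone

/-! ### Velocities of curves and differentials of trace functions. -/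

section Velocity

variable {W W₁ W₂ W₃ : Type*} [AddCommGroup W] [Module ℂ W] [AddCommGroup W₁] [Module ℂ W₁]
  [AddCommGroup W₂] [Module ℂ W₂] [AddCommGroup W₃] [Module ℂ W₃]

/-- The curve `γ` has velocity `X` at `0`. -/
def HasVel (γ : ℂ → W) (X : W) : Prop :=
  ∀ l : Module.Dual ℂ W, HasDerivAt (fun t => l (γ t)) (l X) 0

lemma hasVel_const (a : W) : HasVel (fun _ => a) 0 := fun l => by
  rw [map_zero]; exact hasDerivAt_const _ _

lemma hasVel_line (a X : W) : HasVel (fun t : ℂ => a + t • X) X := hasDerivAt_line a X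

lemma HasVel.bilin [FiniteDimensional ℂ W₁] {φ : ℂ → W₁} {ψ : ℂ → W₂} {X : W₁} {Y : W₂}
    (B : W₁ →ₗ[ℂ] W₂ →ₗ[ℂ] W₃) (hφ : HasVel φ X) (hψ : HasVel ψ Y) :
    HasVel (fun t => B (φ t) (ψ t)) (B X (ψ 0) + B (φ 0) Y) := fun l => by
  let b := Module.finBasis ℂ W₁
  have key : ∀ x y, l (B x y) = ∑ i, b.coord i x * (l ∘ₗ B (b i)) y := by
    intro x y
    conv_lhs => rw [← b.sum_repr x]
    simp only [map_sum, map_smul, LinearMap.sum_apply, LinearMap.smul_apply, smul_eq_mul,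
      Module.Basis.coord_apply, LinearMap.comp_apply]
  rw [map_add, key, key, ← Finset.sum_add_distrib]
  simp only [key (φ _)]
  exact HasDerivAt.fun_sum fun i _ => (hφ (b.coord i)).mul (hψ (l ∘ₗ B (b i)))

lemma HasVel.mul [FiniteDimensional ℂ W] {φ ψ : ℂ → Module.End ℂ W} {X Y : Module.End ℂ W}
    (hφ : HasVel φ X) (hψ : HasVel ψ Y) :
    HasVel (fun t => φ t * ψ t) (X * ψ 0 + φ 0 * Y) :=
  HasVel.bilin (LinearMap.mul ℂ (Module.End ℂ W)) hφ hψ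

/-- The derivative is a noncommutative sum, but only its traces against powers of `a` are needed,
where cyclicity merges all terms. Arbitrary `m` is kept for the induction. -/
lemma exists_hasVel_pow [FiniteDimensional ℂ W] (a X : Module.End ℂ W) (k : ℕ) :
    ∃ D, HasVel (fun t : ℂ => (a + t • X) ^ (k + 1)) D ∧
      ∀ m, LinearMap.trace ℂ W (a ^ m * D) = (k + 1) * LinearMap.trace ℂ W (a ^ (m + k) * X) := by
  induction k with
  | zero =>
    refine ⟨X, ?_, fun m => by simp⟩
    simp only [zero_add, pow_one]
    exact hasVel_line a X
  | succ k ih =>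
    obtain ⟨D, hD, hD'⟩ := ih
    refine ⟨D * a + a ^ (k + 1) * X, ?_, fun m => ?_⟩
    · have := hD.mul (hasVel_line a X)
      simp only [zero_smul, add_zero] at this
      simp only [pow_succ _ (k + 1)]
      exact this
    · have h1 : LinearMap.trace ℂ W (a ^ m * (D * a)) = LinearMap.trace ℂ W (a ^ (m + 1) * D) := by
        rw [← mul_assoc, LinearMap.trace_mul_comm, ← mul_assoc, ← pow_succ']
      rw [mul_add, map_add, h1, hD', ← mul_assoc, ← pow_add]
      push_cast
      rw [show m + 1 + k = m + (k + 1) by ring]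
      ring

lemma polyDiff_trace_pow [FiniteDimensional ℂ W] (a X : Module.End ℂ W) (k : ℕ) :
    polyDiff (fun A => LinearMap.trace ℂ W (A ^ (k + 1))) a X =
      (k + 1) * LinearMap.trace ℂ W (a ^ k * X) := by
  obtain ⟨D, hD, hD'⟩ := exists_hasVel_pow a X k
  have h1 := hasDerivAt_polyDiff_line (p := fun A => LinearMap.trace ℂ W (A ^ (k + 1)))
    (isPolyMap_iff_mem.1 ((isPolyMap_linear (LinearMap.trace ℂ W)).comp (isPolyMap_id.pow _))) a X
  have h2 := hD (LinearMap.trace ℂ W)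
  have h3 := hD' 0
  rw [pow_zero, one_mul, zero_add] at h3
  rw [← h3]
  exact h1.unique h2

end Velocity

/-! ### Independent powers and generic linear independence. -/

section LinearAlgebra

/-- Multiply the relation by the power of `b` that brings its lowest surviving exponent to the last
one with nonzero power; all other terms vanish. -/
lemma pow_sum_eq_zero {R : Type*} [Ring R] [Algebra ℂ R] {b : R} {N : ℕ} (hb : b ^ N = 0) {r : ℕ}
    {e : Fin r → ℕ} (he : StrictMono e) (hne : ∀ k, b ^ e k ≠ 0) {α : Fin r → ℂ}
    (h : ∑ k, α k • b ^ e k = 0) (k : Fin r) : α k = 0 := by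
  classical
  by_contra hk
  have hex : ∃ p, b ^ p = 0 := ⟨N, hb⟩
  have hfind := Nat.find_spec hex
  have hmin : ∀ m < Nat.find hex, b ^ m ≠ 0 := fun m hm => Nat.find_min hex hm
  set p := Nat.find hex
  obtain ⟨k₀, hk₀, hk₀'⟩ := (Finset.univ.filter fun k => α k ≠ 0).exists_min_image id
    ⟨k, by simpa using hk⟩
  simp only [Finset.mem_filter, Finset.mem_univ, true_and, id] at hk₀ hk₀'
  have hlt : e k₀ < p := by
    by_contra hle
    apply hne k₀
    rw [← Nat.sub_add_cancel (not_lt.1 hle), pow_add, hfind, mul_zero]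
  have h1 := congrArg (fun x => b ^ (p - 1 - e k₀) * x) h
  simp only [Finset.mul_sum, mul_smul_comm, ← pow_add, mul_zero] at h1
  rw [Finset.sum_eq_single k₀] at h1
  · rw [show p - 1 - e k₀ + e k₀ = p - 1 by omega] at h1
    exact (smul_ne_zero hk₀ (hmin (p - 1) (by omega))) h1
  · intro j _ hj
    by_cases hαj : α j = 0
    · rw [hαj, zero_smul]
    · have h2 : e k₀ < e j := he (lt_of_le_of_ne (hk₀' j hαj) (Ne.symm hj))
      rw [show p - 1 - e k₀ + e j = (e j - e k₀ - 1) + p by omega, pow_add, hfind, mul_zero,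
        smul_zero]
  · simp

variable {U : Type*} [AddCommGroup U] [Module ℂ U] [FiniteDimensional ℂ U]

lemma exists_dual_vectors {m : ℕ} {L : Fin m → Module.Dual ℂ U} (h : LinearIndependent ℂ L) :
    ∃ x : Fin m → U, ∀ i j, L i (x j) = if i = j then 1 else 0 := by
  have : ∀ j, ∃ x : U, ∀ i, L i x = if i = j then 1 else 0 := by
    intro j
    let B := Module.Basis.span h
    obtain ⟨g, hg⟩ := LinearMap.exists_extend (B.coord j)
    refine ⟨(Module.evalEquiv ℂ U).symm g, fun i => ?_⟩
    rw [Module.apply_evalEquiv_symm_apply]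
    have h1 : B i = (⟨L i, Submodule.subset_span ⟨i, rfl⟩⟩ : Submodule.span ℂ (Set.range L)) :=
      Module.Basis.span_apply h i
    have h2 : g (L i) = B.coord j (B i) := by rw [← hg, h1]; rfl
    rw [h2, Module.Basis.coord_apply, Module.Basis.repr_self, Finsupp.single_apply]
  choose x hx using this
  exact ⟨x, fun i j => hx j i⟩

/-- Linear independence of functionals with polynomial coefficients is a generic condition. -/
lemma eventually_linearIndependent {m : ℕ} {M : ℂ → Fin m → Module.Dual ℂ U}
    (hM : ∀ i x, (fun t => M t i x) ∈ polyFun ℂ) {t₀ : ℂ} (h : LinearIndependent ℂ (M t₀)) :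
    ∀ᶠ t in Filter.cofinite, LinearIndependent ℂ (M t) := by
  -- Pairing with vectors dual at `t₀` gives a polynomial determinant equal to 1 there.
  obtain ⟨x, hx⟩ := exists_dual_vectors h
  have hdet := det_mem_polyFun (M := fun t => Matrix.of fun i j => M t i (x j)) fun i j => hM i (x j)
  have h0 : (Matrix.of fun i j => M t₀ i (x j)).det ≠ 0 := by
    have : (Matrix.of fun i j => M t₀ i (x j)) = 1 := by
      ext i j
      rw [Matrix.of_apply, hx, Matrix.one_apply]
    rw [this, Matrix.det_one]
    exact one_ne_zero
  filter_upwards [eventually_ne_zero hdet h0] with t ht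
  rw [Fintype.linearIndependent_iff]
  intro c hc
  have : c = 0 := by
    refine Matrix.eq_zero_of_vecMul_eq_zero ht (funext fun j => ?_)
    have := congrArg (fun l : Module.Dual ℂ U => l (x j)) hc
    simpa [Matrix.vecMul, dotProduct] using this
  simp [this]

lemma eventually_pow_ne_zero {a c : Module.End ℂ U} {k : ℕ} (h : c ^ k ≠ 0) :
    ∀ᶠ t in Filter.cofinite, (a + (t : ℂ) • (c - a)) ^ k ≠ 0 := by
  obtain ⟨l, hl⟩ : ∃ l : Module.Dual ℂ (Module.End ℂ U), l (c ^ k) ≠ 0 := by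
    by_contra! h'
    exact h ((Module.forall_dual_apply_eq_zero_iff ℂ _).1 h')
  have h1 := ((isPolyMap_line a (c - a)).pow k) l
  filter_upwards [eventually_ne_zero h1 (t₀ := 1) (by simpa using hl)] with t ht h0
  rw [h0, map_zero] at ht
  exact ht rfl

end LinearAlgebra

/-! ### The tangent space of the cone, in particular at regular points. -/

section Tangent

variable {V : Type*} [AddCommGroup V] [Module ℂ V] [FiniteDimensional ℂ V]
  {ω : LinearMap.BilinForm ℂ V} {n : ℕ}

/-- For a square `S` one has `S * S = 0`, so `1 + t • S` is an isometry with inverse `1 - t • S`.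
Conjugating `a` by it gives a curve in the cone with the desired velocity, and squares span `endSp
ω`. -/
lemma commutator_mem_tangentSpace (hω : ω.IsAlt) (hnd : ω.Nondegenerate)
    (hV : Module.finrank ℂ V = 2 * n) {a : Module.End ℂ V} (ha : a ∈ nilCone ω n)
    {X : Module.End ℂ V} (hX : X ∈ endSp ω) : X * a - a * X ∈ tangentSpace (nilCone ω n) a := by
  refine endSp_induction hω hnd hV (P := (tangentSpace (nilCone ω n) a).comap
    (LinearMap.mulRight ℂ a - LinearMap.mulLeft ℂ a)) (fun u => ?_) hX
  rw [Submodule.mem_comap]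
  simp only [LinearMap.sub_apply, LinearMap.mulRight_apply, LinearMap.mulLeft_apply]
  set S := symEnd ω u u with hS
  have hSsp : S ∈ endSp ω := symEnd_mem hω u u
  have hSS : S * S = 0 := by
    ext x
    simp only [hS, Module.End.mul_apply, symEnd_apply, map_add, map_smul, hω u, zero_smul, add_zero,
      smul_zero, LinearMap.zero_apply]
  have hadj : ∀ (t : ℂ) x y, ω ((1 + t • S) x) y = ω x ((1 + t • -S) y) := by
    intro t x y
    simp only [LinearMap.add_apply, Module.End.one_apply, LinearMap.smul_apply, map_add, map_smul,
      LinearMap.neg_apply, map_neg, smul_eq_mul]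
    rw [hSsp x y]
  have hadj' : ∀ (t : ℂ) x y, ω ((1 + t • -S) x) y = ω x ((1 + t • S) y) := by
    intro t x y
    simp only [LinearMap.add_apply, Module.End.one_apply, LinearMap.smul_apply, map_add, map_smul,
      LinearMap.neg_apply, map_neg, smul_eq_mul]
    rw [hSsp x y]
    ring
  refine mem_tangentSpace (γ := fun t : ℂ => (1 + t • S) * a * (1 + t • -S)) (by simp) ?_ fun t =>
    conj_mem_nilCone ?_ (hadj t) (hadj' t) ha
  · have h1 := ((hasVel_line 1 S).mul (hasVel_const a)).mul (hasVel_line 1 (-S))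
    simp only [zero_smul, add_zero, mul_zero, mul_one, one_mul, mul_neg, ← sub_eq_add_neg] at h1
    exact h1
  · simp only [add_mul, mul_add, one_mul, mul_one, smul_mul_smul_comm, neg_mul, hSS, neg_zero,
      smul_zero, smul_neg]
    abel

/-- The functional `X ↦ tr (B X)`. -/
noncomputable def trDual (V : Type*) [AddCommGroup V] [Module ℂ V] :
    Module.End ℂ V →ₗ[ℂ] Module.Dual ℂ (Module.End ℂ V) :=
  (LinearMap.mul ℂ (Module.End ℂ V)).compr₂ (LinearMap.trace ℂ V)

omit [FiniteDimensional ℂ V] in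
lemma trDual_apply (B X : Module.End ℂ V) : trDual V B X = LinearMap.trace ℂ V (B * X) := rfl

lemma linearIndependent_trDual (hω : ω.IsAlt) (hnd : ω.Nondegenerate) {ι : Type*}
    {B : ι → Module.End ℂ V} (hB : ∀ i, B i ∈ endSp ω) (h : LinearIndependent ℂ B) :
    LinearIndependent ℂ fun i => (trDual V (B i)) ∘ₗ (endSp ω).subtype := by
  let Θ : endSp ω →ₗ[ℂ] Module.Dual ℂ (endSp ω) :=
    (LinearMap.lcomp ℂ ℂ (endSp ω).subtype) ∘ₗ trDual V ∘ₗ (endSp ω).subtype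
  have hΘ : LinearMap.ker Θ = ⊥ := by
    rw [LinearMap.ker_eq_bot']
    rintro ⟨B, hB⟩ h0
    refine Subtype.ext (eq_zero_of_trace_mul hω hnd hB fun X hX => ?_)
    exact congrArg (fun l : Module.Dual ℂ (endSp ω) => l ⟨X, hX⟩) h0
  have h1 : LinearIndependent ℂ fun i => (⟨B i, hB i⟩ : endSp ω) :=
    LinearIndependent.of_comp (endSp ω).subtype h
  exact h1.map' Θ hΘ

omit [FiniteDimensional ℂ V] in
lemma tangentSpace_le_endSp (a : Module.End ℂ V) : tangentSpace (nilCone ω n) a ≤ endSp ω := by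
  intro X hX
  rw [← Subspace.dualAnnihilator_dualCoannihilator_eq (W := endSp ω),
    Submodule.mem_dualCoannihilator]
  intro l hl
  have := hX _ (dual_mem_polyFun l) fun s hs => (Submodule.mem_dualAnnihilator _).1 hl s hs.1
  rwa [polyDiff_dual] at this

lemma finrank_comap_subtype {U : Type*} [AddCommGroup U] [Module ℂ U] {p q : Submodule ℂ U}
    (h : p ≤ q) : Module.finrank ℂ (p.comap q.subtype) = Module.finrank ℂ p := by
  rw [← Submodule.finrank_map_subtype_eq, Submodule.map_comap_subtype, inf_eq_right.2 h]

/-- From above: the even traces have differentials given by the odd powers of `a`, which are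
independent. From below: the commutators with `a` are tangent, and the centralizer is small. -/
lemma finrank_tangentSpace_regular (hω : ω.IsAlt) (hnd : ω.Nondegenerate)
    (hV : Module.finrank ℂ V = 2 * n) {a : Module.End ℂ V} (ha : a ∈ endSp ω)
    (han : a ^ (2 * n) = 0) (ha' : a ^ (2 * n - 1) ≠ 0) :
    Module.finrank ℂ (tangentSpace (nilCone ω n) a) = 2 * n ^ 2 := by
  have hsp := finrank_endSp hω hnd hV
  apply le_antisymm
  · have hli : LinearIndependent ℂ fun r : Fin n => a ^ (2 * (r : ℕ) + 1) := by
      rw [Fintype.linearIndependent_iff]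
      intro α hα
      refine pow_sum_eq_zero han (e := fun r : Fin n => 2 * (r : ℕ) + 1) (fun i j hij => ?_)
        (fun k h0 => ha' ?_) hα
      · have : (i : ℕ) < j := hij
        simp only
        omega
      · rw [← Nat.sub_add_cancel (show 2 * (k : ℕ) + 1 ≤ 2 * n - 1 by omega), pow_add, h0, mul_zero]
    have hli' := linearIndependent_trDual hω hnd (fun r : Fin n => endSp_pow_odd ha ⟨r, rfl⟩) hli
    let T := (tangentSpace (nilCone ω n) a).comap (endSp ω).subtype
    let L : Fin n → T.dualAnnihilator := fun r =>
      ⟨(trDual V (a ^ (2 * (r : ℕ) + 1))) ∘ₗ (endSp ω).subtype, by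
        rw [Submodule.mem_dualAnnihilator]
        intro X hX
        have h1 := hX _ (isPolyMap_iff_mem.1 ((isPolyMap_linear (LinearMap.trace ℂ V)).comp
          (isPolyMap_id.pow (2 * (r : ℕ) + 1 + 1)))) fun A hA => by
          have := (mem_nilCone_iff_trace hω hnd hV hA.1).1 hA (r + 1) (by omega) (by omega)
          rwa [show 2 * ((r : ℕ) + 1) = 2 * (r : ℕ) + 1 + 1 by ring] at this
        rw [polyDiff_trace_pow] at h1
        exact (mul_eq_zero.1 h1).resolve_left (Nat.cast_add_one_ne_zero _)⟩
    have hL : LinearIndependent ℂ L := LinearIndependent.of_comp T.dualAnnihilator.subtype hli'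
    have h2 := hL.fintype_card_le_finrank
    have h3 := Subspace.finrank_add_finrank_dualAnnihilator_eq T
    have h4 : Module.finrank ℂ T = Module.finrank ℂ (tangentSpace (nilCone ω n) a) :=
      finrank_comap_subtype (tangentSpace_le_endSp a)
    rw [Fintype.card_fin] at h2
    omega
  · have h1 := finrank_ker_adEnd_le hω hnd hV ha han ha'
    have h2 := LinearMap.finrank_range_add_finrank_ker (adEnd ha)
    have h3 : (LinearMap.range (adEnd ha)).map (endSp ω).subtype ≤ tangentSpace (nilCone ω n) a := by
      rintro _ ⟨_, ⟨X, rfl⟩, rfl⟩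
      exact commutator_mem_tangentSpace hω hnd hV ⟨ha, han⟩ X.2
    have h4 := Submodule.finrank_mono h3
    rw [Submodule.finrank_map_subtype_eq] at h4
    omega

/-- If the tangent space has the expected dimension then there are `n` equations with independent
differentials. -/
lemma exists_equations (hω : ω.IsAlt) (hnd : ω.Nondegenerate)
    (hV : Module.finrank ℂ V = 2 * n) {a : Module.End ℂ V}
    (ha : Module.finrank ℂ (tangentSpace (nilCone ω n) a) = 2 * n ^ 2) :
    ∃ f : Fin n → Module.End ℂ V → ℂ, (∀ i, f i ∈ polyFun (Module.End ℂ V)) ∧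
      (∀ i, ∀ A ∈ nilCone ω n, f i A = 0) ∧
      LinearIndependent ℂ fun i => (polyDiff (f i) a) ∘ₗ (endSp ω).subtype := by
  let T := (tangentSpace (nilCone ω n) a).comap (endSp ω).subtype
  have h1 := Subspace.finrank_add_finrank_dualAnnihilator_eq T
  have h2 : Module.finrank ℂ T = Module.finrank ℂ (tangentSpace (nilCone ω n) a) :=
    finrank_comap_subtype (tangentSpace_le_endSp a)
  rw [h2, ha, finrank_endSp hω hnd hV] at h1
  let β : Module.Basis (Fin n) ℂ T.dualAnnihilator :=
    Module.finBasisOfFinrankEq ℂ _ (Nat.add_left_cancel h1)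
  have h3 : ∀ i, ∃ f ∈ polyFun (Module.End ℂ V), (∀ A ∈ nilCone ω n, f A = 0) ∧
      (polyDiff f a) ∘ₗ (endSp ω).subtype = (β i).1 := by
    intro i
    obtain ⟨l, hl⟩ := LinearMap.exists_extend (β i).1
    have h4 : l ∈ conormalSpace (nilCone ω n) a := by
      rw [conormalSpace_eq, Submodule.mem_dualAnnihilator]
      intro X hX
      have h5 : l X = (l ∘ₗ (endSp ω).subtype) ⟨X, tangentSpace_le_endSp a hX⟩ := rfl
      rw [h5, hl]
      exact (Submodule.mem_dualAnnihilator _).1 (β i).2 _ hX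
    obtain ⟨f, hf, hf', rfl⟩ := h4
    exact ⟨f, hf, hf', hl⟩
  choose f hf hf' hfβ using h3
  refine ⟨f, hf, hf', ?_⟩
  simp only [hfβ]
  exact β.linearIndependent.map' T.dualAnnihilator.subtype (Submodule.ker_subtype _)

end Tangent

/-! ### Non-regular elements are singular. -/

section Singular

variable {V : Type*} [AddCommGroup V] [Module ℂ V] [FiniteDimensional ℂ V]
  {ω : LinearMap.BilinForm ℂ V} {n : ℕ}

omit [FiniteDimensional ℂ V] in
lemma Shifts.line {a c : Module.End ℂ V} {F : IsotropicFlag ω n} (ha : Shifts a F) (hc : Shifts c F)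
    (t : ℂ) : Shifts (a + t • (c - a)) F := by
  rintro j _ ⟨x, hx, rfl⟩
  have h1 := ha j ⟨x, hx, rfl⟩
  have h2 := hc j ⟨x, hx, rfl⟩
  simp only [LinearMap.add_apply, LinearMap.smul_apply, LinearMap.sub_apply]
  exact Submodule.add_mem _ h1 (Submodule.smul_mem _ _ (Submodule.sub_mem _ h2 h1))

/-- A polynomial family of functionals that kills the commutators with all elements shifting a flag
depends on the differentials of `n` independent equations. -/
lemma mem_span_of_commutator (hω : ω.IsAlt) (hnd : ω.Nondegenerate)
    (hV : Module.finrank ℂ V = 2 * n) (hn : 1 ≤ n) {f : Fin n → Module.End ℂ V → ℂ}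
    (hf : ∀ i, f i ∈ polyFun (Module.End ℂ V)) (hf' : ∀ i, ∀ A ∈ nilCone ω n, f i A = 0)
    {F : IsotropicFlag ω n} {Y : Module.End ℂ V → Module.Dual ℂ (Module.End ℂ V)}
    (hYp : ∀ X, (fun b => Y b X) ∈ polyFun (Module.End ℂ V))
    (hY : ∀ b ∈ endSp ω, Shifts b F → ∀ X ∈ endSp ω, Y b (X * b - b * X) = 0)
    {b : Module.End ℂ V} (hb : b ∈ endSp ω) (hbF : Shifts b F)
    (hli : LinearIndependent ℂ fun i => (polyDiff (f i) b) ∘ₗ (endSp ω).subtype) :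
    (Y b) ∘ₗ (endSp ω).subtype ∈
      Submodule.span ℂ (Set.range fun i => (polyDiff (f i) b) ∘ₗ (endSp ω).subtype) := by
  by_contra hnot
  obtain ⟨c, hc, hcF, hcr⟩ := exists_regular_shifts hω hnd hV hn F
  let G : Module.End ℂ V → Fin (n + 1) → Module.Dual ℂ (Module.End ℂ V) := fun b =>
    Fin.cons (Y b) fun i => polyDiff (f i) b
  have hG : ∀ b i X, (fun t : ℂ => G (b + t • (c - b)) i X) ∈ polyFun ℂ := by
    intro b i X
    induction i using Fin.cases with
    | zero => exact (isPolyMap_line b (c - b)).comp_mem (hYp X)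
    | succ i => exact (isPolyMap_line b (c - b)).comp_mem (polyDiff_mem (hf i) X)
  have hG0 : LinearIndependent ℂ fun i => (G (b + (0 : ℂ) • (c - b)) i) ∘ₗ (endSp ω).subtype := by
    have h1 := linearIndependent_finCons.2 ⟨hli, hnot⟩
    rw [zero_smul, add_zero]
    convert! h1 using 1
    ext i
    refine Fin.cases ?_ (fun i => ?_) i <;> rfl
  have hev := eventually_linearIndependent
    (M := fun t i => (G (b + (t : ℂ) • (c - b)) i) ∘ₗ (endSp ω).subtype)
    (fun i x => hG b i x) hG0
  obtain ⟨t, ht1, ht2⟩ := (hev.and (eventually_pow_ne_zero (a := b) hcr)).exists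
  have hbt : b + t • (c - b) ∈ endSp ω :=
    (endSp ω).add_mem hb ((endSp ω).smul_mem _ ((endSp ω).sub_mem hc hb))
  have hbtF := hbF.line hcF t
  have := card_le_of_linearIndependent hω hnd hV hbt (hbtF.pow_eq_zero hV) ht2 ht1 fun i X hX => by
    induction i using Fin.cases with
    | zero => exact hY _ hbt hbtF X hX
    | succ i =>
      exact commutator_mem_tangentSpace hω hnd hV ⟨hbt, hbtF.pow_eq_zero hV⟩ hX _ (hf i) (hf' i)
  omega

/-- Kernel and range of `a` are orthogonal. If `a` is nonzero, a nonzero vector in both together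
with any independent kernel vector spans such a plane. -/
lemma exists_isotropic_plane (hω : ω.IsAlt) (hnd : ω.Nondegenerate)
    (hV : Module.finrank ℂ V = 2 * n) (hn : 2 ≤ n) {a : Module.End ℂ V} (ha : a ∈ nilCone ω n)
    (ha' : a ^ (2 * n - 1) = 0) :
    ∃ U ≤ LinearMap.ker a, U ≤ ω.orthogonal U ∧ Module.finrank ℂ U = 2 := by
  by_cases h0 : a = 0
  · obtain ⟨b, hb⟩ := exists_isSympBasis' hω hnd hV
    obtain ⟨F, -⟩ := hb.exists_flag hV
    refine ⟨F.space ⟨2, by omega⟩, by rw [h0, LinearMap.ker_zero]; exact le_top, ?_,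
      F.finrank_space _⟩
    rw [← F.space_rev]
    refine F.mono ?_
    rw [Fin.le_def, Fin.val_rev]
    simp only
    omega
  · have hker : 2 ≤ Module.finrank ℂ (LinearMap.ker a) := by
      have h1 := LinearMap.finrank_range_add_finrank_ker a
      have h2 := (finrank_range_eq_iff (by omega) hV ha.2).not.2 (not_not.2 ha')
      have h3 : Module.finrank ℂ (LinearMap.ker a) ≠ 0 := by
        intro h3
        rw [Submodule.finrank_eq_zero, LinearMap.ker_eq_bot] at h3
        have h4 : Function.Injective (a ^ (2 * n)) := by
          rw [Module.End.coe_pow]; exact h3.iterate _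
        rw [ha.2] at h4
        have : Subsingleton V := ⟨fun x y => h4 rfl⟩
        rw [Module.finrank_zero_of_subsingleton] at hV
        omega
      omega
    obtain ⟨w₁, hw₁0, hw₁, y, rfl⟩ : ∃ w, w ≠ 0 ∧ a w = 0 ∧ ∃ y, a y = w := by
      classical
      have hex : ∃ p, a ^ p = 0 := ⟨_, ha.2⟩
      have hfind := Nat.find_spec hex
      have hmin : ∀ m < Nat.find hex, a ^ m ≠ 0 := fun m hm => Nat.find_min hex hm
      have hp0 : Nat.find hex ≠ 0 := fun h => by
        rw [h, pow_zero] at hfind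
        exact h0 (by rw [← mul_one a, hfind, mul_zero])
      have hp1 : Nat.find hex ≠ 1 := fun h => by
        rw [h, pow_one] at hfind
        exact h0 hfind
      obtain ⟨x, hx⟩ : ∃ x, (a ^ (Nat.find hex - 1)) x ≠ 0 := by
        by_contra! h
        exact hmin _ (by omega) (LinearMap.ext h)
      refine ⟨_, hx, ?_, (a ^ (Nat.find hex - 2)) x, ?_⟩
      · rw [← Module.End.mul_apply, ← pow_succ', Nat.sub_add_cancel (by omega), hfind]; rfl
      · rw [← Module.End.mul_apply, ← pow_succ']
        congr 2
        omega
    obtain ⟨w₂, hw₂, hw₂'⟩ : ∃ w ∈ LinearMap.ker a, w ∉ Submodule.span ℂ {a y} := by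
      by_contra! h
      have h1 := Submodule.finrank_mono (h : LinearMap.ker a ≤ _)
      rw [finrank_span_singleton hw₁0] at h1
      omega
    refine ⟨Submodule.span ℂ {a y} ⊔ Submodule.span ℂ {w₂}, ?_, isotropic_sup_span hω ?_ ?_, ?_⟩
    · rw [sup_le_iff, Submodule.span_singleton_le_iff_mem, Submodule.span_singleton_le_iff_mem]
      exact ⟨hw₁, hw₂⟩
    · rw [Submodule.span_singleton_le_iff_mem]
      intro z hz
      obtain ⟨s, rfl⟩ := Submodule.mem_span_singleton.1 hz
      show ω (s • a y) (a y) = 0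
      rw [map_smul, LinearMap.smul_apply, hω, smul_zero]
    · intro z hz
      obtain ⟨s, rfl⟩ := Submodule.mem_span_singleton.1 hz
      show ω (s • a y) w₂ = 0
      rw [map_smul, LinearMap.smul_apply, ha.1, LinearMap.mem_ker.1 hw₂, map_zero, neg_zero,
        smul_zero]
    · rw [finrank_sup_span hw₂', finrank_span_singleton hw₁0]

/-- An element of a flag nilradical that kills the first two basis vectors and whose powers vanish
as late as possible. -/
lemma exists_subregular (hω : ω.IsAlt)
    (hV : Module.finrank ℂ V = 2 * n) (hn : 2 ≤ n) {e : Fin (2 * n) → V} (he : IsSympBasis ω e)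
    {F : IsotropicFlag ω n} (heF : IsAdapted e F) :
    ∃ c ∈ endSp ω, Shifts c F ∧ c (e ⟨0, by omega⟩) = 0 ∧ c (e ⟨1, by omega⟩) = 0 ∧
      c ^ (2 * (n - 2)) ≠ 0 := by
  -- Dropping the two end entries of the antidiagonal gives a chain from `e (2 * n - 2)` down to `e
  -- 1`, with `e 0`, `e 1` and the last vector killed.
  let z : Fin (2 * n) → Fin (2 * n) → ℂ := fun i j =>
    if (i : ℕ) + j = 2 * n - 2 ∧ 1 ≤ (i : ℕ) ∧ 1 ≤ (j : ℕ) then 1 else 0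
  have hz : ∀ i j, z i j = z j i := fun i j => by
    simp only [z, add_comm (i : ℕ), and_comm (a := 1 ≤ (i : ℕ))]
  set c := ofCoord ω e z with hc
  have hcoord : ∀ i k, ω (e i.rev) (c (e k)) = z i k.rev := fun i k => by
    rw [← he.coord_ofCoord hz i k.rev, Fin.rev_rev]
  have hzero : ∀ k : Fin (2 * n), (k : ℕ) ≤ 1 → c (e k) = 0 := by
    intro k hk
    refine he.eq_zero_of hV fun j => ?_
    rw [← Fin.rev_rev j, hcoord]
    refine if_neg ?_
    simp only [Fin.val_rev]
    omega
  have hstep : ∀ k l : Fin (2 * n), (k : ℕ) = l + 1 → 1 ≤ (l : ℕ) → (k : ℕ) ≤ 2 * n - 2 →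
      c (e k) = sg n l.rev • e l := by
    intro k l hkl hl hk
    rw [he.expand' hV (c (e k)), Finset.sum_eq_single l]
    · rw [hcoord]
      have : z l k.rev = 1 := by
        refine if_pos ?_
        simp only [Fin.val_rev]
        omega
      rw [this, mul_one]
    · intro j _ hj
      rw [hcoord]
      have : z j k.rev = 0 := by
        refine if_neg ?_
        have : (j : ℕ) ≠ l := fun h => hj (Fin.ext h)
        simp only [Fin.val_rev]
        omega
      rw [this, mul_zero, zero_smul]
    · simp
  have hpow : ∀ m : ℕ, ∀ k l : Fin (2 * n), (k : ℕ) = l + m → 1 ≤ (l : ℕ) → (k : ℕ) ≤ 2 * n - 2 →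
      ∃ s : ℂ, s ≠ 0 ∧ (c ^ m) (e k) = s • e l := by
    intro m
    induction m with
    | zero =>
      intro k l hkl _ _
      obtain rfl : k = l := Fin.ext hkl
      exact ⟨1, one_ne_zero, by simp⟩
    | succ m ih =>
      intro k l hkl hl hk
      obtain ⟨s, hs, hs'⟩ := ih k ⟨l + 1, by omega⟩ (by simp only; omega) (by simp) hk
      refine ⟨s * sg n l.rev, mul_ne_zero hs (sg_ne_zero _), ?_⟩
      rw [pow_succ', Module.End.mul_apply, hs', map_smul, hstep _ l rfl hl (by simp only; omega),
        smul_smul]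
  refine ⟨c, ofCoord_mem hω _ _, (he.shifts_iff hV heF).2 fun i j hij => ?_, hzero _ (by simp),
    hzero _ (by simp), fun h0 => ?_⟩
  · rw [hc, he.coord_ofCoord hz]
    refine if_neg ?_
    omega
  · obtain ⟨s, hs, hs'⟩ := hpow (2 * (n - 2)) ⟨2 * n - 2, by omega⟩ ⟨2, by omega⟩
      (by simp only; omega) (by simp) (by simp)
    rw [h0, LinearMap.zero_apply] at hs'
    have := he.linearIndependent.ne_zero ⟨2, by omega⟩
    exact smul_ne_zero hs this hs'.symm

/-- From a singular point one can move to a generic singular point. -/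
lemma exists_generic_singular (hω : ω.IsAlt) (hnd : ω.Nondegenerate)
    (hV : Module.finrank ℂ V = 2 * n) (hn : 1 ≤ n) {f : Fin n → Module.End ℂ V → ℂ}
    (hf : ∀ i, f i ∈ polyFun (Module.End ℂ V)) {a : Module.End ℂ V} (ha : a ∈ nilCone ω n)
    (ha' : a ^ (2 * n - 1) = 0)
    (hli : LinearIndependent ℂ fun i => (polyDiff (f i) a) ∘ₗ (endSp ω).subtype) :
    ∃ b ∈ nilCone ω n, (∃ w : Fin 2 → V, LinearIndependent ℂ w ∧ ∀ i, b (w i) = 0) ∧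
      b ^ (2 * (n - 2)) ≠ 0 ∧
      LinearIndependent ℂ fun i => (polyDiff (f i) b) ∘ₗ (endSp ω).subtype := by
  rcases Nat.lt_or_ge n 2 with h2 | h2
  · obtain rfl : n = 1 := by omega
    obtain ⟨e, he⟩ := exists_isSympBasis' hω hnd hV
    have ha0 : a = 0 := by simpa using ha'
    refine ⟨a, ha, ⟨e, he.linearIndependent, fun i => by rw [ha0]; rfl⟩, ?_, hli⟩
    rw [show 2 * (1 - 2) = 0 by rfl, pow_zero]
    intro h1
    have : Subsingleton V := ⟨fun x y => by
      rw [← Module.End.one_apply (R := ℂ) x, ← Module.End.one_apply (R := ℂ) y, h1]; rfl⟩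
    rw [Module.finrank_zero_of_subsingleton] at hV
    omega
  -- The flag is chosen through an isotropic plane of the kernel, so that the whole line from `a` to
  -- the subregular element kills this plane.
  · obtain ⟨U, hU, hUi, hUd⟩ := exists_isotropic_plane hω hnd hV h2 ha ha'
    obtain ⟨F, haF, hFU⟩ := exists_shifts hω hnd hV ha hUi hU
    obtain ⟨e, he, heF⟩ := exists_adapted_isSympBasis hω hnd hV F
    have hFU' : F.space ⟨2, by omega⟩ ≤ U := by
      rcases hFU ⟨2, by omega⟩ h2 with h | h
      · exact h
      · exact (Submodule.eq_of_le_of_finrank_eq h (by rw [hUd, F.finrank_space])).ge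
    obtain ⟨c, hc, hcF, hc0, hc1, hcp⟩ := exists_subregular hω hV h2 he heF
    have hev := eventually_linearIndependent
      (M := fun t i => (polyDiff (f i) (a + (t : ℂ) • (c - a))) ∘ₗ (endSp ω).subtype)
      (fun i x => (isPolyMap_line a (c - a)).comp_mem (polyDiff_mem (hf i) x))
      (t₀ := 0) (by simpa using hli)
    obtain ⟨t, ht1, ht2⟩ := (hev.and (eventually_pow_ne_zero (a := a) hcp)).exists
    refine ⟨a + t • (c - a), ⟨(endSp ω).add_mem ha.1 ((endSp ω).smul_mem _
      ((endSp ω).sub_mem hc ha.1)), (haF.line hcF t).pow_eq_zero hV⟩,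
      ⟨fun i => e ⟨i, by omega⟩, ?_, fun i => ?_⟩, ht2, ht1⟩
    · exact he.linearIndependent.comp (fun i : Fin 2 => (⟨i, by omega⟩ : Fin (2 * n)))
        fun i j h => Fin.ext (by simpa using h)
    · have h3 : a (e ⟨i, by omega⟩) = 0 := hU (hFU' (heF.mem (by
        rw [Fin.lt_def]; simp only [Fin.val_castSucc]; exact i.2)))
      have h4 : c (e ⟨i, by omega⟩) = 0 := by
        fin_cases i
        · exact hc0
        · exact hc1
      simp only [LinearMap.add_apply, LinearMap.smul_apply, LinearMap.sub_apply, h3, h4, sub_zero,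
        smul_zero, add_zero]

lemma finrank_tangentSpace_ne (hω : ω.IsAlt) (hnd : ω.Nondegenerate)
    (hV : Module.finrank ℂ V = 2 * n) (hn : 1 ≤ n) {a : Module.End ℂ V} (ha : a ∈ nilCone ω n)
    (ha' : a ^ (2 * n - 1) = 0) :
    Module.finrank ℂ (tangentSpace (nilCone ω n) a) ≠ 2 * n ^ 2 := by
  intro hdim
  obtain ⟨f, hf, hf', hli⟩ := exists_equations hω hnd hV hdim
  obtain ⟨b, hb, ⟨w, hw, hbw⟩, hbp, hlib⟩ := exists_generic_singular hω hnd hV hn hf ha ha' hli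
  set D := Submodule.span ℂ (Set.range fun i => (polyDiff (f i) b) ∘ₗ (endSp ω).subtype) with hD
  have hDdim : Module.finrank ℂ D = n := by
    rw [hD, finrank_span_eq_card hlib, Fintype.card_fin]
  have hpow : ∀ k : ℕ, (trDual V (b ^ (2 * k + 1))) ∘ₗ (endSp ω).subtype ∈ D := by
    intro k
    obtain ⟨F, hbF, -⟩ := exists_shifts hω hnd hV hb (U := ⊥) bot_le bot_le
    refine mem_span_of_commutator hω hnd hV hn hf hf' (F := F)
      (Y := fun b => trDual V (b ^ (2 * k + 1))) (fun X => ?_) (fun b _ _ X _ => ?_) hb.1 hbF hlib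
    · exact isPolyMap_iff_mem.1 ((isPolyMap_linear (LinearMap.trace ℂ V)).comp
        ((isPolyMap_id.pow _).mul (isPolyMap_const X)))
    · rw [trDual_apply, mul_sub, map_sub, ← mul_assoc, LinearMap.trace_mul_comm, ← mul_assoc,
        ← mul_assoc, ← pow_succ, ← pow_succ', sub_self]
  have hsq : ∀ v, b v = 0 → (trDual V (symEnd ω v v)) ∘ₗ (endSp ω).subtype ∈ D := by
    intro v hbv
    -- Every element that shifts a flag with `v` in its first line kills `v`, so its products with
    -- the square of `v` vanish in both orders.
    obtain ⟨F, hbF, hFv⟩ := exists_shifts hω hnd hV hb (U := Submodule.span ℂ {v})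
      (by
        rw [Submodule.span_singleton_le_iff_mem]
        intro z hz
        obtain ⟨s, rfl⟩ := Submodule.mem_span_singleton.1 hz
        show ω (s • v) v = 0
        rw [map_smul, LinearMap.smul_apply, hω, smul_zero])
      (by rw [Submodule.span_singleton_le_iff_mem]; exact hbv)
    have hv1 : v ∈ F.space ⟨1, by omega⟩ := by
      rcases hFv ⟨1, by omega⟩ hn with h | h
      · have : F.space ⟨1, by omega⟩ = Submodule.span ℂ {v} := by
          refine Submodule.eq_of_le_of_finrank_le h ?_
          rw [F.finrank_space]
          simpa using finrank_span_le_card (R := ℂ) ({v} : Set V)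
        rw [this]
        exact Submodule.mem_span_singleton_self v
      · exact h (Submodule.mem_span_singleton_self v)
    refine mem_span_of_commutator hω hnd hV hn hf hf' (F := F)
      (Y := fun _ => trDual V (symEnd ω v v)) (fun X => const_mem_polyFun _) (fun b hb hbF X _ => ?_)
      hb.1 hbF hlib
    have hbv : b v = 0 := by
      have := hbF.space_le _ hv1
      simpa using this
    have h1 : b * symEnd ω v v = 0 := by
      ext x
      simp [symEnd_apply, hbv]
    have h2 : symEnd ω v v * b = 0 := by
      ext x
      have : ω v (b x) = 0 := by rw [← neg_eq_zero, ← hb, hbv, map_zero, LinearMap.zero_apply]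
      simp [symEnd_apply, this]
    rw [trDual_apply, mul_sub, map_sub, ← mul_assoc, LinearMap.trace_mul_comm, ← mul_assoc, h1,
      ← mul_assoc, h2, zero_mul, sub_self]
  -- The squares of these three vectors span the symmetric square of the plane.
  let sq : Fin 3 → V := ![w 0, w 1, w 0 + w 1]
  have hbsq : ∀ j, b (sq j) = 0 := by
    intro j
    fin_cases j <;> simp [sq, hbw]
  let B : Fin (n - 2) ⊕ Fin 3 → Module.End ℂ V :=
    Sum.elim (fun k => b ^ (2 * (k : ℕ) + 1)) fun j => symEnd ω (sq j) (sq j)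
  have hBsp : ∀ s, B s ∈ endSp ω := by
    rintro (k | j)
    · exact endSp_pow_odd hb.1 ⟨k, rfl⟩
    · exact symEnd_mem hω _ _
  have hBli : LinearIndependent ℂ B := by
    rw [Fintype.linearIndependent_iff]
    intro α hα
    rw [Fintype.sum_sum_type] at hα
    simp only [B, Sum.elim_inl, Sum.elim_inr] at hα
    -- Multiplying by `b` kills the squares and raises the odd powers to exponents at most `2 * (n -
    -- 2)`, where powers of `b` are still nonzero.
    have h1 : ∀ k, α (Sum.inl k) = 0 := by
      refine pow_sum_eq_zero hb.2 (e := fun k : Fin (n - 2) => 2 * (k : ℕ) + 2)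
        (fun i j hij => by have : (i : ℕ) < j := hij; simp only; omega) (fun k h0 => hbp ?_) ?_
      · rw [← Nat.sub_add_cancel (show 2 * (k : ℕ) + 2 ≤ 2 * (n - 2) by omega), pow_add, h0, mul_zero]
      · have h2 := congrArg (fun x => b * x) hα
        have h3 : ∀ j, b * symEnd ω (sq j) (sq j) = 0 := fun j => by
          ext x; simp [symEnd_apply, hbsq]
        simp only [mul_add, Finset.mul_sum, mul_smul_comm, h3, smul_zero, Finset.sum_const_zero,
          add_zero, mul_zero, ← pow_succ'] at h2
        exact h2
    have h4 : ∀ x, ∑ j, α (Sum.inr j) • symEnd ω (sq j) (sq j) x = 0 := by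
      intro x
      simp only [h1, zero_smul, Finset.sum_const_zero, zero_add] at hα
      have := congrArg (fun T : Module.End ℂ V => T x) hα
      simpa [LinearMap.sum_apply] using this
    have h5 : ∀ x, ω (α (Sum.inr 0) • w 0 + α (Sum.inr 2) • (w 0 + w 1)) x = 0 ∧
        ω (α (Sum.inr 1) • w 1 + α (Sum.inr 2) • (w 0 + w 1)) x = 0 := by
      intro x
      have h6 := h4 x
      simp only [Fin.sum_univ_three, sq, symEnd_apply, Matrix.cons_val_zero, Matrix.cons_val_one,
        Matrix.cons_val] at h6
      have h7 : (2 * ω (α (Sum.inr 0) • w 0 + α (Sum.inr 2) • (w 0 + w 1)) x) • w 0 +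
          (2 * ω (α (Sum.inr 1) • w 1 + α (Sum.inr 2) • (w 0 + w 1)) x) • w 1 = 0 := by
        rw [← h6]
        simp only [map_add, map_smul, LinearMap.add_apply, LinearMap.smul_apply, smul_eq_mul]
        module
      have h8 := (LinearIndependent.pair_iff.1 (by
        convert! hw using 1
        ext i; fin_cases i <;> rfl : LinearIndependent ℂ ![w 0, w 1])) _ _ h7
      exact ⟨by simpa using h8.1, by simpa using h8.2⟩
    have h9 := hnd.1 _ fun x => (h5 x).1
    have h10 := hnd.1 _ fun x => (h5 x).2
    have hpair := LinearIndependent.pair_iff.1 (by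
        convert! hw using 1
        ext i; fin_cases i <;> rfl : LinearIndependent ℂ ![w 0, w 1])
    have h11 := hpair (α (Sum.inr 0) + α (Sum.inr 2)) (α (Sum.inr 2)) (by rw [← h9]; module)
    have h12 := hpair (α (Sum.inr 2)) (α (Sum.inr 1) + α (Sum.inr 2)) (by rw [← h10]; module)
    rintro (k | j)
    · exact h1 k
    · have h13 := h11.2
      have h14 := h11.1
      have h15 := h12.2
      rw [h13, add_zero] at h14 h15
      fin_cases j
      · exact h14
      · exact h15
      · exact h13
  have hli3 := linearIndependent_trDual hω hnd hBsp hBli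
  let B' : Fin (n - 2) ⊕ Fin 3 → D := fun s => ⟨(trDual V (B s)) ∘ₗ (endSp ω).subtype, by
    rcases s with k | j
    · exact hpow k
    · exact hsq _ (hbsq j)⟩
  have hB' : LinearIndependent ℂ B' := LinearIndependent.of_comp D.subtype hli3
  -- `(n - 2) + 3` exceeds `n`, also for `n = 1`, where the subtraction truncates.
  have := hB'.fintype_card_le_finrank
  rw [hDdim, Fintype.card_sum, Fintype.card_fin, Fintype.card_fin] at this
  omega

lemma mem_smoothLocus_nilCone_iff (hω : ω.IsAlt) (hnd : ω.Nondegenerate)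
    (hV : Module.finrank ℂ V = 2 * n) (hn : 1 ≤ n) {a : Module.End ℂ V} (ha : a ∈ nilCone ω n) :
    a ∈ smoothLocus (nilCone ω n) ↔ a ^ (2 * n - 1) ≠ 0 := by
  rw [mem_smoothLocus_iff ⟨a, ha⟩, height_pointIdeal_nilCone hω hnd hV hn, Nat.cast_inj]
  constructor
  · intro h h0
    exact finrank_tangentSpace_ne hω hnd hV hn ha h0 h
  · exact fun h => finrank_tangentSpace_regular hω hnd hV ha.1 ha.2 h

end Singular

end SympCone

namespace SympCone

/-! ### Regular functions, morphisms and products of varieties. -/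

namespace AlgSpace

variable {α β γ : Type*}

lemma isOpen_of_forall (T : TopologicalSpace α) {U : Set α}
    (h : ∀ x ∈ U, ∃ O, T.IsOpen O ∧ x ∈ O ∧ O ⊆ U) : T.IsOpen U := by
  refine isOpen_iff_forall_mem_open.2 fun x hx => ?_
  obtain ⟨O, hO, hxO, hOU⟩ := h x hx
  exact ⟨O, hOU, hO, hxO⟩

lemma isOpen_induced {T : TopologicalSpace β} {f : α → β} {U : Set α} :
    (TopologicalSpace.induced f T).IsOpen U ↔ ∃ O, T.IsOpen O ∧ f ⁻¹' O = U := Iff.rfl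

lemma isOpen_preimage {T : TopologicalSpace α} {T' : TopologicalSpace β} {f : α → β}
    (hf : @Continuous _ _ T T' f) {U : Set β} (hU : T'.IsOpen U) : T.IsOpen (f ⁻¹' U) :=
  continuous_def.1 hf U hU

/-- The regular functions at each point form an algebra. -/
structure IsAlg (X : AlgSpace α) : Prop where
  const : ∀ c x, X.RegularAt (fun _ => c) x
  add : ∀ {f g x}, X.RegularAt f x → X.RegularAt g x → X.RegularAt (fun y => f y + g y) x
  mul : ∀ {f g x}, X.RegularAt f x → X.RegularAt g x → X.RegularAt (fun y => f y * g y) x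

/-- Regularity is a local notion, and non-vanishing regular functions are invertible. -/
structure IsLocal (X : AlgSpace α) : Prop extends IsAlg X where
  inv : ∀ {f x}, X.RegularAt f x → f x ≠ 0 → X.RegularAt (fun y => (f y)⁻¹) x
  congr : ∀ {f g x U}, X.RegularAt f x → X.top.IsOpen U → x ∈ U → (∀ y ∈ U, f y = g y) →
    X.RegularAt g x
  exists_ne : ∀ {f x}, X.RegularAt f x → f x ≠ 0 → ∃ U, X.top.IsOpen U ∧ x ∈ U ∧ ∀ y ∈ U, f y ≠ 0

lemma IsAlg.sum {X : AlgSpace α} (hX : X.IsAlg) {ι : Type*} (s : Finset ι) {f : ι → α → ℂ} {x : α}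
    (hf : ∀ i ∈ s, X.RegularAt (f i) x) : X.RegularAt (fun y => ∑ i ∈ s, f i y) x := by
  classical
  induction s using Finset.induction_on with
  | empty => simpa using hX.const 0 x
  | insert i s hi ih =>
    simp only [Finset.sum_insert hi]
    exact hX.add (hf i (Finset.mem_insert_self _ _))
      (ih fun j hj => hf j (Finset.mem_insert_of_mem hj))

lemma IsAlg.polyFun_comp {X : AlgSpace α} (hX : X.IsAlg) {W : Type*} [AddCommGroup W] [Module ℂ W]
    {φ : α → W} {x : α} (hφ : ∀ l : Module.Dual ℂ W, X.RegularAt (fun y => l (φ y)) x)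
    {p : W → ℂ} (hp : p ∈ polyFun W) : X.RegularAt (fun y => p (φ y)) x := by
  induction hp using Algebra.adjoin_induction with
  | mem q hq => obtain ⟨l, rfl⟩ := hq; exact hφ l
  | algebraMap r => exact hX.const r x
  | add p q _ _ hp hq => exact hX.add hp hq
  | mul p q _ _ hp hq => exact hX.mul hp hq

lemma IsAlg.dual_comp {X : AlgSpace α} (hX : X.IsAlg) {ι : Type*} [Fintype ι]
    {φ : α → ι → ℂ} {x : α} (hφ : ∀ i, X.RegularAt (fun y => φ y i) x)
    (l : Module.Dual ℂ (ι → ℂ)) : X.RegularAt (fun y => l (φ y)) x := by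
  classical
  simp only [LinearMap.pi_apply_eq_sum_univ l (φ _), smul_eq_mul]
  exact hX.sum _ fun i _ => hX.mul (hφ i) (hX.const _ _)

section QuasiAffine

variable {W : Type*} [AddCommGroup W] [Module ℂ W] {S : Set W}

lemma regularAt_polyFun {p : W → ℂ} (hp : p ∈ polyFun W) (s : S) :
    (quasiAffine S).RegularAt (fun t => p t) s :=
  ⟨p, hp, 1, (polyFun W).one_mem, one_ne_zero, fun t _ => by simp⟩

lemma isOpen_quasiAffine {p : W → ℂ} (hp : p ∈ polyFun W) :
    (quasiAffine S).top.IsOpen {t : S | p t ≠ 0} :=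
  isOpen_induced.2 ⟨_, zariski_isOpen_ne hp, rfl⟩

lemma exists_polyFun_of_isOpen {U : Set S} (hU : (quasiAffine S).top.IsOpen U) {s : S} (hs : s ∈ U) :
    ∃ p ∈ polyFun W, p s ≠ 0 ∧ ∀ t : S, p t ≠ 0 → t ∈ U := by
  obtain ⟨O, hO, rfl⟩ := isOpen_induced.1 hU
  obtain ⟨p, hp, hps, hpO⟩ := zariski_exists_of_mem hO hs
  exact ⟨p, hp, hps, fun t ht => hpO ht⟩

lemma quasiAffine_isLocal (S : Set W) : (quasiAffine S).IsLocal where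
  const c x := regularAt_polyFun (const_mem_polyFun c) x
  add := by
    rintro f g x ⟨p, hp, q, hq, hqx, h⟩ ⟨p', hp', q', hq', hqx', h'⟩
    refine ⟨p * q' + p' * q, (polyFun W).add_mem ((polyFun W).mul_mem hp hq')
      ((polyFun W).mul_mem hp' hq), q * q', (polyFun W).mul_mem hq hq', mul_ne_zero hqx hqx',
      fun t ht => ?_⟩
    have h1 : q t ≠ 0 := left_ne_zero_of_mul ht
    have h2 : q' t ≠ 0 := right_ne_zero_of_mul ht
    simp only [h t h1, h' t h2, Pi.add_apply, Pi.mul_apply]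
    field_simp
  mul := by
    rintro f g x ⟨p, hp, q, hq, hqx, h⟩ ⟨p', hp', q', hq', hqx', h'⟩
    refine ⟨p * p', (polyFun W).mul_mem hp hp', q * q', (polyFun W).mul_mem hq hq',
      mul_ne_zero hqx hqx', fun t ht => ?_⟩
    simp only [h t (left_ne_zero_of_mul ht), h' t (right_ne_zero_of_mul ht), Pi.mul_apply]
    rw [div_mul_div_comm]
  inv := by
    rintro f x ⟨p, hp, q, hq, hqx, h⟩ hfx
    refine ⟨q * q, (polyFun W).mul_mem hq hq, p * q, (polyFun W).mul_mem hp hq, ?_, fun t ht => ?_⟩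
    · refine mul_ne_zero (fun h0 => hfx ?_) hqx
      rw [h x hqx, h0, zero_div]
    · have h2 : q t ≠ 0 := right_ne_zero_of_mul ht
      simp only [Pi.mul_apply]
      rw [h t h2, inv_div, mul_div_mul_right _ _ h2]
  congr := by
    rintro f g x U ⟨p, hp, q, hq, hqx, h⟩ hU hxU hfg
    -- The quotient formula has to hold wherever the denominator is nonzero; multiplying numerator
    -- and denominator by `r` confines it to `U`.
    obtain ⟨r, hr, hrx, hrU⟩ := exists_polyFun_of_isOpen hU hxU
    refine ⟨p * r, (polyFun W).mul_mem hp hr, q * r, (polyFun W).mul_mem hq hr,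
      mul_ne_zero hqx hrx, fun t ht => ?_⟩
    have h2 : r t ≠ 0 := right_ne_zero_of_mul ht
    rw [← hfg t (hrU t h2), h t (left_ne_zero_of_mul ht)]
    simp only [Pi.mul_apply]
    rw [mul_div_mul_right _ _ h2]
  exists_ne := by
    rintro f x ⟨p, hp, q, hq, hqx, h⟩ hfx
    refine ⟨_, isOpen_quasiAffine ((polyFun W).mul_mem hp hq), ?_, fun t ht => ?_⟩
    · refine mul_ne_zero (fun h0 => hfx ?_) hqx
      rw [h x hqx, h0, zero_div]
    · have h2 : q t ≠ 0 := right_ne_zero_of_mul ht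
      rw [h t h2]
      exact div_ne_zero (left_ne_zero_of_mul ht) h2

end QuasiAffine

section Constructions

/-- The algebra structure is enough for the flag variety, which occurs only as a target of morphisms
and as a factor of a product carrying tensors. -/
lemma quotient_isAlg {X : AlgSpace α} (hX : X.IsAlg) (q : α → β) : (X.quotient q).IsAlg where
  const c _ := fun x _ => hX.const c x
  add := fun hf hg x hx => hX.add (hf x hx) (hg x hx)
  mul := fun hf hg x hx => hX.mul (hf x hx) (hg x hx)

lemma RegularAt.restrict {X : AlgSpace α} {T : Set α} {f : α → ℂ} {t : T} (h : X.RegularAt f t) :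
    (X.restrict T).RegularAt (fun s => f s) t :=
  ⟨f, h, Set.univ, X.top.isOpen_univ, trivial, fun _ _ => rfl⟩

lemma restrict_isAlg {X : AlgSpace α} (hX : X.IsAlg) (T : Set α) : (X.restrict T).IsAlg where
  const c t := RegularAt.restrict (hX.const c t.1)
  add := by
    rintro f g x ⟨f', hf', U, hU, hxU, hfU⟩ ⟨g', hg', U', hU', hxU', hgU⟩
    exact ⟨_, hX.add hf' hg', U ∩ U', X.top.isOpen_inter _ _ hU hU', ⟨hxU, hxU'⟩,
      fun s hs => by simp only [hfU s hs.1, hgU s hs.2]⟩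
  mul := by
    rintro f g x ⟨f', hf', U, hU, hxU, hfU⟩ ⟨g', hg', U', hU', hxU', hgU⟩
    exact ⟨_, hX.mul hf' hg', U ∩ U', X.top.isOpen_inter _ _ hU hU', ⟨hxU, hxU'⟩,
      fun s hs => by simp only [hfU s hs.1, hgU s hs.2]⟩

lemma isOpen_restrict {X : AlgSpace α} {T : Set α} {U : Set α} (hU : X.top.IsOpen U) :
    (X.restrict T).top.IsOpen {t : T | (t : α) ∈ U} :=
  isOpen_induced.2 ⟨U, hU, rfl⟩

lemma restrict_isLocal {X : AlgSpace α} (hX : X.IsLocal) (T : Set α) : (X.restrict T).IsLocal where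
  toIsAlg := restrict_isAlg hX.toIsAlg T
  inv := by
    rintro f x ⟨g, hg, U, hU, hxU, hgU⟩ hfx
    exact ⟨_, hX.inv hg (by rwa [← hgU x hxU]), U, hU, hxU, fun s hs => by simp only [hgU s hs]⟩
  congr := by
    rintro f f' x U' ⟨g, hg, U, hU, hxU, hgU⟩ hU' hxU' hff'
    obtain ⟨O, hO, rfl⟩ := isOpen_induced.1 hU'
    exact ⟨g, hg, U ∩ O, X.top.isOpen_inter _ _ hU hO, ⟨hxU, hxU'⟩,
      fun s hs => by rw [← hff' s hs.2, hgU s hs.1]⟩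
  exists_ne := by
    rintro f x ⟨g, hg, U, hU, hxU, hgU⟩ hfx
    obtain ⟨O, hO, hxO, hgO⟩ := hX.exists_ne hg (by rwa [← hgU x hxU])
    refine ⟨_, isOpen_restrict (X.top.isOpen_inter _ _ hU hO), ⟨hxU, hxO⟩, fun y hy => ?_⟩
    rw [hgU y hy.1]
    exact hgO y hy.2

lemma isTensorOn_of_fintype {X : AlgSpace α} {Y : AlgSpace β} {U : Set α} {V : Set β} {ι : Type*}
    [Fintype ι] {a : ι → α → ℂ} {b : ι → β → ℂ} (ha : ∀ i, ∀ x ∈ U, X.RegularAt (a i) x)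
    (hb : ∀ i, ∀ y ∈ V, Y.RegularAt (b i) y) {h : α × β → ℂ}
    (hh : ∀ x ∈ U, ∀ y ∈ V, h (x, y) = ∑ i, a i x * b i y) : IsTensorOn X Y U V h := by
  refine ⟨Fintype.card ι, fun k => a ((Fintype.equivFin ι).symm k),
    fun k => b ((Fintype.equivFin ι).symm k), fun _ => ha _, fun _ => hb _, fun x hx y hy => ?_⟩
  rw [hh x hx y hy]
  exact ((Fintype.equivFin ι).symm.sum_comp fun i => a i x * b i y).symm

section Tensor

variable {X : AlgSpace α} {Y : AlgSpace β} (hX : X.IsAlg) (hY : Y.IsAlg) {U : Set α} {V : Set β}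

include hY in
lemma isTensorOn_fst {a : α → ℂ} (ha : ∀ x ∈ U, X.RegularAt a x) :
    IsTensorOn X Y U V fun p => a p.1 :=
  ⟨1, fun _ => a, fun _ _ => 1, fun _ => ha, fun _ y _ => hY.const 1 y, fun x _ y _ => by simp⟩

include hX in
lemma isTensorOn_snd {b : β → ℂ} (hb : ∀ y ∈ V, Y.RegularAt b y) :
    IsTensorOn X Y U V fun p => b p.2 :=
  ⟨1, fun _ _ => 1, fun _ => b, fun _ x _ => hX.const 1 x, fun _ => hb, fun x _ y _ => by simp⟩

lemma IsTensorOn.add {g h : α × β → ℂ} (hg : IsTensorOn X Y U V g) (hh : IsTensorOn X Y U V h) :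
    IsTensorOn X Y U V fun p => g p + h p := by
  obtain ⟨m, a, b, ha, hb, hab⟩ := hg
  obtain ⟨m', a', b', ha', hb', hab'⟩ := hh
  refine isTensorOn_of_fintype (ι := Fin m ⊕ Fin m') (a := Sum.elim a a') (b := Sum.elim b b')
    (Sum.rec ha ha') (Sum.rec hb hb') fun x hx y hy => ?_
  rw [Fintype.sum_sum_type, hab x hx y hy, hab' x hx y hy]
  rfl

include hX hY in
lemma IsTensorOn.mul {g h : α × β → ℂ} (hg : IsTensorOn X Y U V g) (hh : IsTensorOn X Y U V h) :
    IsTensorOn X Y U V fun p => g p * h p := by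
  obtain ⟨m, a, b, ha, hb, hab⟩ := hg
  obtain ⟨m', a', b', ha', hb', hab'⟩ := hh
  refine isTensorOn_of_fintype (ι := Fin m × Fin m') (a := fun k x => a k.1 x * a' k.2 x)
    (b := fun k y => b k.1 y * b' k.2 y) (fun k x hx => hX.mul (ha _ x hx) (ha' _ x hx))
    (fun k y hy => hY.mul (hb _ y hy) (hb' _ y hy)) fun x hx y hy => ?_
  rw [Fintype.sum_prod_type, hab x hx y hy, hab' x hx y hy, Finset.sum_mul_sum]
  refine Finset.sum_congr rfl fun i _ => Finset.sum_congr rfl fun j _ => ?_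
  ring

include hX hY in
lemma IsTensorOn.sum {ι : Type*} (s : Finset ι) {h : ι → α × β → ℂ}
    (hh : ∀ i ∈ s, IsTensorOn X Y U V (h i)) : IsTensorOn X Y U V fun p => ∑ i ∈ s, h i p := by
  classical
  induction s using Finset.induction_on with
  | empty => simpa using isTensorOn_fst (V := V) (U := U) (X := X) hY fun x _ => hX.const 0 x
  | insert i s hi ih =>
    simp only [Finset.sum_insert hi]
    exact (hh i (Finset.mem_insert_self _ _)).add
      (ih fun j hj => hh j (Finset.mem_insert_of_mem hj))

include hX hY in
lemma isTensorOn_polyFun {W : Type*} [AddCommGroup W] [Module ℂ W] {Φ : α × β → W}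
    (hΦ : ∀ l : Module.Dual ℂ W, IsTensorOn X Y U V fun p => l (Φ p))
    {p : W → ℂ} (hp : p ∈ polyFun W) : IsTensorOn X Y U V fun q => p (Φ q) := by
  induction hp using Algebra.adjoin_induction with
  | mem q hq => obtain ⟨l, rfl⟩ := hq; exact hΦ l
  | algebraMap r => exact isTensorOn_fst hY fun x _ => hX.const r x
  | add p q _ _ hp hq => exact hp.add hq
  | mul p q _ _ hp hq => exact hp.mul hX hY hq

end Tensor

end Constructions

section Morphisms

lemma IsMorphism.restrict {X : AlgSpace α} {Y : AlgSpace β} {φ : α → β} (h : IsMorphism X Y φ)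
    (U : Set β) : IsMorphism (X.restrict (φ ⁻¹' U)) (Y.restrict U) fun x => ⟨φ x, x.2⟩ := by
  refine ⟨?_, ?_⟩
  · refine continuous_def.2 fun O hO => ?_
    obtain ⟨O', hO', rfl⟩ := isOpen_induced.1 hO
    exact isOpen_restrict (isOpen_preimage h.1 hO')
  · rintro x g ⟨g', hg', O, hO, hxO, hgO⟩
    exact ⟨_, h.2 _ _ hg', _, isOpen_preimage h.1 hO, hxO, fun s hs => hgO _ hs⟩

/-- Morphisms into a quasi-affine variety are given by regular coordinate functions. -/
lemma isMorphism_quasiAffine {X : AlgSpace α} (hX : X.IsLocal) {W : Type*} [AddCommGroup W]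
    [Module ℂ W] {S : Set W} {φ : α → S}
    (hφ : ∀ (l : Module.Dual ℂ W) x, X.RegularAt (fun y => l (φ y)) x) :
    IsMorphism X (quasiAffine S) φ := by
  refine ⟨?_, ?_⟩
  · refine continuous_def.2 fun O hO => isOpen_of_forall _ fun x hx => ?_
    obtain ⟨p, hp, hpx, hpO⟩ := exists_polyFun_of_isOpen hO hx
    obtain ⟨U, hU, hxU, hpU⟩ := hX.exists_ne (hX.polyFun_comp (φ := fun y => (φ y : W))
      (fun l => hφ l x) hp) hpx
    exact ⟨U, hU, hxU, fun y hy => hpO _ (hpU y hy)⟩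
  · rintro x g ⟨p, hp, q, hq, hqx, hg⟩
    have hp' := hX.polyFun_comp (φ := fun y => (φ y : W)) (fun l => hφ l x) hp
    have hq' := hX.polyFun_comp (φ := fun y => (φ y : W)) (fun l => hφ l x) hq
    obtain ⟨U, hU, hxU, hqU⟩ := hX.exists_ne hq' hqx
    exact hX.congr (hX.mul hp' (hX.inv hq' hqx)) hU hxU fun y hy => by
      rw [Function.comp_apply, hg _ (hqU y hy), div_eq_mul_inv]

lemma isMorphism_codRestrict {X : AlgSpace α} (hX : X.IsLocal) {Y : AlgSpace β} {T : Set β}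
    {φ : α → T} (h : IsMorphism X Y fun x => (φ x : β)) : IsMorphism X (Y.restrict T) φ := by
  refine ⟨?_, ?_⟩
  · refine continuous_def.2 fun O hO => ?_
    obtain ⟨O', hO', rfl⟩ := isOpen_induced.1 hO
    exact isOpen_preimage h.1 hO'
  · rintro x g ⟨g', hg', O, hO, hxO, hgO⟩
    exact hX.congr (h.2 _ _ hg') (isOpen_preimage h.1 hO) hxO fun y hy => (hgO _ hy).symm

/-- Pairs of morphisms are morphisms into the product. -/
lemma isMorphism_prodMk {X : AlgSpace α} (hX : X.IsLocal) {Y : AlgSpace β} {Z : AlgSpace γ}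
    {φ : α → β} {ψ : α → γ} (hφ : IsMorphism X Y φ) (hψ : IsMorphism X Z ψ) :
    IsMorphism X (Y.prod Z) fun x => (φ x, ψ x) := by
  have key : ∀ {U V h}, IsTensorOn Y Z U V h → ∃ f : α → ℂ,
      (∀ x, φ x ∈ U → ψ x ∈ V → X.RegularAt f x) ∧
      ∀ x, φ x ∈ U → ψ x ∈ V → h (φ x, ψ x) = f x := by
    rintro U V h ⟨m, a, b, ha, hb, hab⟩
    exact ⟨fun x => ∑ i, a i (φ x) * b i (ψ x), fun x hU hV => hX.sum _ fun i _ =>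
      hX.mul (hφ.2 _ _ (ha i _ hU)) (hψ.2 _ _ (hb i _ hV)), fun x hU hV => hab _ hU _ hV⟩
  refine ⟨?_, ?_⟩
  · refine continuous_generateFrom_iff.2 ?_
    rintro _ ⟨U, V, h, hU, hV, hh, rfl⟩
    obtain ⟨f, hf, hhf⟩ := key hh
    refine isOpen_of_forall _ fun x hx => ?_
    obtain ⟨hxU, hxV, hx0⟩ := hx
    obtain ⟨O, hO, hxO, hfO⟩ := hX.exists_ne (hf x hxU hxV) (by rw [← hhf x hxU hxV]; exact hx0)
    refine ⟨O ∩ (φ ⁻¹' U ∩ ψ ⁻¹' V), X.top.isOpen_inter _ _ hO (X.top.isOpen_inter _ _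
      (isOpen_preimage hφ.1 hU) (isOpen_preimage hψ.1 hV)), ⟨hxO, hxU, hxV⟩, ?_⟩
    rintro y ⟨hyO, hyU, hyV⟩
    refine ⟨hyU, hyV, ?_⟩
    show h (φ y, ψ y) ≠ 0
    rw [hhf y hyU hyV]
    exact hfO y hyO
  · rintro x f ⟨U, V, g, h, hU, hV, hxU, hxV, hg, hh, hx0, hf⟩
    obtain ⟨g', hg', hgg'⟩ := key hg
    obtain ⟨h', hh', hhh'⟩ := key hh
    have hx0' : h' x ≠ 0 := by rw [← hhh' x hxU hxV]; exact hx0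
    obtain ⟨O, hO, hxO, hfO⟩ := hX.exists_ne (hh' x hxU hxV) hx0'
    refine hX.congr (hX.mul (hg' x hxU hxV) (hX.inv (hh' x hxU hxV) hx0'))
      (X.top.isOpen_inter _ _ hO (X.top.isOpen_inter _ _
      (isOpen_preimage hφ.1 hU) (isOpen_preimage hψ.1 hV))) ⟨hxO, hxU, hxV⟩ ?_
    rintro y ⟨hyO, hyU, hyV⟩
    have h1 := hhh' y hyU hyV
    rw [Function.comp_apply, hf (φ y, ψ y) hyU hyV (by rw [h1]; exact hfO y hyO), h1,
      hgg' y hyU hyV, div_eq_mul_inv]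

/-- Maps from a product into a piece of a quasi-affine variety that are given by tensors are
morphisms. -/
lemma isMorphism_of_isTensorOn {X : AlgSpace α} {Y : AlgSpace β} (hX : X.IsAlg) (hY : Y.IsAlg)
    {W : Type*} [AddCommGroup W] [Module ℂ W] {S : Set W} {T : Set S} {Φ : α × β → T}
    (hΦ : ∀ l : Module.Dual ℂ W, IsTensorOn X Y Set.univ Set.univ fun p => l (Φ p).1.1) :
    IsMorphism (X.prod Y) ((quasiAffine S).restrict T) Φ := by
  refine ⟨?_, ?_⟩
  · refine continuous_induced_rng.2 (continuous_induced_rng.2 (continuous_generateFrom_iff.2 ?_))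
    rintro _ ⟨p, hp, rfl⟩
    refine TopologicalSpace.GenerateOpen.basic _ ⟨Set.univ, Set.univ, _, X.top.isOpen_univ,
      Y.top.isOpen_univ, isTensorOn_polyFun hX hY hΦ hp, ?_⟩
    ext z
    simp
  · rintro z f ⟨g, ⟨p, hp, q, hq, hqz, hg⟩, U, hU, hzU, hfU⟩
    obtain ⟨r, hr, hrz, hrU⟩ := exists_polyFun_of_isOpen hU hzU
    refine ⟨Set.univ, Set.univ, _, _, X.top.isOpen_univ, Y.top.isOpen_univ, trivial, trivial,
      isTensorOn_polyFun hX hY hΦ ((polyFun W).mul_mem hp hr),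
      isTensorOn_polyFun hX hY hΦ ((polyFun W).mul_mem hq hr), mul_ne_zero hqz hrz,
      fun w _ _ hw => ?_⟩
    have h2 : r (Φ w).1.1 ≠ 0 := right_ne_zero_of_mul hw
    rw [Function.comp_apply, hfU _ (hrU _ h2), hg _ (left_ne_zero_of_mul hw)]
    simp only [Pi.mul_apply]
    rw [mul_div_mul_right _ _ h2]

end Morphisms

end AlgSpace

end SympCone

namespace SympCone

/-! ### Coordinates on the elements shifting a fixed flag. -/

section TorusCoordinates

/-- The position of the `k`-th coordinate next to the diagonal. -/
def simpleIdx (n : ℕ) (k : Fin n) : CoordIdx n (2 * n - 1) :=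
  ⟨(⟨k, by omega⟩, ⟨2 * n - 2 - k, by omega⟩), by rw [Fin.le_def]; simp only; omega,
    by simp only; omega⟩

/-- The positions of the remaining coordinates. -/
noncomputable def lowerIdx (n : ℕ) (m : Fin (n ^ 2 - n)) : CoordIdx n (2 * n - 1) :=
  ⟨((Fintype.equivFinOfCardEq (card_coordIdx_lower n)).symm m).1,
    ((Fintype.equivFinOfCardEq (card_coordIdx_lower n)).symm m).2.1, by
      have := ((Fintype.equivFinOfCardEq (card_coordIdx_lower n)).symm m).2.2
      omega⟩

/-- The positions with `i + j = 2 * n - 2` are determined by the row `i < n`; all others have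
smaller degree. -/
lemma idx_bijective (n : ℕ) : Function.Bijective (Sum.elim (simpleIdx n) (lowerIdx n)) := by
  have hlow : ∀ m, ((lowerIdx n m).1.1 : ℕ) + (lowerIdx n m).1.2 < 2 * n - 2 := fun m =>
    ((Fintype.equivFinOfCardEq (card_coordIdx_lower n)).symm m).2.2
  have hsim : ∀ k, ((simpleIdx n k).1.1 : ℕ) + (simpleIdx n k).1.2 = 2 * n - 2 := fun k => by
    simp only [simpleIdx]; omega
  constructor
  · refine Function.Injective.sumElim ?_ ?_ ?_
    · intro k k' h
      have := congrArg (fun p : CoordIdx n (2 * n - 1) => (p.1.1 : ℕ)) h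
      exact Fin.ext this
    · intro m m' h
      refine (Fintype.equivFinOfCardEq (card_coordIdx_lower n)).symm.injective (Subtype.ext ?_)
      exact congrArg (fun p : CoordIdx n (2 * n - 1) => p.1) h
    · intro k m h
      have h1 := hsim k
      rw [h] at h1
      have := hlow m
      omega
  · intro p
    have h1 : (p.1.1 : ℕ) ≤ p.1.2 := p.2.1
    have h2 := p.2.2
    rcases Nat.lt_or_ge ((p.1.1 : ℕ) + p.1.2) (2 * n - 2) with h | h
    · refine ⟨Sum.inr (Fintype.equivFinOfCardEq (card_coordIdx_lower n) ⟨p.1, p.2.1, h⟩), ?_⟩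
      exact Subtype.ext (congrArg (fun q : CoordIdx n (2 * n - 2) => q.1)
        ((Fintype.equivFinOfCardEq (card_coordIdx_lower n)).symm_apply_apply ⟨p.1, p.2.1, h⟩))
    · have h3 := p.1.1.2
      refine ⟨Sum.inl ⟨p.1.1, by omega⟩, ?_⟩
      apply Subtype.ext
      refine Prod.ext (Fin.ext rfl) (Fin.ext ?_)
      simp only [Sum.elim_inl, simpleIdx]
      omega

/-- The coordinates of a flag nilradical, with those next to the diagonal first. -/
noncomputable def torusCoord (n : ℕ) :
    (CoordIdx n (2 * n - 1) → ℂ) ≃ₗ[ℂ] (Fin n → ℂ) × (Fin (n ^ 2 - n) → ℂ) :=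
  (LinearEquiv.funCongrLeft ℂ ℂ (Equiv.ofBijective _ (idx_bijective n))).trans
    (LinearEquiv.sumArrowLequivProdArrow _ _ ℂ ℂ)

variable {V : Type*} [AddCommGroup V] [Module ℂ V] {ω : LinearMap.BilinForm ℂ V} {n : ℕ}

/-- The coordinates of an endomorphism in a basis adapted to a flag that it shifts. -/
noncomputable def flagCoord (ω : LinearMap.BilinForm ℂ V) (b : Fin (2 * n) → V)
    (A : Module.End ℂ V) : (Fin n → ℂ) × (Fin (n ^ 2 - n) → ℂ) :=
  torusCoord n fun p => ω (b p.1.1.rev) (A (b p.1.2.rev))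

/-- The endomorphism with given coordinates. -/
noncomputable def flagElem (ω : LinearMap.BilinForm ℂ V) (b : Fin (2 * n) → V)
    (z : (Fin n → ℂ) × (Fin (n ^ 2 - n) → ℂ)) : Module.End ℂ V :=
  ofCoord ω b (symExt ((torusCoord n).symm z))

lemma flagElem_mem (hω : ω.IsAlt) (b : Fin (2 * n) → V) (z) : flagElem ω b z ∈ endSp ω :=
  ofCoord_mem hω _ _

lemma IsSympBasis.coord_flagElem {b : Fin (2 * n) → V} (hb : IsSympBasis ω b) (z)
    (i j : Fin (2 * n)) : ω (b i.rev) (flagElem ω b z (b j.rev)) =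
      symExt ((torusCoord n).symm z) i j := hb.coord_ofCoord (symExt_comm _) i j

lemma IsSympBasis.flagCoord_flagElem {b : Fin (2 * n) → V} (hb : IsSympBasis ω b) (z) :
    flagCoord ω b (flagElem ω b z) = z := by
  unfold flagCoord
  simp only [hb.coord_flagElem, symExt_idx]
  exact (torusCoord n).apply_symm_apply z

lemma isPolyMap_symExt (i j : Fin (2 * n)) :
    (fun z => symExt ((torusCoord n).symm z) i j) ∈
      polyFun ((Fin n → ℂ) × (Fin (n ^ 2 - n) → ℂ)) := by
  unfold symExt
  split_ifs with h
  · exact dual_mem_polyFun (LinearMap.proj _ ∘ₗ (torusCoord n).symm.toLinearMap)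
  · exact const_mem_polyFun 0

lemma isPolyMap_flagElem (b : Fin (2 * n) → V) : IsPolyMap (flagElem ω b) := by
  unfold flagElem ofCoord
  refine IsPolyMap.sum _ fun i _ => IsPolyMap.sum _ fun j _ => IsPolyMap.smul ?_ (isPolyMap_const _)
  exact (polyFun _).mul_mem (const_mem_polyFun _) (isPolyMap_symExt i j)

variable [FiniteDimensional ℂ V]

lemma IsSympBasis.flagElem_flagCoord {b : Fin (2 * n) → V} (hb : IsSympBasis ω b) (hω : ω.IsAlt)
    (hV : Module.finrank ℂ V = 2 * n) {F : IsotropicFlag ω n} (hF : IsAdapted b F)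
    {A : Module.End ℂ V} (hA : A ∈ endSp ω) (hAF : Shifts A F) :
    flagElem ω b (flagCoord ω b A) = A := by
  unfold flagElem flagCoord
  rw [LinearEquiv.symm_apply_apply, symExt_restrict (x := fun i j => ω (b i.rev) (A (b j.rev)))
    (fun _ _ => endSp_pair_comm hω hA _ _) ((hb.shifts_iff hV hF).1 hAF)]
  exact hb.ofCoord_coord hω hV hA

lemma IsSympBasis.shifts_flagElem {b : Fin (2 * n) → V} (hb : IsSympBasis ω b)
    (hV : Module.finrank ℂ V = 2 * n) {F : IsotropicFlag ω n} (hF : IsAdapted b F) (z) :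
    Shifts (flagElem ω b z) F := (hb.shifts_iff hV hF).2 fun i j hij => by
  rw [hb.coord_flagElem, symExt_of_le _ hij]

lemma IsSympBasis.regular_iff_flagCoord {b : Fin (2 * n) → V} (hb : IsSympBasis ω b)
    (hω : ω.IsAlt) (hV : Module.finrank ℂ V = 2 * n) (hn : 1 ≤ n) {F : IsotropicFlag ω n}
    (hF : IsAdapted b F) {A : Module.End ℂ V} (hA : A ∈ endSp ω) (hAF : Shifts A F) :
    A ^ (2 * n - 1) ≠ 0 ↔ flagCoord ω b A ∈ torusTimesAffine n := by
  rw [hb.regular_iff hV hn hF hAF]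
  have h1 : ∀ k, (flagCoord ω b A).1 k =
      ω (b (simpleIdx n k).1.1.rev) (A (b (simpleIdx n k).1.2.rev)) := fun k => rfl
  constructor
  · intro h k
    rw [h1]
    refine h _ _ ?_
    simp only [simpleIdx]
    omega
  · intro h
    have key : ∀ i j : Fin (2 * n), i ≤ j → (i : ℕ) + j = 2 * n - 2 →
        ω (b i.rev) (A (b j.rev)) ≠ 0 := by
      intro i j hij hsum
      have hij' : (i : ℕ) ≤ j := hij
      have h2 := h ⟨i, by omega⟩
      rw [h1] at h2
      have h3 : (simpleIdx n ⟨i, by omega⟩).1 = (i, j) :=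
        Prod.ext (Fin.ext rfl) (Fin.ext (by simp only [simpleIdx]; omega))
      rwa [h3] at h2
    intro i j hsum
    rcases le_total i j with hij | hij
    · exact key i j hij hsum
    · rw [endSp_pair_comm hω hA]
      exact key j i hij (by omega)

end TorusCoordinates

/-! ### Open cells and regular functions on the flag variety. -/

section FlagVariety

open AlgSpace

variable {V : Type*} [AddCommGroup V] [Module ℂ V] {ω : LinearMap.BilinForm ℂ V} {n : ℕ}

lemma isPolyMap_pi_of_forall {W W₁ ι : Type*} [AddCommGroup W] [Module ℂ W] [AddCommGroup W₁]
    [Module ℂ W₁] [Fintype ι] {φ : W → ι → W₁} (h : ∀ i, IsPolyMap fun w => φ w i) :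
    IsPolyMap φ := by
  classical
  have : φ = fun w => ∑ i, LinearMap.single ℂ (fun _ : ι => W₁) i (φ w i) := by
    ext w j
    simp [Finset.sum_apply, Pi.single_apply]
  rw [this]
  exact IsPolyMap.sum _ fun i _ => (isPolyMap_linear _).comp (h i)

lemma frameFlag_isAdapted (b : frames ω n) : IsAdapted b.1 (frameFlag ω n b) := b.2.choose_spec

lemma IsAdapted.unique {c : Fin (2 * n) → V} {F F' : IsotropicFlag ω n} (h : IsAdapted c F)
    (h' : IsAdapted c F') : F = F' :=
  IsotropicFlag.ext (funext fun i => (h i).trans (h' i).symm)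

lemma flagVariety_isAlg : (flagVariety ω n).IsAlg :=
  quotient_isAlg (quasiAffine_isLocal _).toIsAlg _

lemma leadingMinor_det_mem (ε : Fin (2 * n) → V) (i : Fin (2 * n + 1)) :
    (fun c => (leadingMinor ω ε c i).det) ∈ polyFun (Fin (2 * n) → V) :=
  det_mem_polyFun fun k j => dual_mem_polyFun (W := Fin (2 * n) → V)
    ((ω (ε k.1.rev)) ∘ₗ (LinearMap.proj j.1 : (Fin (2 * n) → V) →ₗ[ℂ] V))

lemma prod_leadingMinor_det_mem (ε : Fin (2 * n) → V) :
    (fun c => ∏ i, (leadingMinor ω ε c i).det) ∈ polyFun (Fin (2 * n) → V) := by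
  have := (polyFun (Fin (2 * n) → V)).prod_mem (t := Finset.univ)
    fun i _ => leadingMinor_det_mem (ω := ω) ε i
  convert this using 1
  ext c
  simp [Finset.prod_apply]

variable [FiniteDimensional ℂ V]

lemma setOf_oppTo_frameFlag (hV : Module.finrank ℂ V = 2 * n) (ε : Fin (2 * n) → V) :
    frameFlag ω n ⁻¹' {F | OppTo ε F} =
      {c : frames ω n | ∏ i, (leadingMinor ω ε c.1 i).det ≠ 0} := by
  ext c
  rw [Set.mem_preimage, Set.mem_ofPred_eq, oppTo_iff_det hV (frameFlag_isAdapted c),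
    Set.mem_ofPred_eq, Finset.prod_ne_zero_iff]
  simp

lemma isOpen_oppTo (hV : Module.finrank ℂ V = 2 * n) (ε : Fin (2 * n) → V) :
    (flagVariety ω n).top.IsOpen {F | OppTo ε F} := by
  show (quasiAffine (frames ω n)).top.IsOpen (frameFlag ω n ⁻¹' {F | OppTo ε F})
  rw [setOf_oppTo_frameFlag hV]
  exact isOpen_quasiAffine (prod_leadingMinor_det_mem ε)

/-- The symplectic basis of a flag opposite to a fixed flag depends algebraically on the flag. -/
lemma oppBasis_regularAt (hV : Module.finrank ℂ V = 2 * n) {ε : Fin (2 * n) → V}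
    (l : Module.Dual ℂ V) (i : Fin (2 * n)) {F : IsotropicFlag ω n} (hF : OppTo ε F) :
    (flagVariety ω n).RegularAt (fun F => l (oppBasis ε F i)) F := by
  intro x hx
  -- Cramer's rule: the coefficients of the opposite basis vector in a frame `c` solve a linear
  -- system with matrix `M c`, so on frames the function is a polynomial over a minor that is
  -- nonzero on the cell.
  let M : (Fin (2 * n) → V) → Matrix _ _ ℂ := fun c => leadingMinor ω ε c i.succ
  let rhs : {j : Fin (2 * n) // j.castSucc < i.succ} → ℂ := fun k =>
    if k.1 = i then sg n i.rev else 0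
  have hM : ∀ k j, (fun c => M c k j) ∈ polyFun (Fin (2 * n) → V) := fun k j =>
    dual_mem_polyFun (W := Fin (2 * n) → V)
    ((ω (ε k.1.rev)) ∘ₗ (LinearMap.proj j.1 : (Fin (2 * n) → V) →ₗ[ℂ] V))
  have hadj : ∀ k j, (fun c => (M c).adjugate k j) ∈ polyFun (Fin (2 * n) → V) := by
    intro k j
    simp only [Matrix.adjugate_apply]
    refine det_mem_polyFun fun k' j' => ?_
    by_cases h : k' = j
    · subst h
      simp only [Matrix.updateRow_self]
      exact const_mem_polyFun _
    · simp only [Matrix.updateRow_ne h]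
      exact hM k' j'
  let p : (Fin (2 * n) → V) → ℂ := fun c => ∑ j, ((M c).adjugate.mulVec rhs) j * l (c j)
  have hp : p ∈ polyFun (Fin (2 * n) → V) := by
    have h1 : IsPolyMap p := by
      refine IsPolyMap.sum _ fun j _ => ?_
      refine isPolyMap_iff_mem.2 ((polyFun _).mul_mem ?_
        (dual_mem_polyFun (W := Fin (2 * n) → V)
          (l ∘ₗ (LinearMap.proj j.1 : (Fin (2 * n) → V) →ₗ[ℂ] V))))
      simp only [Matrix.mulVec, dotProduct]
      refine isPolyMap_iff_mem.1 (IsPolyMap.sum _ fun k _ => isPolyMap_iff_mem.2 ?_)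
      exact (polyFun _).mul_mem (hadj j k) (const_mem_polyFun _)
    exact isPolyMap_iff_mem.1 h1
  have key : ∀ c : frames ω n, OppTo ε (frameFlag ω n c) →
      l (oppBasis ε (frameFlag ω n c) i) = p c * ((M c).det)⁻¹ := by
    intro c hc
    have hcF := frameFlag_isAdapted c
    have hdet : (M c).det ≠ 0 := (oppTo_iff_det hV hcF).1 hc i.succ
    set t : {j : Fin (2 * n) // j.castSucc < i.succ} → ℂ :=
      ((M c).det)⁻¹ • (M c).adjugate.mulVec rhs with ht
    have hMt : (M c).mulVec t = rhs := by
      rw [ht, Matrix.mulVec_smul, Matrix.mulVec_mulVec, Matrix.mul_adjugate, Matrix.smul_mulVec,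
        Matrix.one_mulVec, smul_smul, inv_mul_cancel₀ hdet, one_smul]
    have h1 : ∑ j, t j • c.1 j = oppBasis ε (frameFlag ω n c) i := by
      refine eq_oppBasis hc i (hcF.mem_space_iff.2 ⟨t, rfl⟩) fun k hk => ?_
      have h2 := congrFun hMt ⟨k, Fin.castSucc_lt_succ_iff.2 hk⟩
      simp only [rhs] at h2
      rw [← h2]
      simp [Matrix.mulVec, dotProduct, M, leadingMinor, mul_comm]
    rw [← h1, map_sum, Finset.sum_mul]
    refine Finset.sum_congr rfl fun j _ => ?_
    rw [map_smul, ht, Pi.smul_apply, smul_eq_mul, smul_eq_mul]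
    ring
  have hloc := quasiAffine_isLocal (frames ω n)
  have hopen := isOpen_quasiAffine (S := frames ω n) (prod_leadingMinor_det_mem (ω := ω) ε)
  rw [← setOf_oppTo_frameFlag hV] at hopen
  have hxF : OppTo ε (frameFlag ω n x) := by rw [hx]; exact hF
  refine hloc.congr (hloc.mul (regularAt_polyFun hp x) (hloc.inv
    (regularAt_polyFun (leadingMinor_det_mem ε i.succ) x) ?_)) hopen hxF fun c hc => (key c hc).symm
  exact (oppTo_iff_det hV (frameFlag_isAdapted x)).1 hxF i.succ

end FlagVariety

/-! ### The kernel flag map and its trivializations. -/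

section Fibration

open AlgSpace

variable {V : Type*} [AddCommGroup V] [Module ℂ V] [FiniteDimensional ℂ V]
  {ω : LinearMap.BilinForm ℂ V} {n : ℕ}

lemma mem_smoothLocus_nilCone (hω : ω.IsAlt) (hnd : ω.Nondegenerate)
    (hV : Module.finrank ℂ V = 2 * n) (hn : 1 ≤ n) {A : Module.End ℂ V} :
    A ∈ smoothLocus (nilCone ω n) ↔ A ∈ nilCone ω n ∧ A ^ (2 * n - 1) ≠ 0 := by
  constructor
  · intro h
    have hA : A ∈ nilCone ω n := h.1
    exact ⟨hA, (mem_smoothLocus_nilCone_iff hω hnd hV hn hA).1 h⟩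
  · rintro ⟨hA, h⟩
    exact (mem_smoothLocus_nilCone_iff hω hnd hV hn hA).2 h

/-- Near a given point the map lifts to frames by a polynomial formula, the iterates of a fixed
vector `v`, valid where a functional of `A ^ (2 * n - 1) v` is nonzero. Opens and regular functions
of the flag variety are tested on frames, so they pull back along this lift. -/
lemma isMorphism_kerFlag (hω : ω.IsAlt) (hnd : ω.Nondegenerate)
    (hV : Module.finrank ℂ V = 2 * n) (hn : 1 ≤ n)
    {π : smoothLocus (nilCone ω n) → IsotropicFlag ω n}
    (hπ : ∀ A i, (π A).space i = LinearMap.ker ((A : Module.End ℂ V) ^ (i : ℕ))) :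
    IsMorphism (quasiAffine (smoothLocus (nilCone ω n))) (flagVariety ω n) π := by
  have key : ∀ A₀ : smoothLocus (nilCone ω n), ∃ σ : Module.End ℂ V → Fin (2 * n) → V,
      IsPolyMap σ ∧ ∃ r ∈ polyFun (Module.End ℂ V), r A₀ ≠ 0 ∧
        ∀ A : smoothLocus (nilCone ω n), r A ≠ 0 →
          ∃ h : σ A ∈ frames ω n, frameFlag ω n ⟨σ A, h⟩ = π A := by
    intro A₀
    have hA₀ := (mem_smoothLocus_nilCone hω hnd hV hn).1 A₀.2
    obtain ⟨v, hv⟩ : ∃ v, ((A₀ : Module.End ℂ V) ^ (2 * n - 1)) v ≠ 0 := by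
      by_contra! h
      exact hA₀.2 (LinearMap.ext h)
    obtain ⟨l, hl⟩ : ∃ l : Module.Dual ℂ V, l (((A₀ : Module.End ℂ V) ^ (2 * n - 1)) v) ≠ 0 := by
      by_contra! h'
      exact hv ((Module.forall_dual_apply_eq_zero_iff ℂ _).1 h')
    have hpow : ∀ k : ℕ, IsPolyMap fun A : Module.End ℂ V => (A ^ k) v := fun k =>
      (isPolyMap_id.pow k).apply (isPolyMap_const v)
    refine ⟨fun A i => (A ^ (2 * n - 1 - i : ℕ)) v, isPolyMap_pi_of_forall fun i => hpow _,
      fun A => l ((A ^ (2 * n - 1)) v), hpow _ l, hl, fun A hA => ?_⟩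
    have hAv : ((A : Module.End ℂ V) ^ (2 * n - 1)) v ≠ 0 := fun h => hA (by
      show l _ = 0
      rw [h, map_zero])
    have hAN := (mem_smoothLocus_nilCone hω hnd hV hn).1 A.2
    have had := isAdapted_pow hAN.1.2 (hπ A) hAv
    exact ⟨⟨_, had⟩, (frameFlag_isAdapted ⟨_, ⟨_, had⟩⟩).unique had⟩
  refine ⟨continuous_def.2 fun U hU => isOpen_of_forall _ fun A₀ hA₀ => ?_, fun A₀ g hg => ?_⟩
  · obtain ⟨σ, hσ, r, hr, hr0, hrA⟩ := key A₀
    obtain ⟨h0, h0'⟩ := hrA A₀ hr0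
    obtain ⟨p, hp, hp0, hpU⟩ := exists_polyFun_of_isOpen (S := frames ω n)
      (U := frameFlag ω n ⁻¹' U) hU (s := ⟨σ A₀, h0⟩) (by rw [Set.mem_preimage, h0']; exact hA₀)
    refine ⟨_, isOpen_quasiAffine ((polyFun _).mul_mem (hσ.comp_mem hp) hr), mul_ne_zero hp0 hr0,
      fun A hA => ?_⟩
    obtain ⟨h1, h1'⟩ := hrA A (right_ne_zero_of_mul hA)
    have := hpU ⟨σ A, h1⟩ (left_ne_zero_of_mul hA)
    rwa [Set.mem_preimage, h1'] at this
  · obtain ⟨σ, hσ, r, hr, hr0, hrA⟩ := key A₀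
    obtain ⟨h0, h0'⟩ := hrA A₀ hr0
    obtain ⟨p, hp, q, hq, hq0, hpq⟩ := hg ⟨σ A₀, h0⟩ h0'
    refine ⟨_, (polyFun _).mul_mem (hσ.comp_mem hp) hr, _, (polyFun _).mul_mem (hσ.comp_mem hq) hr,
      mul_ne_zero hq0 hr0, fun A hA => ?_⟩
    have hrA0 := right_ne_zero_of_mul hA
    obtain ⟨h1, h1'⟩ := hrA A hrA0
    have := hpq ⟨σ A, h1⟩ (left_ne_zero_of_mul hA)
    rw [Function.comp_apply, h1'] at this
    rw [Function.comp_apply, this]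
    simp only [Pi.mul_apply]
    rw [mul_div_mul_right _ _ hrA0]

/-- A regular element shifts no flag but its kernel flag; membership in a fibre thus becomes a
linear condition on `A`. -/
lemma kerFlag_eq_iff (hω : ω.IsAlt) (hnd : ω.Nondegenerate)
    (hV : Module.finrank ℂ V = 2 * n) (hn : 1 ≤ n)
    {π : smoothLocus (nilCone ω n) → IsotropicFlag ω n}
    (hπ : ∀ A i, (π A).space i = LinearMap.ker ((A : Module.End ℂ V) ^ (i : ℕ)))
    {A : smoothLocus (nilCone ω n)} {F : IsotropicFlag ω n} :
    π A = F ↔ Shifts (A : Module.End ℂ V) F := by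
  constructor
  · rintro rfl
    exact shifts_of_ker (hπ A)
  · intro h
    refine IsotropicFlag.ext (funext fun i => ?_)
    rw [hπ, h.space_eq hV ((mem_smoothLocus_nilCone hω hnd hV hn).1 A.2).2]

lemma flagElem_mem_smoothLocus (hω : ω.IsAlt) (hnd : ω.Nondegenerate)
    (hV : Module.finrank ℂ V = 2 * n) (hn : 1 ≤ n) {b : Fin (2 * n) → V} (hb : IsSympBasis ω b)
    {F : IsotropicFlag ω n} (hF : IsAdapted b F) {z} (hz : z ∈ torusTimesAffine n) :
    flagElem ω b z ∈ smoothLocus (nilCone ω n) := by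
  have hs := hb.shifts_flagElem hV hF z
  refine (mem_smoothLocus_nilCone hω hnd hV hn).2
    ⟨⟨flagElem_mem hω b z, hs.pow_eq_zero hV⟩, ?_⟩
  rw [hb.regular_iff_flagCoord hω hV hn hF (flagElem_mem hω b z) hs, hb.flagCoord_flagElem]
  exact hz

lemma flagCoord_mem_torus (hω : ω.IsAlt) (hnd : ω.Nondegenerate)
    (hV : Module.finrank ℂ V = 2 * n) (hn : 1 ≤ n) {b : Fin (2 * n) → V} (hb : IsSympBasis ω b)
    {F : IsotropicFlag ω n} (hF : IsAdapted b F) {A : Module.End ℂ V}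
    (hA : A ∈ smoothLocus (nilCone ω n)) (hAF : Shifts A F) :
    flagCoord ω b A ∈ torusTimesAffine n := by
  have h := (mem_smoothLocus_nilCone hω hnd hV hn).1 hA
  exact (hb.regular_iff_flagCoord hω hV hn hF h.1.1 hAF).1 h.2

/-- The fibres of the flag map are products of a torus and an affine space. -/
lemma exists_fibre_iso (hω : ω.IsAlt) (hnd : ω.Nondegenerate)
    (hV : Module.finrank ℂ V = 2 * n) (hn : 1 ≤ n)
    {π : smoothLocus (nilCone ω n) → IsotropicFlag ω n}
    (hπ : ∀ A i, (π A).space i = LinearMap.ker ((A : Module.End ℂ V) ^ (i : ℕ)))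
    (F : IsotropicFlag ω n) : ∃ e : ↥(π ⁻¹' {F}) ≃ ↥(torusTimesAffine n),
      IsIso ((quasiAffine (smoothLocus (nilCone ω n))).restrict (π ⁻¹' {F}))
        (quasiAffine (torusTimesAffine n)) e := by
  obtain ⟨b, hb, hbF⟩ := exists_adapted_isSympBasis hω hnd hV F
  have hπF : ∀ A : ↥(π ⁻¹' {F}), Shifts (A.1 : Module.End ℂ V) F := fun A =>
    (kerFlag_eq_iff hω hnd hV hn hπ).1 A.2
  let e : ↥(π ⁻¹' {F}) ≃ ↥(torusTimesAffine n) :=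
    { toFun := fun A => ⟨flagCoord ω b A.1.1, flagCoord_mem_torus hω hnd hV hn hb hbF A.1.2 (hπF A)⟩
      invFun := fun z => ⟨⟨flagElem ω b z.1, flagElem_mem_smoothLocus hω hnd hV hn hb hbF z.2⟩,
        (kerFlag_eq_iff hω hnd hV hn hπ).2 (hb.shifts_flagElem hV hbF z.1)⟩
      left_inv := fun A => Subtype.ext (Subtype.ext (hb.flagElem_flagCoord hω hV hbF
        ((mem_smoothLocus_nilCone hω hnd hV hn).1 A.1.2).1.1 (hπF A)))
      right_inv := fun z => Subtype.ext (hb.flagCoord_flagElem z.1) }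
  have hloc := restrict_isLocal (quasiAffine_isLocal (smoothLocus (nilCone ω n))) (π ⁻¹' {F})
  refine ⟨e, isMorphism_quasiAffine hloc fun l A => ?_, isMorphism_codRestrict
    (quasiAffine_isLocal _) (isMorphism_quasiAffine (quasiAffine_isLocal _) fun l z => ?_)⟩
  · refine hloc.dual_comp (φ := fun A : ↥(π ⁻¹' {F}) => fun p : CoordIdx n (2 * n - 1) =>
      ω (b p.1.1.rev) (A.1.1 (b p.1.2.rev))) (fun p => ?_) (l ∘ₗ (torusCoord n).toLinearMap)
    exact RegularAt.restrict (regularAt_polyFun (S := smoothLocus (nilCone ω n))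
      (dual_mem_polyFun ((ω (b p.1.1.rev)) ∘ₗ (LinearMap.applyₗ (b p.1.2.rev)))) A.1)
  · exact regularAt_polyFun (isPolyMap_flagElem (ω := ω) b l) z

/-- The flag map is trivial over the flags opposite to a fixed one. -/
lemma isFibration_kerFlag (hω : ω.IsAlt) (hnd : ω.Nondegenerate)
    (hV : Module.finrank ℂ V = 2 * n) (hn : 1 ≤ n)
    {π : smoothLocus (nilCone ω n) → IsotropicFlag ω n}
    (hπ : ∀ A i, (π A).space i = LinearMap.ker ((A : Module.End ℂ V) ^ (i : ℕ))) :
    IsFibration (quasiAffine (smoothLocus (nilCone ω n))) (flagVariety ω n)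
      (quasiAffine (torusTimesAffine n)) π := by
  have hmor := isMorphism_kerFlag hω hnd hV hn hπ
  refine ⟨hmor, fun F₀ => ?_⟩
  obtain ⟨ε, hε, hεF⟩ := exists_adapted_isSympBasis hω hnd hV F₀
  set U : Set (IsotropicFlag ω n) := {F | OppTo ε F} with hU
  refine ⟨U, isOpen_oppTo hV ε, oppTo_self hV hε hεF, ?_⟩
  have hb : ∀ F ∈ U, IsSympBasis ω (oppBasis ε F) := fun F hF => oppBasis_isSympBasis hω hV hε hF
  have hbF : ∀ F ∈ U, IsAdapted (oppBasis ε F) F := fun F hF => oppBasis_isAdapted hF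
  have hπA : ∀ A : smoothLocus (nilCone ω n), Shifts (A : Module.End ℂ V) (π A) := fun A =>
    (kerFlag_eq_iff hω hnd hV hn hπ).1 rfl
  have hmem : ∀ p : ↥U × ↥(torusTimesAffine n),
      flagElem ω (oppBasis ε p.1.1) p.2.1 ∈ smoothLocus (nilCone ω n) := fun p =>
    flagElem_mem_smoothLocus hω hnd hV hn (hb _ p.1.2) (hbF _ p.1.2) p.2.2
  have hπe : ∀ p : ↥U × ↥(torusTimesAffine n), π ⟨_, hmem p⟩ = p.1.1 := fun p =>
    (kerFlag_eq_iff hω hnd hV hn hπ).2 ((hb _ p.1.2).shifts_flagElem hV (hbF _ p.1.2) p.2.1)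
  -- The trivialization takes coordinates in the symplectic basis `oppBasis`, which varies with the
  -- kernel flag.
  let e : ↥(π ⁻¹' U) ≃ ↥U × ↥(torusTimesAffine n) :=
    { toFun := fun A => (⟨π A.1, A.2⟩, ⟨flagCoord ω (oppBasis ε (π A.1)) A.1.1,
        flagCoord_mem_torus hω hnd hV hn (hb _ A.2) (hbF _ A.2) A.1.2 (hπA A.1)⟩)
      invFun := fun p => ⟨⟨_, hmem p⟩, by rw [Set.mem_preimage, hπe]; exact p.1.2⟩
      left_inv := fun A => Subtype.ext (Subtype.ext ((hb _ A.2).flagElem_flagCoord hω hV (hbF _ A.2)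
        ((mem_smoothLocus_nilCone hω hnd hV hn).1 A.1.2).1.1 (hπA A.1)))
      right_inv := fun p => by
        refine Prod.ext (Subtype.ext (hπe p)) (Subtype.ext ?_)
        simp only
        rw [hπe p]
        exact (hb _ p.1.2).flagCoord_flagElem p.2.1 }
  have hloc := restrict_isLocal (quasiAffine_isLocal (smoothLocus (nilCone ω n))) (π ⁻¹' U)
  have hUalg := restrict_isAlg (flagVariety_isAlg (ω := ω) (n := n)) U
  have hTalg := (quasiAffine_isLocal (torusTimesAffine n)).toIsAlg
  let β := Module.finBasis ℂ V
  refine ⟨e, ⟨isMorphism_prodMk hloc (hmor.restrict U) (isMorphism_quasiAffine hloc fun l A => ?_),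
    isMorphism_of_isTensorOn hUalg hTalg fun l => ?_⟩, fun A => rfl⟩
  · refine hloc.dual_comp (φ := fun A : ↥(π ⁻¹' U) => fun p : CoordIdx n (2 * n - 1) =>
      ω (oppBasis ε (π A.1) p.1.1.rev) (A.1.1 (oppBasis ε (π A.1) p.1.2.rev))) (fun p => ?_)
      (l ∘ₗ (torusCoord n).toLinearMap)
    -- A fixed basis of `V` separates the dependence on the flag, through the coordinates of the
    -- moving basis, from the dependence on the matrix entries of `A`.
    have hexp : ∀ (X : Module.End ℂ V) (u w : V), ω u (X w) =
        ∑ k, ∑ m, β.coord k u * β.coord m w * ω (β k) (X (β m)) := by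
      intro X u w
      conv_lhs => rw [← β.sum_repr u, ← β.sum_repr w]
      simp only [map_sum, map_smul, LinearMap.sum_apply, LinearMap.smul_apply, smul_eq_mul,
        Module.Basis.coord_apply, Finset.mul_sum]
      rw [Finset.sum_comm]
      refine Finset.sum_congr rfl fun k _ => Finset.sum_congr rfl fun m _ => ?_
      ring
    have hcoord : ∀ k i, ((quasiAffine (smoothLocus (nilCone ω n))).restrict (π ⁻¹' U)).RegularAt
        (fun A : ↥(π ⁻¹' U) => β.coord k (oppBasis ε (π A.1) i)) A := fun k i =>
      RegularAt.restrict (hmor.2 A.1 _ (oppBasis_regularAt hV (β.coord k) i A.2))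
    rw [show (fun A : ↥(π ⁻¹' U) => ω (oppBasis ε (π A.1) p.1.1.rev)
        (A.1.1 (oppBasis ε (π A.1) p.1.2.rev))) = _ from funext fun A => hexp _ _ _]
    refine hloc.sum _ fun k _ => hloc.sum _ fun m _ => hloc.mul (hloc.mul (hcoord _ _) (hcoord _ _)) ?_
    exact RegularAt.restrict (regularAt_polyFun (S := smoothLocus (nilCone ω n))
      (dual_mem_polyFun ((ω (β k)) ∘ₗ (LinearMap.applyₗ (β m)))) A.1)
  · have hexp : ∀ u w : V, l (symEnd ω u w) =
        ∑ k, ∑ m, β.coord k u * β.coord m w * l (symEnd ω (β k) (β m)) := by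
      intro u w
      conv_lhs => rw [← β.sum_repr u, ← β.sum_repr w]
      simp only [map_sum, map_smul, LinearMap.sum_apply, LinearMap.smul_apply, smul_eq_mul,
        Module.Basis.coord_apply, Finset.mul_sum]
      rw [Finset.sum_comm]
      refine Finset.sum_congr rfl fun k _ => Finset.sum_congr rfl fun m _ => ?_
      ring
    have hcoord : ∀ k i, IsTensorOn ((flagVariety ω n).restrict U)
        (quasiAffine (torusTimesAffine n)) Set.univ Set.univ
        (fun p => β.coord k (oppBasis ε p.1.1 i)) := fun k i =>
      isTensorOn_fst hTalg (a := fun F : ↥U => β.coord k (oppBasis ε F.1 i)) fun F _ =>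
        RegularAt.restrict (oppBasis_regularAt hV (β.coord k) i F.2)
    have hconst : ∀ c : ℂ, IsTensorOn ((flagVariety ω n).restrict U)
        (quasiAffine (torusTimesAffine n)) Set.univ Set.univ (fun _ => c) := fun c =>
      isTensorOn_fst hTalg (a := fun _ => c) fun F _ => hUalg.const c F
    show IsTensorOn _ _ _ _ fun p : ↥U × ↥(torusTimesAffine n) =>
      l (flagElem ω (oppBasis ε p.1.1) p.2.1)
    -- The inverse is written as a sum of products of functions of the flag and functions of `z`, as
    -- a morphism out of a product requires.
    have hfun : (fun p : ↥U × ↥(torusTimesAffine n) => l (flagElem ω (oppBasis ε p.1.1) p.2.1)) =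
        fun p => ∑ i, ∑ j, (-(1 / 2) * (sg n i * sg n j) *
          symExt ((torusCoord n).symm p.2.1) i j) *
            ∑ k, ∑ m, β.coord k (oppBasis ε p.1.1 i) * β.coord m (oppBasis ε p.1.1 j) *
              l (symEnd ω (β k) (β m)) := by
      funext p
      simp only [flagElem, ofCoord, map_sum, map_smul, smul_eq_mul]
      exact Finset.sum_congr rfl fun i _ => Finset.sum_congr rfl fun j _ => by
        rw [hexp (oppBasis ε p.1.1 i)]
    rw [hfun]
    refine IsTensorOn.sum hUalg hTalg _ fun i _ => IsTensorOn.sum hUalg hTalg _ fun j _ =>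
      IsTensorOn.mul hUalg hTalg (IsTensorOn.mul hUalg hTalg (hconst _) ?_)
      (IsTensorOn.sum hUalg hTalg _ fun k _ => IsTensorOn.sum hUalg hTalg _ fun m _ =>
        IsTensorOn.mul hUalg hTalg (IsTensorOn.mul hUalg hTalg (hcoord _ _) (hcoord _ _)) (hconst _))
    exact isTensorOn_snd hUalg (b := fun z : ↥(torusTimesAffine n) =>
      symExt ((torusCoord n).symm z.1) i j) fun z _ => regularAt_polyFun (isPolyMap_symExt i j) z

end Fibration

end SympCone

theorem lemma5p1 {V : Type*} [AddCommGroup V] [Module ℂ V] [FiniteDimensional ℂ V]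
    (n : ℕ) (hn : 1 ≤ n) (hV : Module.finrank ℂ V = 2 * n)
    (ω : LinearMap.BilinForm ℂ V) (hω : ω.IsAlt) (hnd : ω.Nondegenerate) :
    -- the cone is a (closed, irreducible) algebraic variety of dimension `2 * n ^ 2`
    (@IsClosed _ (SympCone.zariski (Module.End ℂ V)) (SympCone.nilCone ω n) ∧
      @IsIrreducible _ (SympCone.zariski (Module.End ℂ V)) (SympCone.nilCone ω n) ∧
      ringKrullDim (SympCone.coordRing (SympCone.nilCone ω n)) = ((2 * n ^ 2 : ℕ) : WithBot ℕ∞)) ∧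
    -- equations of the cone
    (∀ A ∈ SympCone.endSp ω, A ∈ SympCone.nilCone ω n ↔
      ∀ r : ℕ, 1 ≤ r → r ≤ n → LinearMap.trace ℂ V (A ^ (2 * r)) = 0) ∧
    -- its smooth points
    (∀ A ∈ SympCone.nilCone ω n, A ∈ SympCone.smoothLocus (SympCone.nilCone ω n) ↔
      Module.finrank ℂ (LinearMap.range A) = 2 * n - 1) ∧
    -- the fibration of the smooth locus over the flag variety
    ∃ π : ↥(SympCone.smoothLocus (SympCone.nilCone ω n)) → SympCone.IsotropicFlag ω n,
      (∀ A i, (π A).space i = LinearMap.ker ((A : Module.End ℂ V) ^ (i : ℕ))) ∧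
      SympCone.AlgSpace.IsFibration
        (SympCone.AlgSpace.quasiAffine (SympCone.smoothLocus (SympCone.nilCone ω n)))
        (SympCone.flagVariety ω n)
        (SympCone.AlgSpace.quasiAffine (SympCone.torusTimesAffine n)) π ∧
      ∀ F : SympCone.IsotropicFlag ω n, ∃ e : ↥(π ⁻¹' {F}) ≃ ↥(SympCone.torusTimesAffine n),
        SympCone.AlgSpace.IsIso
          ((SympCone.AlgSpace.quasiAffine
            (SympCone.smoothLocus (SympCone.nilCone ω n))).restrict (π ⁻¹' {F}))
          (SympCone.AlgSpace.quasiAffine (SympCone.torusTimesAffine n)) e := by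
  open SympCone in
  refine ⟨⟨nilCone_isClosed hω hnd hV, nilCone_isIrreducible hω hnd hV hn,
      ringKrullDim_nilCone hω hnd hV hn⟩, fun A hA => mem_nilCone_iff_trace hω hnd hV hA,
    fun A hA => (mem_smoothLocus_nilCone_iff hω hnd hV hn hA).trans
      (finrank_range_eq_iff (by omega) hV hA.2).symm, ?_⟩
  open SympCone in
  choose π hπ using fun A : ↥(smoothLocus (nilCone ω n)) =>
    exists_kerFlag hnd hV ((mem_smoothLocus_nilCone hω hnd hV hn).1 A.2).1
      ((mem_smoothLocus_nilCone hω hnd hV hn).1 A.2).2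
  open SympCone in
  exact ⟨π, hπ, isFibration_kerFlag hω hnd hV hn hπ, exists_fibre_iso hω hnd hV hn hπ⟩
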